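/- Let $T(s,t,u)=\sum_{m,n\ge 1} m^{-s}n^{-t}(m+n)^{-u}$, absolutely convergent for $\Re(s+u)>1$, $\Re(t+u)>1$, $\Re(s+t+u)>2$. It continues (uniquely) to a holomorphic function, also denoted $T$, on the complement in $\mathbb C^3$ of the hyperplanes $s+u\in\mathbb Z_{\le 1}$, $t+u\in\mathbb Z_{\le1}$, $s+t+u=2$. Put $$S_3(s,t,u)=T(s,t,u)+T(u,s,t)+T(t,u,s),\qquad S_4(s,t,u)=-T(s,t,u)+T(u,s,t)+T(t,u,s),$$ $$\Gamma_{\cos}(s)=\frac{2\Gamma(s)}{(2\pi)^s}\cos\frac{\pi s}{2},\qquad \Gamma_{\sin}(s)=\frac{2\Gamma(s)}{(2\pi)^s}\sin\frac{\pi s}{2},\qquad \eta_k(s)=2^{-k}\binom{k-s}{k}\zeta(k+1-s)\quad(k\ge 0),$$ $$G_{ccc}(s,t,u)=\frac{4}{\Gamma_{\cos}(s)\Gamma_{\cos}(t)\Gamma_{\cos}(u)},\qquad G_{ssc}(s,t,u)=\frac{4}{\Gamma_{\sin}(s)\Gamma_{\sin}(t)\Gamma_{\cos}(u)},$$ where $\Gamma_{\cos}$,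 $\Gamma_{\sin}$ and $\eta_k$ take their limit values at removable singularities. Let $\mathbb Z^{od}_{\le1}$ be the set of odd integers $\le 1$ and $\mathbb Z^{ev}_{\le0}$ the set of even integers $\le0$. A point is called a true singularity of a function holomorphic off a union of hyperplanes if the function does not continue holomorphically to any neighbourhood of the point. (1) $S_3$ continues holomorphically to the set of all $(s,t,u)\in\mathbb C^3$ with $s+t,\ t+u,\ u+s\notin\mathbb Z^{od}_{\le1}$ and $s+t+u\ne2$, and every point outside this set is a true singularity of $S_3$. On this set $$\begin{aligned}S_3(s,t,u)=G_{ccc}(s,t,u)\Biggl\{&\frac{2^{-s-t-u}}{s+t+u-2}+\sum_{l,m,n\ge0}\frac{\eta_{2l}(s)\eta_{2m}(t)\eta_{2n}(u)}{2l+2m+2n+1}\\ &+\sum_{l,m\ge0}\frac{2^{-u}\eta_{2l}(s)\eta_{2m}(t)}{u+2l+2m}+\sum_{m,n\ge0}\frac{2^{-s}\eta_{2m}(t)\eta_{2n}(u)}{s+2m+2n}+\sum_{n,l\ge0}\frac{2^{-t}\eta_{2n}(u)\eta_{2l}(s)}{t+2n+2l}\\ &+\sum_{l\ge0}\frac{2^{-t-u}\eta_{2l}(s)}{t+u+2l-1}+\sum_{m\ge0}\frac{2^{-u-s}\eta_{2m}(t)}{u+s+2m-1}+\sum_{n\ge0}\frac{2^{-s-t}\eta_{2n}(u)}{s+t+2n-1}\Biggr\}.\end{aligned}$$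 The equation holds literally if none of $s,t,u$ is a zero ($1,3,5,\dots$) or a pole ($0,-2,-4,\dots$) of $\Gamma_{\cos}$; at the remaining points of the set the right-hand side has a removable singularity and the equation holds by continuity. (2) $S_4$ continues holomorphically to the set of all $(s,t,u)\in\mathbb C^3$ with $s+t\notin\mathbb Z^{od}_{\le1}$, $t+u,\ u+s\notin\mathbb Z^{ev}_{\le0}$ and $s+t+u\ne2$, and every point outside this set is a true singularity of $S_4$. On this set $$\begin{aligned}S_4(s,t,u)=G_{ssc}(s,t,u)\Biggl\{&\frac{2^{-s-t-u}}{s+t+u-2}+\sum_{l,m,n\ge0}\frac{\eta_{2l+1}(s)\eta_{2m+1}(t)\eta_{2n}(u)}{2l+2m+2n+3}\\ &+\sum_{l,m\ge0}\frac{2^{-u}\eta_{2l+1}(s)\eta_{2m+1}(t)}{u+2l+2m+2}-\sum_{m,n\ge0}\frac{2^{-s}\eta_{2m+1}(t)\eta_{2n}(u)}{s+2m+2n+1}-\sum_{n,l\ge0}\frac{2^{-t}\eta_{2n}(u)\eta_{2l+1}(s)}{t+2n+2l+1}\\ &-\sum_{l\ge0}\frac{2^{-t-u}\eta_{2l+1}(s)}{t+u+2l}-\sum_{m\ge0}\frac{2^{-u-s}\eta_{2m+1}(t)}{u+s+2m}+\sum_{n\ge0}\frac{2^{-s-t}\eta_{2n}(u)}{s+t+2n-1}\Biggr\}.\end{aligned}$$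 The equation holds literally if neither $s$ nor $t$ is a zero ($2,4,6,\dots$) or a pole ($-1,-3,-5,\dots$) of $\Gamma_{\sin}$ and $u$ is neither a zero nor a pole of $\Gamma_{\cos}$; at the remaining points of the set the right-hand side has a removable singularity and the equation holds by continuity. In (1) and (2), wherever the equation holds literally, all the series converge absolutely and rapidly: for every $r>1/4$ the terms are $O(r^{l+m+n})$, $O(r^{l+m})$ (with the two indices of the double series), $O(r^{l})$ (with the index of the simple series), respectively. -/

import Mathlib

open Filter Topology

namespace Tornheim

noncomputable section

/-! ### Sets of integers, seen in `ℂ` -/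

/-- The integers `≤ 1`. -/
def intLEOne : Set ℂ := {z | ∃ n : ℤ, n ≤ 1 ∧ z = n}

/-- The odd integers `≤ 1`. -/
def oddLEOne : Set ℂ := {z | ∃ n : ℤ, n ≤ 1 ∧ Odd n ∧ z = n}

/-- The even integers `≤ 0`. -/
def evenLEZero : Set ℂ := {z | ∃ n : ℤ, n ≤ 0 ∧ Even n ∧ z = n}

/-! ### The Tornheim double zeta function -/

/-- The region of absolute convergence of the double series; points are `(s, t, u)`. -/
def convRegion : Set (ℂ × ℂ × ℂ) :=
  {p | 1 < (p.1 + p.2.2).re ∧ 1 < (p.2.1 + p.2.2).re ∧ 2 < (p.1 + p.2.1 + p.2.2).re}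

/-- The summand `1 / (m ^ s n ^ t (m + n) ^ u)` with `m = k.1 + 1` and `n = k.2 + 1`. -/
def tornheimTerm (s t u : ℂ) (k : ℕ × ℕ) : ℂ :=
  1 / (((k.1 : ℂ) + 1) ^ s * ((k.2 : ℂ) + 1) ^ t * ((k.1 : ℂ) + 1 + ((k.2 : ℂ) + 1)) ^ u)

/-- The complement of the polar hyperplanes of the continued double series. It is open and
connected, so that a holomorphic function on it is determined by its values on `convRegion`. -/
def tornheimDomain : Set (ℂ × ℂ × ℂ) :=
  {p | p.1 + p.2.2 ∉ intLEOne ∧ p.2.1 + p.2.2 ∉ intLEOne ∧ p.1 + p.2.1 + p.2.2 ≠ 2}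

/-- `T` is the continuation of the Tornheim double series: it is holomorphic off the polar
hyperplanes and is the sum of the (absolutely convergent) double series in `convRegion`. -/
def IsTornheim (T : ℂ × ℂ × ℂ → ℂ) : Prop :=
  DifferentiableOn ℂ T tornheimDomain ∧
    ∀ s t u : ℂ, (s, t, u) ∈ convRegion → HasSum (tornheimTerm s t u) (T (s, t, u))

/-- All of `(s, t, u)`, `(u, s, t)`, `(t, u, s)` are in the domain of the continued series. -/
def InCyclicDomain (s t u : ℂ) : Prop :=
  (s, t, u) ∈ tornheimDomain ∧ (u, s, t) ∈ tornheimDomain ∧ (t, u, s) ∈ tornheimDomain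

/-! ### Singularities of holomorphic functions on open subsets of `ℂ³` -/

/-- `p` is a true (that is, not removable) singularity of the function `f`, holomorphic on `U`:
`f` does not continue holomorphically to any neighbourhood of `p`. -/
def IsTrueSingularity (f : ℂ × ℂ × ℂ → ℂ) (U : Set (ℂ × ℂ × ℂ)) (p : ℂ × ℂ × ℂ) : Prop :=
  ¬ ∃ (V : Set (ℂ × ℂ × ℂ)) (g : ℂ × ℂ × ℂ → ℂ), IsOpen V ∧ p ∈ V ∧
    DifferentiableOn ℂ g V ∧ Set.EqOn g f (V ∩ U)

/-! ### The special functions -/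

/-- The value of `f` at `s` by continuity: it is `f s` where `f` is continuous, and the limit of
`f` where `f` has a removable singularity (and meaningless where `f` has no limit). -/
def valueAt (f : ℂ → ℂ) (s : ℂ) : ℂ := limUnder (𝓝[≠] s) f

/-- `η_k^+ (s) = 2 ^ (-k) * binom (k - s) k * ζ (k + 1 - s)`, holomorphic for all `s` if `1 ≤ k`,
and for `s ≠ 0` if `k = 0`. -/
def eta (k : ℕ) (s : ℂ) : ℂ :=
  valueAt (fun z => ((2 : ℂ) ^ k)⁻¹ * Ring.choose ((k : ℂ) - z) k * riemannZeta ((k : ℂ) + 1 - z)) s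

/-- `Γ_cos (s) = 2 Γ(s) (2π) ^ (-s) cos (π s / 2)`, with simple poles at `0, -2, -4, …`. -/
def gammaCos (s : ℂ) : ℂ :=
  valueAt (fun z => 2 * Complex.Gamma z / (2 * (Real.pi : ℂ)) ^ z * Complex.cos (Real.pi * z / 2)) s

/-- `Γ_sin (s) = 2 Γ(s) (2π) ^ (-s) sin (π s / 2)`, with simple poles at `-1, -3, -5, …`. -/
def gammaSin (s : ℂ) : ℂ :=
  valueAt (fun z => 2 * Complex.Gamma z / (2 * (Real.pi : ℂ)) ^ z * Complex.sin (Real.pi * z / 2)) s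

/-- The poles (`0, -2, -4, …`) and zeros (`1, 3, 5, …`) of `gammaCos`. -/
def cosExceptional : Set ℂ := {z | ∃ n : ℤ, (n ≤ 0 ∧ Even n ∨ 0 < n ∧ Odd n) ∧ z = n}

/-- The poles (`-1, -3, -5, …`) and zeros (`2, 4, 6, …`) of `gammaSin`. -/
def sinExceptional : Set ℂ := {z | ∃ n : ℤ, (n < 0 ∧ Odd n ∨ 0 < n ∧ Even n) ∧ z = n}

def Gccc (s t u : ℂ) : ℂ := 4 / (gammaCos s * gammaCos t * gammaCos u)

def Gssc (s t u : ℂ) : ℂ := 4 / (gammaSin s * gammaSin t * gammaCos u)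

/-! ### The series -/

/-- `k ↦ η_{2k}^+ (s)`. -/
def etaEven (s : ℂ) (k : ℕ) : ℂ := eta (2 * k) s

/-- `k ↦ η_{2k+1}^+ (s)`. -/
def etaOdd (s : ℂ) (k : ℕ) : ℂ := eta (2 * k + 1) s

/-- `(l, m, n) ↦ a_l b_m c_n / (2l + 2m + 2n + d)`. -/
def tripleTerm (a b c : ℕ → ℂ) (d : ℂ) (k : ℕ × ℕ × ℕ) : ℂ :=
  a k.1 * b k.2.1 * c k.2.2 / (2 * k.1 + 2 * k.2.1 + 2 * k.2.2 + d)

/-- `(l, m) ↦ 2 ^ (-w) a_l b_m / (d + 2l + 2m)`. -/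
def doubleTerm (a b : ℕ → ℂ) (w d : ℂ) (k : ℕ × ℕ) : ℂ :=
  (2 : ℂ) ^ (-w) * a k.1 * b k.2 / (d + 2 * k.1 + 2 * k.2)

/-- `l ↦ 2 ^ (-w) a_l / (d + 2l)`. -/
def singleTerm (a : ℕ → ℂ) (w d : ℂ) (k : ℕ) : ℂ :=
  (2 : ℂ) ^ (-w) * a k / (d + 2 * k)

/-- The family `f` is summable, and its terms decay geometrically in the weight `wt`, with every
ratio `r > 1 / 4`. -/
def ConvergesRapidly {ι : Type} (wt : ι → ℕ) (f : ι → ℂ) : Prop :=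
  Summable f ∧ ∀ r : ℝ, 1 / 4 < r → ∃ C : ℝ, ∀ i, ‖f i‖ ≤ C * r ^ wt i

def weight3 (k : ℕ × ℕ × ℕ) : ℕ := k.1 + k.2.1 + k.2.2

def weight2 (k : ℕ × ℕ) : ℕ := k.1 + k.2

/-! ### The sum `T(s,t,u) + T(u,s,t) + T(t,u,s)` -/

def regularSet3 : Set (ℂ × ℂ × ℂ) :=
  {p | p.1 + p.2.1 ∉ oddLEOne ∧ p.2.1 + p.2.2 ∉ oddLEOne ∧ p.2.2 + p.1 ∉ oddLEOne ∧
    p.1 + p.2.1 + p.2.2 ≠ 2}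

/-- The points where no single factor or term of `expansion3` has a pole in `s`, `t` or `u`
alone. -/
def genericSet3 : Set (ℂ × ℂ × ℂ) :=
  {p | p.1 ∉ cosExceptional ∧ p.2.1 ∉ cosExceptional ∧ p.2.2 ∉ cosExceptional}

def expansion3 (s t u : ℂ) : ℂ :=
  Gccc s t u *
    ((2 : ℂ) ^ (-s - t - u) / (s + t + u - 2)
      + ∑' k, tripleTerm (etaEven s) (etaEven t) (etaEven u) 1 k
      + ∑' k, doubleTerm (etaEven s) (etaEven t) u u k
      + ∑' k, doubleTerm (etaEven t) (etaEven u) s s k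
      + ∑' k, doubleTerm (etaEven u) (etaEven s) t t k
      + ∑' k, singleTerm (etaEven s) (t + u) (t + u - 1) k
      + ∑' k, singleTerm (etaEven t) (u + s) (u + s - 1) k
      + ∑' k, singleTerm (etaEven u) (s + t) (s + t - 1) k)

/-- All seven series in `expansion3` converge rapidly. -/
def RapidExpansion3 (s t u : ℂ) : Prop :=
  ConvergesRapidly weight3 (tripleTerm (etaEven s) (etaEven t) (etaEven u) 1) ∧
  ConvergesRapidly weight2 (doubleTerm (etaEven s) (etaEven t) u u) ∧
  ConvergesRapidly weight2 (doubleTerm (etaEven t) (etaEven u) s s) ∧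
  ConvergesRapidly weight2 (doubleTerm (etaEven u) (etaEven s) t t) ∧
  ConvergesRapidly id (singleTerm (etaEven s) (t + u) (t + u - 1)) ∧
  ConvergesRapidly id (singleTerm (etaEven t) (u + s) (u + s - 1)) ∧
  ConvergesRapidly id (singleTerm (etaEven u) (s + t) (s + t - 1))

/-! ### The sum `-T(s,t,u) + T(u,s,t) + T(t,u,s)` -/

def regularSet4 : Set (ℂ × ℂ × ℂ) :=
  {p | p.1 + p.2.1 ∉ oddLEOne ∧ p.2.1 + p.2.2 ∉ evenLEZero ∧ p.2.2 + p.1 ∉ evenLEZero ∧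
    p.1 + p.2.1 + p.2.2 ≠ 2}

/-- The points where no single factor or term of `expansion4` has a pole in `s`, `t` or `u`
alone. -/
def genericSet4 : Set (ℂ × ℂ × ℂ) :=
  {p | p.1 ∉ sinExceptional ∧ p.2.1 ∉ sinExceptional ∧ p.2.2 ∉ cosExceptional}

def expansion4 (s t u : ℂ) : ℂ :=
  Gssc s t u *
    ((2 : ℂ) ^ (-s - t - u) / (s + t + u - 2)
      + ∑' k, tripleTerm (etaOdd s) (etaOdd t) (etaEven u) 3 k
      + ∑' k, doubleTerm (etaOdd s) (etaOdd t) u (u + 2) k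
      - ∑' k, doubleTerm (etaOdd t) (etaEven u) s (s + 1) k
      - ∑' k, doubleTerm (etaEven u) (etaOdd s) t (t + 1) k
      - ∑' k, singleTerm (etaOdd s) (t + u) (t + u) k
      - ∑' k, singleTerm (etaOdd t) (u + s) (u + s) k
      + ∑' k, singleTerm (etaEven u) (s + t) (s + t - 1) k)

/-- All seven series in `expansion4` converge rapidly. -/
def RapidExpansion4 (s t u : ℂ) : Prop :=
  ConvergesRapidly weight3 (tripleTerm (etaOdd s) (etaOdd t) (etaEven u) 3) ∧
  ConvergesRapidly weight2 (doubleTerm (etaOdd s) (etaOdd t) u (u + 2)) ∧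
  ConvergesRapidly weight2 (doubleTerm (etaOdd t) (etaEven u) s (s + 1)) ∧
  ConvergesRapidly weight2 (doubleTerm (etaEven u) (etaOdd s) t (t + 1)) ∧
  ConvergesRapidly id (singleTerm (etaOdd s) (t + u) (t + u)) ∧
  ConvergesRapidly id (singleTerm (etaOdd t) (u + s) (u + s)) ∧
  ConvergesRapidly id (singleTerm (etaEven u) (s + t) (s + t - 1))

end

end Tornheim

open Tornheim

/-! Both cases run in parallel: a = 0 for `S_3`, a = 1 for `S_4`. Let C_0(s) and C_1(s) be the sums
over n ≥ 1 of cos(π n y) / n^s and sin(π n y) / n^s. When the three exponents have real part above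
1, integrating C_a(s) C_a(t) C_0(u) over 0 < y < 1 keeps only the triples of frequencies in which
one is the sum of the other two, and gives a quarter of (-1)^a T(s,t,u) + T(u,s,t) + T(t,u,s)
(`integral_trigZeta`). By Hurwitz's functional equation (`psi_mul_hurwitzTrig`) each C_a(s) is, up
to a Gamma factor, an even or odd Hurwitz zeta function at 1 - s. On (0, 1] this function is the
power 2^(-s) y^(s-1) plus a power series in y with coefficients (-1)^a η_{2l+a}(s)
(`hurwitzTrig_one_sub`). Multiplying three such binomials and integrating term by term produces the
eight terms in the braces (`integral_eq_bracket`).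

For the continuation everything is written with ψ = 1 / Γ_ℝ, which is entire with simple zeros at 0,
-2, -4, …; for instance Γ_cos(s) = ψ(1-s) / ψ(s). Clearing denominators gives `polar` · `zeroFactor`
· S = 4 · `numer` with `numer` entire. The zeros of `zeroFactor` produce no poles: they force one
exponent to have real part at least 1, where S is finite as soon as the other two exponents are
large. So `numer` vanishes on an open piece of each such hyperplane, hence on all of it, and since
the zeros of ψ are simple, `numer` = `zeroFactor` · N with N entire (`exists_numer_eq_mul`). Thus S
= 4 N / `polar`, and the zero set of `polar` is exactly the complement of the asserted domain.

Every zero of `polar` is a true singularity, because on each polar hyperplane `numer` reduces to a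
single product, which is not identically zero along a suitable line inside the hyperplane through
the given point (`exists_direction`). A local extension g would satisfy g · `polar` = 4 N and force
`numer` to vanish on that line. This also covers points on several polar hyperplanes.

The continued T comes from the same functions: T(s,t,u) is half of S_3 - S_4, and also half of a sum
of two rotations of S_4. The first formula has superfluous poles only at odd s + t, the second only
at even s + t, so together they cover the whole domain (`exists_isTornheim`). -/

namespace Tornheim

noncomputable section

/-! ### Holomorphic functions of several variables -/

section SeveralVariables

open Metric

variable {E E₁ E₂ : Type*} [NormedAddCommGroup E] [NormedSpace ℂ E]
  [NormedAddCommGroup E₁] [NormedSpace ℂ E₁] [NormedAddCommGroup E₂] [NormedSpace ℂ E₂]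

lemma differentiableAt_div {f g : E → ℂ} {x : E} (hf : DifferentiableAt ℂ f x)
    (hg : DifferentiableAt ℂ g x) (h : g x ≠ 0) : DifferentiableAt ℂ (fun y => f y / g y) x := by
  simp_rw [div_eq_mul_inv]
  exact hf.mul (hg.inv h)

lemma mapsTo_closedBall_of_norm_le {E : Type*} [NormedAddCommGroup E] {f : E → ℂ}
    {c : E} {R C : ℝ} (hR : 0 < R) (hb : ∀ x ∈ ball c R, ‖f x‖ ≤ C) :
    Set.MapsTo f (ball c R) (closedBall (f c) (2 * C)) := by
  intro x hx
  rw [mem_closedBall, dist_eq_norm]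
  have h1 := hb x hx
  have h2 := hb c (mem_ball_self hR)
  linarith [norm_sub_le (f x) (f c)]

/-- Cauchy's estimate in a normed space, taken from the Schwarz lemma. The constant 2 is the price
of centring at `f c`: values of norm at most `C` lie within `2 * C` of it. -/
lemma norm_fderiv_le_of_norm_le {f : E → ℂ} {c : E} {R C : ℝ} (hR : 0 < R)
    (hd : DifferentiableOn ℂ f (ball c R)) (hb : ∀ x ∈ ball c R, ‖f x‖ ≤ C) :
    ‖fderiv ℂ f c‖ ≤ 2 * C / R :=
  Complex.norm_fderiv_le_div_of_mapsTo_ball hd (mapsTo_closedBall_of_norm_le hR hb) hR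

lemma norm_sub_le_of_norm_le {f : E → ℂ} {c z : E} {R C : ℝ} (hR : 0 < R)
    (hd : DifferentiableOn ℂ f (ball c R)) (hb : ∀ x ∈ ball c R, ‖f x‖ ≤ C)
    (hz : z ∈ ball c R) : ‖f z - f c‖ ≤ 2 * C / R * ‖z - c‖ := by
  rw [← dist_eq_norm, ← dist_eq_norm]
  exact Complex.dist_le_div_mul_dist_of_mapsTo_ball hd (mapsTo_closedBall_of_norm_le hR hb) hz

/-- A uniform limit of holomorphic functions on a ball is holomorphic at the centre. -/
lemma differentiableAt_of_tendstoUniformlyOn {ι : Type*} {l : Filter ι} [NeBot l]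
    {F : ι → E → ℂ} {f : E → ℂ} {c : E} {R : ℝ} (hR : 0 < R)
    (hF : ∀ n, DifferentiableOn ℂ (F n) (ball c R))
    (h : TendstoUniformlyOn F f l (ball c R)) : DifferentiableAt ℂ f c := by
  have hsub : ∀ x ∈ ball c (R / 2), ball x (R / 2) ⊆ ball c R := fun x hx =>
    ball_subset_ball' (by rw [mem_ball] at hx; linarith)
  have hin : ball c (R / 2) ⊆ ball c R := ball_subset_ball (by linarith)
  have hda : ∀ n, ∀ x ∈ ball c R, DifferentiableAt ℂ (F n) x := fun n x hx =>
    (hF n).differentiableAt (isOpen_ball.mem_nhds hx)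
  -- Cauchy's estimate on balls of radius `R / 2` turns uniform closeness of the functions into
  -- uniform closeness of the derivatives on the half ball; a uniform limit of derivatives is then
  -- the derivative of the limit.
  have hC : UniformCauchySeqOn (fun n x => fderiv ℂ (F n) x) l (ball c (R / 2)) := by
    intro u hu
    obtain ⟨ε, hε, hεu⟩ := Metric.mem_uniformity_dist.1 hu
    have := h.uniformCauchySeqOn {p | dist p.1 p.2 < ε * R / 8}
      (Metric.dist_mem_uniformity (by positivity))
    filter_upwards [this] with m hm x hx
    apply hεu
    rw [dist_eq_norm, ← fderiv_sub (hda _ _ (hin hx)) (hda _ _ (hin hx))]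
    have h2 := norm_fderiv_le_of_norm_le (f := F m.1 - F m.2) (c := x) (R := R / 2)
      (C := ε * R / 8) (by positivity)
      (((hF _).mono (hsub x hx)).sub ((hF _).mono (hsub x hx))) (fun y hy => by
        have := hm y (hsub x hx hy)
        exact (mem_ball_iff_norm.1 this).le)
    refine h2.trans_lt ?_
    have : 2 * (ε * R / 8) / (R / 2) = ε / 2 := by field_simp; ring
    rw [this]; linarith
  have hlim : ∀ x ∈ ball c (R / 2), ∃ L, Tendsto (fun n => fderiv ℂ (F n) x) l (𝓝 L) :=
    fun x hx => cauchy_map_iff_exists_tendsto.1 (hC.cauchy_map hx)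
  choose! g hg using hlim
  exact (hasFDerivAt_of_tendstoUniformlyOn isOpen_ball
    (hC.tendstoUniformlyOn_of_tendsto hg) (fun n x hx => (hda n x (hin hx)).hasFDerivAt)
    (fun x hx => h.tendsto_at (hin hx)) (mem_ball_self (by positivity))).differentiableAt

/-- The sum of a locally normally convergent series of holomorphic functions is holomorphic. -/
lemma differentiableOn_tsum_of_locally_summable {ι : Type*} {f : ι → E → ℂ} {U : Set E}
    (hU : IsOpen U) (hf : ∀ i, DifferentiableOn ℂ (f i) U)
    (hb : ∀ p ∈ U, ∃ v : ι → ℝ, Summable v ∧ ∀ᶠ q in 𝓝 p, ∀ i, ‖f i q‖ ≤ v i) :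
    DifferentiableOn ℂ (fun q => ∑' i, f i q) U := by
  intro p hp
  obtain ⟨v, hv, h⟩ := hb p hp
  obtain ⟨R, hR, hRb⟩ := Metric.eventually_nhds_iff_ball.1 (h.and (hU.eventually_mem hp))
  refine (differentiableAt_of_tendstoUniformlyOn hR (F := fun (t : Finset ι) q => ∑ i ∈ t, f i q)
    (fun t => ?_) (tendstoUniformlyOn_tsum hv fun i x hx => (hRb x hx).1 i)).differentiableWithinAt
  exact DifferentiableOn.fun_sum fun i _ => (hf i).mono fun x hx => (hRb x hx).2

/-- Translating the first variable makes both partial derivatives derivatives at the same point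
`p.1`. The difference of the two functions is small by the Schwarz bound in each variable
separately, and Cauchy's estimate carries this over to the derivative. -/
lemma continuousAt_partial_fderiv {f : E₁ × E₂ → ℂ} {p : E₁ × E₂} {R C : ℝ} (hR : 0 < R)
    (hb : ∀ q ∈ ball p R, ‖f q‖ ≤ C)
    (h1 : ∀ q ∈ ball p R, DifferentiableAt ℂ (fun x => f (x, q.2)) q.1)
    (h2 : ∀ q ∈ ball p R, DifferentiableAt ℂ (fun y => f (q.1, y)) q.2) :
    ContinuousAt (fun q : E₁ × E₂ => fderiv ℂ (fun x => f (x, q.2)) q.1) p := by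
  have hmem : ∀ x y, x ∈ ball p.1 R → y ∈ ball p.2 R → (x, y) ∈ ball p R := fun x y hx hy => by
    rw [mem_ball, Prod.dist_eq]; exact max_lt hx hy
  have hC : 0 ≤ C := (norm_nonneg _).trans (hb p (mem_ball_self hR))
  refine Metric.continuousAt_iff.2 fun ε hε => ?_
  refine ⟨min (R / 4) (ε * R ^ 2 / (64 * (C + 1))), by positivity, fun {q} hq => ?_⟩
  have hq4 : dist q p < R / 4 := hq.trans_le (min_le_left _ _)
  have hqε : dist q p < ε * R ^ 2 / (64 * (C + 1)) := hq.trans_le (min_le_right _ _)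
  have hq1 : ‖q.1 - p.1‖ ≤ dist q p := by
    rw [← dist_eq_norm, Prod.dist_eq]; exact le_max_left _ _
  have hq2 : ‖q.2 - p.2‖ ≤ dist q p := by
    rw [← dist_eq_norm, Prod.dist_eq]; exact le_max_right _ _
  have hq2R : q.2 ∈ ball p.2 R := by rw [mem_ball, dist_eq_norm]; linarith
  set δ := q.1 - p.1 with hδ
  have hx : ∀ x ∈ ball p.1 (R / 4), x ∈ ball p.1 R ∧ x + δ ∈ ball p.1 R := fun x hx => by
    rw [mem_ball_iff_norm] at hx
    rw [mem_ball_iff_norm, mem_ball_iff_norm]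
    refine ⟨by linarith, ?_⟩
    have : x + δ - p.1 = (x - p.1) + δ := by abel
    rw [this]
    linarith [norm_add_le (x - p.1) δ]
  have hd1 : ∀ y ∈ ball p.2 R, ∀ x ∈ ball p.1 R, DifferentiableAt ℂ (fun x => f (x, y)) x :=
    fun y hy x hx => h1 (x, y) (hmem x y hx hy)
  have hdshift : ∀ x ∈ ball p.1 (R / 4), DifferentiableAt ℂ (fun x => f (x + δ, q.2)) x :=
    fun x hx' => by
      have := hd1 q.2 hq2R (x + δ) (hx x hx').2
      exact DifferentiableAt.comp (g := fun x => f (x, q.2)) x this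
        (differentiableAt_id.add_const δ)
  have hp1 : p.1 ∈ ball p.1 (R / 4) := mem_ball_self (by positivity)
  have hp2 : p.2 ∈ ball p.2 R := mem_ball_self hR
  -- The derivative at `q.1` becomes a derivative at `p.1` of the function shifted by `δ = q.1 -
  -- p.1`.
  have e1 : fderiv ℂ (fun x => f (x, q.2)) q.1 = fderiv ℂ (fun x => f (x + δ, q.2)) p.1 := by
    rw [fderiv_comp_add_right (f := fun x => f (x, q.2))]
    congr 1; rw [hδ]; abel
  have e2 := fderiv_sub (hdshift p.1 hp1) (hd1 p.2 hp2 p.1 (hx _ hp1).1)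
  rw [dist_eq_norm, e1, ← e2]
  have key := norm_fderiv_le_of_norm_le
    (f := (fun x => f (x + δ, q.2)) - fun x => f (x, p.2)) (c := p.1) (R := R / 4)
    (C := 8 * C / R * dist q p) (by positivity)
    (fun x hx' => ((hdshift x hx').sub (hd1 p.2 hp2 x (hx x hx').1)).differentiableWithinAt)
    (fun x hx' => by
      have a1 : ‖f (x + δ, q.2) - f (x, q.2)‖ ≤ 2 * C / (R / 2) * ‖x + δ - x‖ := by
        have hxx : ball x (R / 2) ⊆ ball p.1 R := ball_subset_ball' (by
          rw [mem_ball] at hx'; linarith)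
        refine norm_sub_le_of_norm_le (f := fun x => f (x, q.2)) (by positivity)
          (fun z hz => (hd1 _ hq2R z (hxx hz)).differentiableWithinAt)
          (fun z hz => hb _ (hmem _ _ (hxx hz) hq2R)) ?_
        rw [mem_ball, dist_eq_norm, add_sub_cancel_left]; linarith
      have a2 : ‖f (x, q.2) - f (x, p.2)‖ ≤ 2 * C / R * ‖q.2 - p.2‖ :=
        norm_sub_le_of_norm_le (f := fun y => f (x, y)) hR
          (fun z hz => (h2 (x, z) (hmem _ _ (hx x hx').1 hz)).differentiableWithinAt)
          (fun z hz => hb _ (hmem _ _ (hx x hx').1 hz)) hq2R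
      rw [add_sub_cancel_left] at a1
      have b1 : 2 * C / (R / 2) * ‖δ‖ ≤ 2 * C / (R / 2) * dist q p := by gcongr
      have b2 : 2 * C / R * ‖q.2 - p.2‖ ≤ 2 * C / R * dist q p := by gcongr
      have b3 : 2 * C / (R / 2) * dist q p + 2 * C / R * dist q p = 6 * C / R * dist q p := by
        field_simp; ring
      have b4 : 6 * C / R * dist q p ≤ 8 * C / R * dist q p := by gcongr; norm_num
      calc ‖f (x + δ, q.2) - f (x, p.2)‖
          = ‖(f (x + δ, q.2) - f (x, q.2)) + (f (x, q.2) - f (x, p.2))‖ := by congr 1; ring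
        _ ≤ _ := norm_add_le _ _
        _ ≤ _ := by linarith)
  refine key.trans_lt ?_
  have hc : 2 * (8 * C / R * dist q p) / (R / 4) = 64 * C / R ^ 2 * dist q p := by
    field_simp; ring
  rw [hc]
  calc 64 * C / R ^ 2 * dist q p ≤ 64 * (C + 1) / R ^ 2 * dist q p := by gcongr; linarith
    _ < 64 * (C + 1) / R ^ 2 * (ε * R ^ 2 / (64 * (C + 1))) := by gcongr
    _ = ε := by field_simp

/-- **Osgood's lemma**: a locally bounded, separately holomorphic function is holomorphic. -/
lemma differentiableAt_of_separately {f : E₁ × E₂ → ℂ} {p : E₁ × E₂} {C : ℝ}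
    (hb : ∀ᶠ q in 𝓝 p, ‖f q‖ ≤ C)
    (h1 : ∀ᶠ q in 𝓝 p, DifferentiableAt ℂ (fun x => f (x, q.2)) q.1)
    (h2 : ∀ᶠ q in 𝓝 p, DifferentiableAt ℂ (fun y => f (q.1, y)) q.2) :
    DifferentiableAt ℂ f p := by
  obtain ⟨R, hR, h⟩ := Metric.eventually_nhds_iff_ball.1 (hb.and (h1.and h2))
  have c1 := continuousAt_partial_fderiv hR (fun q hq => (h q hq).1) (fun q hq => (h q hq).2.1)
    (fun q hq => (h q hq).2.2)
  have hswap : ∀ q ∈ ball p.swap R, q.swap ∈ ball p R := fun q hq => by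
    rw [mem_ball, Prod.dist_eq, max_comm] at hq
    rw [mem_ball, Prod.dist_eq]; exact hq
  have c2 := continuousAt_partial_fderiv (f := fun q : E₂ × E₁ => f q.swap) (p := p.swap) hR
    (fun q hq => (h _ (hswap q hq)).1) (fun q hq => (h _ (hswap q hq)).2.2)
    (fun q hq => (h _ (hswap q hq)).2.1)
  have c2' : ContinuousAt (fun q : E₁ × E₂ => fderiv ℂ (fun y => f (q.1, y)) q.2) p :=
    ContinuousAt.comp (f := Prod.swap) (x := p) c2 continuous_swap.continuousAt
  have := hasStrictFDerivAt_uncurry_coprod (u := p) (f := fun x y => f (x, y))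
    (f₁ := fun x y => fderiv ℂ (fun x => f (x, y)) x)
    (f₂ := fun x y => fderiv ℂ (fun y => f (x, y)) y)
    (h1.mono fun q hq => hq.hasFDerivAt) (h2.mono fun q hq => hq.hasFDerivAt) c1 c2'
  exact this.hasFDerivAt.differentiableAt

lemma norm_dslope_le_of_norm_le {f : ℂ → ℂ} {c z : ℂ} {R C : ℝ} (hR : 0 < R)
    (hd : DifferentiableOn ℂ f (ball c R)) (hb : ∀ x ∈ ball c R, ‖f x‖ ≤ C)
    (hz : z ∈ ball c R) : ‖dslope f c z‖ ≤ 2 * C / R :=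
  Complex.norm_dslope_le_div_of_mapsTo_ball hd (mapsTo_closedBall_of_norm_le hR hb) hz

lemma differentiable_dslope {f : ℂ → ℂ} (hf : Differentiable ℂ f) (c : ℂ) :
    Differentiable ℂ (dslope f c) :=
  differentiableOn_univ.1
    ((Complex.differentiableOn_dslope univ_mem).2 (differentiableOn_univ.2 hf))

/-- The difference quotient in the first variable of an entire function is entire. -/
lemma differentiable_partial_dslope {F : ℂ × E → ℂ} (hF : Differentiable ℂ F) (c : ℂ) :
    Differentiable ℂ (fun p : ℂ × E => dslope (fun z => F (z, p.2)) c p.1) := by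
  have hF1 : ∀ w : E, Differentiable ℂ (fun z => F (z, w)) := fun w =>
    hF.comp (differentiable_id.prodMk (differentiable_const w))
  have hF2 : ∀ z : ℂ, Differentiable ℂ (fun w => F (z, w)) := fun z =>
    hF.comp ((differentiable_const z).prodMk differentiable_id)
  have hne : ∀ z ≠ c, ∀ w : E, dslope (fun z => F (z, w)) c z = (F (z, w) - F (c, w)) / (z - c) :=
    fun z hz w => by rw [dslope_of_ne _ hz, slope_def_field]
  have hbd : ∀ w₀ : E, ∃ R > 0, ∃ C, ∀ z ∈ ball c R, ∀ w ∈ ball w₀ R, ‖F (z, w)‖ ≤ C := by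
    intro w₀
    have : ∀ᶠ q in 𝓝 (c, w₀), ‖F q‖ < ‖F (c, w₀)‖ + 1 :=
      (hF.continuous.norm.tendsto _).eventually (gt_mem_nhds (by linarith))
    obtain ⟨R, hR, h⟩ := Metric.eventually_nhds_iff_ball.1 this
    refine ⟨R, hR, _, fun z hz w hw => (h (z, w) ?_).le⟩
    rw [mem_ball, Prod.dist_eq]; exact max_lt hz hw
  -- The only delicate slice is the first variable equal to `c`, where the quotient is a derivative.
  -- It is the uniform limit of honest difference quotients at `c + R / (n + 2)`; the 2 keeps these
  -- points strictly inside the ball.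
  have hconst : ∀ w₀ : E, DifferentiableAt ℂ (fun w => dslope (fun z => F (z, w)) c c) w₀ := by
    intro w₀
    obtain ⟨R, hR, C, hC⟩ := hbd w₀
    have hlim : Tendsto (fun n : ℕ => (R / (n + 2) : ℝ)) atTop (𝓝 0) := by
      have := (tendsto_const_div_atTop_nhds_zero_nat R).comp (tendsto_add_atTop_nat 2)
      refine this.congr fun n => ?_
      simp
    refine differentiableAt_of_tendstoUniformlyOn hR (l := atTop)
      (F := fun (n : ℕ) w => dslope (fun z => F (z, w)) c (c + (R / (n + 2) : ℝ)))
      (fun n => ?_) ?_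
    · have hn : c + ((R / (n + 2) : ℝ) : ℂ) ≠ c := by
        have : (R / (n + 2) : ℝ) ≠ 0 := by positivity
        exact fun h => this (Complex.ofReal_eq_zero.1 (left_eq_add.1 h.symm))
      simp_rw [hne _ hn]
      exact fun x _ => (differentiableAt_div ((hF2 _).sub (hF2 _) x)
        (differentiableAt_const _) (sub_ne_zero.2 hn)).differentiableWithinAt
    · rw [Metric.tendstoUniformlyOn_iff]
      intro ε hε
      have h0 : Tendsto (fun n : ℕ => 2 * (2 * C / R) / R * (R / (n + 2) : ℝ)) atTop (𝓝 0) := by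
        simpa using hlim.const_mul (2 * (2 * C / R) / R)
      filter_upwards [h0.eventually (gt_mem_nhds hε)] with n hn w hw
      have hRn : (R / (n + 2) : ℝ) < R := by
        rw [div_lt_iff₀ (by positivity)]
        nlinarith [(Nat.cast_nonneg n : (0 : ℝ) ≤ n)]
      have := norm_sub_le_of_norm_le (f := dslope (fun z => F (z, w)) c) (c := c)
        (z := c + (R / (n + 2) : ℝ)) hR (differentiable_dslope (hF1 w) c).differentiableOn
        (fun x hx => norm_dslope_le_of_norm_le hR (hF1 w).differentiableOn
          (fun y hy => hC y hy w hw) hx)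
        (by
          rw [mem_ball_iff_norm, add_sub_cancel_left, Complex.norm_real, Real.norm_eq_abs,
            abs_of_nonneg (by positivity)]
          exact hRn)
      rw [add_sub_cancel_left, Complex.norm_real, Real.norm_eq_abs,
            abs_of_nonneg (by positivity)] at this
      rw [dist_comm, dist_eq_norm]
      exact this.trans_lt hn
  have hsep : ∀ q : ℂ × E, DifferentiableAt ℂ (fun w => dslope (fun z => F (z, w)) c q.1) q.2 := by
    intro q
    by_cases hq : q.1 = c
    · rw [hq]; exact hconst q.2
    · simp_rw [hne _ hq]
      exact differentiableAt_div ((hF2 _).sub (hF2 _) _)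
        (differentiableAt_const _) (sub_ne_zero.2 hq)
  rintro ⟨z, w⟩
  by_cases hz : z = c
  · subst hz
    obtain ⟨R, hR, C, hC⟩ := hbd w
    refine differentiableAt_of_separately (C := 2 * C / R) ?_
      (Eventually.of_forall fun q => differentiable_dslope (hF1 q.2) z q.1)
      (Eventually.of_forall hsep)
    filter_upwards [ball_mem_nhds (z, w) hR] with q hq
    rw [mem_ball, Prod.dist_eq] at hq
    exact norm_dslope_le_of_norm_le hR (hF1 _).differentiableOn
      (fun y hy => hC y hy _ ((le_max_right _ _).trans_lt hq)) ((le_max_left _ _).trans_lt hq)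
  · have : (fun p : ℂ × E => dslope (fun z => F (z, p.2)) c p.1) =ᶠ[𝓝 (z, w)]
        fun p => (F p - F (c, p.2)) / (p.1 - c) := by
      filter_upwards [continuousAt_fst.eventually_ne hz] with p hp
      exact hne _ hp _
    refine DifferentiableAt.congr_of_eventuallyEq ?_ this
    have h2 : Differentiable ℂ (fun p : ℂ × E => F (c, p.2)) :=
      hF.comp ((differentiable_const c).prodMk differentiable_snd)
    exact differentiableAt_div ((hF _).sub (h2 _)) (differentiableAt_fst.sub_const c)
      (sub_ne_zero.2 hz)

/-- An entire function which vanishes with `D (p.1)` is divisible by it, if `D` has only simple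
zeros. -/
lemma exists_eq_mul_of_vanishing {F : ℂ × E → ℂ} (hF : Differentiable ℂ F) {D : ℂ → ℂ}
    (hD : Differentiable ℂ D) (hsimple : ∀ z, D z = 0 → deriv D z ≠ 0)
    (hv : ∀ z w, D z = 0 → F (z, w) = 0) :
    ∃ G : ℂ × E → ℂ, Differentiable ℂ G ∧ ∀ p, F p = D p.1 * G p := by
  classical
  have hd : ∀ (f : ℂ → ℂ) (c z : ℂ), f c = 0 → f z = (z - c) * dslope f c z := fun f c z h => by
    have := sub_smul_dslope f c z
    rw [smul_eq_mul, h, sub_zero] at this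
    exact this.symm
  -- The quotient is given its l'Hôpital value on the zeros of `D`. Near such a zero it is the ratio
  -- of the two difference quotients, whose denominator is nonzero because the zero is simple.
  refine ⟨fun p => if D p.1 = 0 then deriv (fun z => F (z, p.2)) p.1 / deriv D p.1
    else F p / D p.1, ?_, fun p => ?_⟩
  · rintro ⟨c, w⟩
    by_cases hc : D c = 0
    · have hD0 : dslope D c c ≠ 0 := by rw [dslope_same]; exact hsimple c hc
      have hne : ∀ᶠ z in 𝓝 c, dslope D c z ≠ 0 :=
        (differentiable_dslope hD c).continuous.continuousAt.eventually_ne hD0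
      have hdiff : DifferentiableAt ℂ
          (fun p : ℂ × E => dslope (fun z => F (z, p.2)) c p.1 / dslope D c p.1) (c, w) :=
        differentiableAt_div (differentiable_partial_dslope hF c _)
          (((differentiable_dslope hD c) c).comp (c, w) differentiableAt_fst) hD0
      refine hdiff.congr_of_eventuallyEq ?_
      filter_upwards [continuousAt_fst.eventually hne] with p hp
      by_cases hpc : p.1 = c
      · rw [hpc, if_pos hc, dslope_same, dslope_same]
      · have h1 := hd D c p.1 hc
        have h3 : p.1 - c ≠ 0 := sub_ne_zero.2 hpc
        have h2 : D p.1 ≠ 0 := by rw [h1]; exact mul_ne_zero h3 hp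
        rw [if_neg h2, h1]
        have h4 := hd (fun z => F (z, p.2)) c p.1 (hv c p.2 hc)
        change F p / _ = _
        have h5 : F p = (p.1 - c) * dslope (fun z => F (z, p.2)) c p.1 := h4
        rw [h5, mul_div_mul_left _ _ h3]
    · have hne : ∀ᶠ p : ℂ × E in 𝓝 (c, w), D p.1 ≠ 0 :=
        (hD.continuous.comp continuous_fst).continuousAt.eventually_ne hc
      refine DifferentiableAt.congr_of_eventuallyEq ?_
        (hne.mono fun p hp => if_neg hp : _ =ᶠ[𝓝 (c, w)] fun p => F p / D p.1)
      exact differentiableAt_div (hF _) ((hD c).comp (c, w) differentiableAt_fst) hc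
  · by_cases hp : D p.1 = 0
    · rw [hp, zero_mul]; exact hv p.1 p.2 hp
    · simp only [if_neg hp, mul_div_cancel₀ _ hp]

/-- The identity theorem along a complex line. -/
lemma eq_zero_of_eventuallyEq_zero {f : E → ℂ} {U : Set E} (hU : IsOpen U)
    (hf : DifferentiableOn ℂ f U) {p q : E} (hp : p ∈ U) (hq : q ∈ U)
    (hline : IsPreconnected {z : ℂ | p + z • (q - p) ∈ U}) (h : ∀ᶠ x in 𝓝 q, f x = 0) :
    f p = 0 := by
  have hcont : Continuous (fun z : ℂ => p + z • (q - p)) := by fun_prop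
  have hopen : IsOpen {z : ℂ | p + z • (q - p) ∈ U} := hU.preimage hcont
  have hdiff : DifferentiableOn ℂ (fun z : ℂ => f (p + z • (q - p)))
      {z : ℂ | p + z • (q - p) ∈ U} :=
    hf.comp (Differentiable.differentiableOn (by fun_prop)) fun z hz => hz
  have h1 : (fun z : ℂ => f (p + z • (q - p))) =ᶠ[𝓝 1] 0 := by
    have : Tendsto (fun z : ℂ => p + z • (q - p)) (𝓝 1) (𝓝 q) := by
      have := hcont.tendsto 1
      simpa using this
    exact this.eventually h
  have := (hdiff.analyticOnNhd hopen).eqOn_zero_of_preconnected_of_eventuallyEq_zero hline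
    (z₀ := 1) (by simpa using hq) h1 (show (0 : ℂ) ∈ _ by simpa using hp)
  simpa using this

/-- The complement of a countable set in the plane is connected. This suits domains obtained by
removing countably many hyperplanes: a line through a point of the domain meets each of them at most
once. -/
lemma eq_zero_of_eventuallyEq_zero_of_countable {f : E → ℂ} {U : Set E} (hU : IsOpen U)
    (hf : DifferentiableOn ℂ f U) {p q : E} (hp : p ∈ U) (hq : q ∈ U)
    (hline : {z : ℂ | p + z • (q - p) ∉ U}.Countable) (h : ∀ᶠ x in 𝓝 q, f x = 0) :
    f p = 0 := by
  refine eq_zero_of_eventuallyEq_zero hU hf hp hq ?_ h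
  have := (hline.isConnected_compl_of_one_lt_rank (by
    rw [Complex.rank_real_complex]; norm_num)).isPreconnected
  convert this using 1
  ext z; simp

lemma eq_zero_of_eventuallyEq_zero_of_convex {f : E → ℂ} {U : Set E} (hU : IsOpen U)
    (hf : DifferentiableOn ℂ f U) (hconv : Convex ℝ U) {p q : E} (hp : p ∈ U) (hq : q ∈ U)
    (h : ∀ᶠ x in 𝓝 q, f x = 0) : f p = 0 := by
  refine eq_zero_of_eventuallyEq_zero hU hf hp hq (Convex.isPreconnected ?_) h
  intro x hx y hy a b ha hb hab
  have := hconv hx hy ha hb hab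
  change p + (a • x + b • y) • (q - p) ∈ U
  convert this using 1
  have e : (a : ℂ) + b = 1 := by exact_mod_cast hab
  have e2 : p = ((a : ℂ) + b) • p := by rw [e, one_smul]
  rw [Complex.real_smul, Complex.real_smul, ← Complex.coe_smul, ← Complex.coe_smul]
  nth_rewrite 1 [e2]
  module

lemma countable_line {A : Set ℂ} (hA : A.Countable) {x y : ℂ} (hx : x ∉ A) :
    {z : ℂ | x + z * (y - x) ∈ A}.Countable := by
  by_cases hxy : y - x = 0
  · simp [hxy, hx]
  · exact hA.preimage_of_injOn (f := fun z => x + z * (y - x)) fun z _ w _ h => by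
      simpa [hxy] using h

/-- A nonzero entire function has isolated zeros. -/
lemma eventually_ne_zero_of_entire {f : ℂ → ℂ} (hf : Differentiable ℂ f) {z₁ : ℂ} (h : f z₁ ≠ 0)
    (z₀ : ℂ) : ∀ᶠ z in 𝓝[≠] z₀, f z ≠ 0 := by
  refine (hf.analyticAt z₀).eventually_eq_zero_or_eventually_ne_zero.resolve_left fun h0 => h ?_
  have ha := hf.differentiableOn.analyticOnNhd isOpen_univ
  exact ha.eqOn_zero_of_preconnected_of_eventuallyEq_zero
    isPreconnected_univ (Set.mem_univ z₀) h0 (Set.mem_univ z₁)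

end SeveralVariables

/-! ### The entire function `1 / Γ_ℝ` -/

section Psi

open Complex Metric

/-- `1 / Γ_ℝ`, an entire function with simple zeros at `0, -2, -4, …`. -/
def psi (z : ℂ) : ℂ := (Gammaℝ z)⁻¹

/-- `psi z / (z + 2 n)`, extended to an entire function. -/
def psiQuot (n : ℕ) (z : ℂ) : ℂ := dslope psi (-(2 * n)) z

lemma differentiable_psi : Differentiable ℂ psi := differentiable_Gammaℝ_inv

lemma psi_eq_zero_iff {z : ℂ} : psi z = 0 ↔ ∃ n : ℕ, z = -(2 * n) := by
  rw [psi, inv_eq_zero, Gammaℝ_eq_zero_iff]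

lemma psi_neg_two_mul (n : ℕ) : psi (-(2 * n)) = 0 := psi_eq_zero_iff.2 ⟨n, rfl⟩

lemma psi_ne_zero_of_re_pos {z : ℂ} (h : 0 < z.re) : psi z ≠ 0 :=
  inv_ne_zero (Gammaℝ_ne_zero_of_re_pos h)

/-- The recurrence of `Γ_ℝ`, inverted. At the poles of `Γ_ℝ` the convention that its value is 0
makes `psi` vanish, as the continuation does. -/
lemma psi_eq_psi_add_two (z : ℂ) : psi z = psi (z + 2) * z / (2 * Real.pi) := by
  by_cases hz : z = 0
  · subst hz
    have := psi_neg_two_mul 0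
    simpa using this
  · have hpi : (Real.pi : ℂ) ≠ 0 := ofReal_ne_zero.2 Real.pi_ne_zero
    rw [psi, psi, Gammaℝ_add_two hz]
    by_cases h : Gammaℝ z = 0
    · simp [h]
    · field_simp

/-- Differentiating the recurrence moves a zero two steps to the right: at -2(n+1) the term without
a derivative vanishes and a nonzero multiple of the derivative at -2n remains, while at 0 the
surviving term is `psi 2`. -/
lemma deriv_psi_ne_zero (n : ℕ) : deriv psi (-(2 * n)) ≠ 0 := by
  have hpi : (Real.pi : ℂ) ≠ 0 := ofReal_ne_zero.2 Real.pi_ne_zero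
  have hder : ∀ z : ℂ, deriv psi z = (deriv psi (z + 2) * z + psi (z + 2)) / (2 * Real.pi) := by
    intro z
    have h1 : HasDerivAt (fun z => psi (z + 2)) (deriv psi (z + 2)) z :=
      (differentiable_psi (z + 2)).hasDerivAt.comp_add_const z 2
    have h2 := (h1.mul (hasDerivAt_id z)).div_const (2 * Real.pi : ℂ)
    have h3 : HasDerivAt psi _ z := h2.congr_of_eventuallyEq
      (Eventually.of_forall fun w => psi_eq_psi_add_two w)
    rw [h3.deriv]; simp
  induction n with
  | zero =>
    rw [hder]
    have : psi 2 ≠ 0 := psi_ne_zero_of_re_pos (by norm_num)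
    simp [this, hpi]
  | succ n ih =>
    rw [hder]
    have e : -(2 * ((n + 1 : ℕ) : ℂ)) + 2 = -(2 * n) := by push_cast; ring
    rw [e, psi_neg_two_mul, add_zero]
    have : -(2 * ((n + 1 : ℕ) : ℂ)) ≠ 0 :=
      neg_ne_zero.2 (mul_ne_zero two_ne_zero (Nat.cast_ne_zero.2 n.succ_ne_zero))
    exact div_ne_zero (mul_ne_zero ih this) (mul_ne_zero two_ne_zero hpi)

lemma deriv_psi_ne_zero_of_eq_zero {z : ℂ} (h : psi z = 0) : deriv psi z ≠ 0 := by
  obtain ⟨n, rfl⟩ := psi_eq_zero_iff.1 h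
  exact deriv_psi_ne_zero n

lemma differentiable_psiQuot (n : ℕ) : Differentiable ℂ (psiQuot n) :=
  differentiable_dslope differentiable_psi _

lemma psiQuot_mul (n : ℕ) (z : ℂ) : psiQuot n z * (z + 2 * n) = psi z := by
  have := sub_smul_dslope psi (-(2 * n)) z
  rw [smul_eq_mul, psi_neg_two_mul, sub_zero, sub_neg_eq_add, mul_comm] at this
  exact this

lemma psiQuot_eq_div {n : ℕ} {z : ℂ} (h : z + 2 * n ≠ 0) : psiQuot n z = psi z / (z + 2 * n) := by
  rw [← psiQuot_mul n z, mul_div_cancel_right₀ _ h]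

lemma add_two_mul_ne_zero_of_psi_ne_zero {z : ℂ} (h : psi z ≠ 0) (n : ℕ) : z + 2 * n ≠ 0 :=
  fun h0 => h (psi_eq_zero_iff.2 ⟨n, eq_neg_of_add_eq_zero_left h0⟩)

lemma psiQuot_self_ne_zero (n : ℕ) : psiQuot n (-(2 * n)) ≠ 0 := by
  rw [psiQuot, dslope_same]; exact deriv_psi_ne_zero n

/-- With `psiQuot_self_ne_zero` this makes the quotients behave like a Kronecker delta at the zeros
of `psi`, so a series in them collapses to one term on a polar hyperplane. -/
lemma psiQuot_eq_zero {m n : ℕ} (h : m ≠ n) : psiQuot m (-(2 * n)) = 0 := by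
  have : -(2 * (n : ℂ)) + 2 * m ≠ 0 := fun h0 => h (by
    have : (m : ℂ) = n := by linear_combination h0 / 2
    exact_mod_cast this)
  rw [psiQuot_eq_div this, psi_neg_two_mul, zero_div]

/-- Uniformity in `n` is the point. If -2n is at distance at least 1 from `z`, division does not
increase the norm; otherwise the unit ball about -2n stays within distance 3 of `z₀`, and the
Schwarz bound for difference quotients applies. -/
lemma exists_psiQuot_bound (z₀ : ℂ) : ∃ C : ℝ, 0 ≤ C ∧ ∀ᶠ z in 𝓝 z₀, ∀ n, ‖psiQuot n z‖ ≤ C := by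
  obtain ⟨C, hC⟩ := (isCompact_closedBall z₀ 3).exists_bound_of_continuousOn
    differentiable_psi.continuous.continuousOn
  have hC0 : 0 ≤ C := (norm_nonneg _).trans (hC z₀ (mem_closedBall_self (by norm_num)))
  refine ⟨2 * C, by positivity, ?_⟩
  filter_upwards [ball_mem_nhds z₀ one_pos] with z hz n
  rw [mem_ball, dist_eq_norm] at hz
  by_cases h : 1 ≤ ‖z + 2 * n‖
  · rw [psiQuot_eq_div (norm_pos_iff.1 (by linarith)), norm_div]
    refine (div_le_self (norm_nonneg _) h).trans ?_
    have := hC z (by rw [mem_closedBall, dist_eq_norm]; linarith)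
    linarith
  · have := norm_dslope_le_of_norm_le (f := psi) (c := -(2 * n)) (z := z) (R := 1) (C := C) one_pos
      differentiable_psi.differentiableOn (fun x hx => hC x ?_)
      (by rw [mem_ball, dist_eq_norm, sub_neg_eq_add]; linarith)
    · rwa [div_one] at this
    · rw [mem_ball, dist_eq_norm, sub_neg_eq_add] at hx
      rw [mem_closedBall, dist_eq_norm]
      have e : x - z₀ = (x + 2 * n) - (z + 2 * n) + (z - z₀) := by ring
      rw [e]
      have h1 := norm_add_le ((x + 2 * n) - (z + 2 * n)) (z - z₀)
      have h2 := norm_sub_le (x + 2 * n) (z + 2 * n)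
      linarith

end Psi

/-! ### The factors `Γ_cos` and `Γ_sin` -/

section GammaFactors

open Complex

lemma valueAt_eq {f g : ℂ → ℂ} {s : ℂ} (h : f =ᶠ[𝓝[≠] s] g) (hg : ContinuousAt g s) :
    valueAt f s = g s :=
  Tendsto.limUnder_eq ((hg.tendsto.mono_left nhdsWithin_le_nhds).congr' h.symm)

lemma eventually_ne_neg_nat (s : ℂ) : ∀ᶠ z in 𝓝[≠] s, ∀ n : ℕ, z ≠ -(n : ℂ) := by
  filter_upwards [eventually_ne_zero_of_entire differentiable_one_div_Gamma
    (z₁ := 1) (by simp) s] with z hz n hn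
  exact hz (by rw [inv_eq_zero, Complex.Gamma_eq_zero_iff]; exact ⟨n, hn⟩)

lemma two_mul_Gamma_div (z : ℂ) : 2 * Gamma z / (2 * (Real.pi : ℂ)) ^ z = Gammaℂ z := by
  rw [Gammaℂ_def, cpow_neg]; ring

/-- The reflection formula for `Γ_ℝ`. It remains valid at -1, -3, …, where a pole of Γ meets a zero
of the cosine and only the limit has a meaning. -/
lemma gammaCos_eq {s : ℂ} (h : psi s ≠ 0) : gammaCos s = psi (1 - s) / psi s := by
  refine valueAt_eq (g := fun z => psi (1 - z) / psi z) ?_ ?_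
  · filter_upwards [eventually_ne_neg_nat s,
      (differentiable_psi.continuous.continuousAt.eventually_ne h).filter_mono
        nhdsWithin_le_nhds] with z hz hpz
    rw [two_mul_Gamma_div, eq_div_iff hpz, psi, psi, ← inv_Gammaℝ_one_sub hz]
  · exact (differentiable_psi.continuous.comp (continuous_const.sub continuous_id)).continuousAt.div
      differentiable_psi.continuous.continuousAt h

lemma gammaSin_eq {s : ℂ} (h : psi (s + 1) ≠ 0) : gammaSin s = psi (2 - s) / psi (s + 1) := by
  have hc : Continuous (fun z => psi (z + 1)) :=
    differentiable_psi.continuous.comp (continuous_id.add continuous_const)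
  refine valueAt_eq (g := fun z => psi (2 - z) / psi (z + 1)) ?_ ?_
  · filter_upwards [eventually_ne_neg_nat s,
      (hc.continuousAt.eventually_ne h).filter_mono nhdsWithin_le_nhds] with z hz hpz
    rw [two_mul_Gamma_div, eq_div_iff hpz, psi, psi, ← inv_Gammaℝ_two_sub hz]
  · exact (differentiable_psi.continuous.comp (continuous_const.sub continuous_id)).continuousAt.div
      hc.continuousAt h

end GammaFactors

/-! ### The functions `η_k` -/

section Eta

open Complex Metric

/-- `(w - 1) ζ(w)`, extended to an entire function. -/
def zetaReg : ℂ → ℂ := Function.update (fun w => (w - 1) * riemannZeta w) 1 1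

lemma zetaReg_of_ne {w : ℂ} (h : w ≠ 1) : zetaReg w = (w - 1) * riemannZeta w :=
  Function.update_of_ne h _ _

lemma differentiable_zetaReg : Differentiable ℂ zetaReg := by
  rw [← differentiableOn_univ, ← Complex.differentiableOn_compl_singleton_and_continuousAt_iff
    (c := 1) univ_mem]
  refine ⟨fun z hz => ?_, ?_⟩
  · have hz1 : z ≠ 1 := hz.2
    have : DifferentiableAt ℂ (fun w => (w - 1) * riemannZeta w) z :=
      (differentiableAt_id.sub_const 1).mul (differentiableAt_riemannZeta hz1)
    refine (this.congr_of_eventuallyEq ?_).differentiableWithinAt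
    filter_upwards [eventually_ne_nhds hz1] with w hw using zetaReg_of_ne hw
  · exact continuousAt_update_same.2 riemannZeta_residue_one

/-- `binom (k - s) k = ∏_{j ≤ k} (1 - s / j)`. -/
def binomProd (k : ℕ) (s : ℂ) : ℂ := ∏ i ∈ Finset.range k, (1 - s / (i + 1))

lemma differentiable_binomProd (k : ℕ) : Differentiable ℂ (binomProd k) := by
  unfold binomProd
  fun_prop

lemma binomProd_succ (k : ℕ) (s : ℂ) : binomProd (k + 1) s = binomProd k s * (1 - s / (k + 1)) :=
  Finset.prod_range_succ _ _

lemma ringChoose_eq_binomProd (k : ℕ) (s : ℂ) : Ring.choose ((k : ℂ) - s) k = binomProd k s := by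
  have hk : (k.factorial : ℂ) ≠ 0 := Nat.cast_ne_zero.2 k.factorial_ne_zero
  have h := Ring.descPochhammer_eq_factorial_smul_choose ((k : ℂ) - s) k
  rw [← Polynomial.aeval_eq_smeval, Polynomial.aeval_def, Polynomial.eval₂_eq_eval_map,
    descPochhammer_map, descPochhammer_eval_eq_prod_range, nsmul_eq_mul] at h
  rw [← mul_right_inj' hk, ← h, ← Finset.prod_range_reflect, binomProd,
    ← Finset.prod_range_add_one_eq_factorial, Nat.cast_prod, ← Finset.prod_mul_distrib]
  refine Finset.prod_congr rfl fun i hi => ?_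
  have hik := Finset.mem_range.1 hi
  have e : ((k - 1 - i : ℕ) : ℂ) = k - 1 - i := by
    rw [Nat.cast_sub (by omega), Nat.cast_sub (by omega)]; simp
  rw [e]
  have : (i : ℂ) + 1 ≠ 0 := Nat.cast_add_one_ne_zero i
  push_cast
  field_simp
  ring

lemma eventually_ne_punctured (s c : ℂ) : ∀ᶠ z in 𝓝[≠] s, z ≠ c := by
  have : Differentiable ℂ (fun z : ℂ => z - c) := differentiable_id.sub_const c
  filter_upwards [eventually_ne_zero_of_entire this (z₁ := c + 1) (by simp) s] with z hz
  exact sub_ne_zero.1 hz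

/-- The last factor 1 - s/(k+1) of the binomial coefficient is (w - 1)/(k+1) for the zeta argument w
= k + 2 - s. It cancels the pole of zeta, so every η except η_0 is entire. -/
lemma eta_succ (k : ℕ) (s : ℂ) :
    eta (k + 1) s = ((2 : ℂ) ^ (k + 1))⁻¹ * binomProd k s / (k + 1) * zetaReg (k + 2 - s) := by
  refine valueAt_eq (g := fun s => ((2 : ℂ) ^ (k + 1))⁻¹ * binomProd k s / (k + 1) *
    zetaReg (k + 2 - s)) ?_ ?_
  · filter_upwards [eventually_ne_punctured s (k + 1)] with z hz
    have hw : (k : ℂ) + 2 - z ≠ 1 := fun h => hz (by linear_combination -h)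
    have hk : (k : ℂ) + 1 ≠ 0 := Nat.cast_add_one_ne_zero k
    rw [ringChoose_eq_binomProd, binomProd_succ, zetaReg_of_ne hw]
    push_cast
    have e : (k : ℂ) + 1 + 1 - z = k + 2 - z := by ring
    rw [e]
    field_simp
    ring
  · have h1 := (differentiable_binomProd k).continuous
    have h2 := differentiable_zetaReg.continuous
    fun_prop

lemma eta_of_ne {k : ℕ} {s : ℂ} (h : s ≠ k) :
    eta k s = ((2 : ℂ) ^ k)⁻¹ * binomProd k s * riemannZeta (k + 1 - s) := by
  refine valueAt_eq (g := fun s => ((2 : ℂ) ^ k)⁻¹ * binomProd k s * riemannZeta (k + 1 - s))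
    (Eventually.of_forall fun z => by simp only [ringChoose_eq_binomProd]) ?_
  have h1 := (differentiable_binomProd k).continuous
  have h2 : ContinuousAt riemannZeta (k + 1 - s) :=
    (differentiableAt_riemannZeta fun h0 => h (by linear_combination -h0)).continuousAt
  have h3 : ContinuousAt (fun s => riemannZeta (k + 1 - s)) s :=
    ContinuousAt.comp (f := fun s : ℂ => (k : ℂ) + 1 - s) h2 (by fun_prop)
  exact (continuousAt_const.mul h1.continuousAt).mul h3

lemma differentiable_eta_succ (k : ℕ) : Differentiable ℂ (eta (k + 1)) := by
  have : eta (k + 1) = fun s =>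
      ((2 : ℂ) ^ (k + 1))⁻¹ * binomProd k s / (k + 1) * zetaReg (k + 2 - s) := funext (eta_succ k)
  rw [this]
  have h1 := differentiable_binomProd k
  have h2 : Differentiable ℂ (fun s => zetaReg (k + 2 - s)) :=
    differentiable_zetaReg.comp (by fun_prop)
  exact ((h1.const_mul _).div_const _).mul h2

lemma differentiableAt_eta {k : ℕ} {s : ℂ} (h : k ≠ 0 ∨ s ≠ 0) : DifferentiableAt ℂ (eta k) s := by
  cases k with
  | succ k => exact differentiable_eta_succ k s
  | zero =>
    have hs : s ≠ 0 := h.resolve_left (by simp)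
    have h2 : DifferentiableAt ℂ (fun s : ℂ => riemannZeta (1 - s)) s := by
      refine DifferentiableAt.comp (g := riemannZeta) s
        (differentiableAt_riemannZeta fun h0 => hs (by linear_combination -h0)) (by fun_prop)
    refine h2.congr_of_eventuallyEq ?_
    filter_upwards [eventually_ne_nhds hs] with z hz
    rw [eta_of_ne (by simpa using hz)]
    simp [binomProd]

lemma tendsto_one_add_div (R : ℝ) : Tendsto (fun n : ℕ => 1 + R / ((n : ℝ) + 1)) atTop (𝓝 1) := by
  have h1 := (tendsto_const_div_atTop_nhds_zero_nat R).comp (tendsto_add_atTop_nat 1)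
  have h2 : Tendsto (fun n : ℕ => R / ((n : ℝ) + 1)) atTop (𝓝 0) :=
    h1.congr fun n => by simp
  simpa using h2.const_add 1

/-- The ratio of consecutive terms tends to `x`, so the binomial products cannot spoil geometric
decay. -/
lemma summable_prod_one_add_div {R x : ℝ} (hR : 0 ≤ R) (hx0 : 0 < x) (hx : x < 1) :
    Summable (fun k : ℕ => (∏ i ∈ Finset.range k, (1 + R / ((i : ℝ) + 1))) * x ^ k) := by
  have hpos : ∀ k : ℕ, 0 < (∏ i ∈ Finset.range k, (1 + R / ((i : ℝ) + 1))) * x ^ k := fun k =>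
    mul_pos (Finset.prod_pos fun i _ => by positivity) (by positivity)
  refine summable_of_ratio_test_tendsto_lt_one hx (Eventually.of_forall fun k => (hpos k).ne') ?_
  have h3 : Tendsto (fun n : ℕ => (1 + R / ((n : ℝ) + 1)) * x) atTop (𝓝 x) := by
    simpa using (tendsto_one_add_div R).mul_const x
  refine h3.congr fun k => ?_
  rw [Real.norm_of_nonneg (hpos _).le, Real.norm_of_nonneg (hpos _).le, eq_div_iff (hpos k).ne',
    Finset.prod_range_succ, pow_succ]
  ring

lemma norm_binomProd_le {R : ℝ} {s : ℂ} (hs : ‖s‖ ≤ R) (k : ℕ) :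
    ‖binomProd k s‖ ≤ ∏ i ∈ Finset.range k, (1 + R / ((i : ℝ) + 1)) := by
  rw [binomProd, norm_prod]
  refine Finset.prod_le_prod (fun _ _ => norm_nonneg _) fun i _ => ?_
  refine (norm_sub_le _ _).trans ?_
  have : ‖(i : ℂ) + 1‖ = (i : ℝ) + 1 := by
    have : (i : ℂ) + 1 = ((i + 1 : ℝ) : ℂ) := by push_cast; rfl
    rw [this, Complex.norm_real, Real.norm_of_nonneg (by positivity)]
  rw [norm_one, norm_div, this]
  gcongr

lemma exists_riemannZeta_bound : ∃ C : ℝ, 0 ≤ C ∧ ∀ w : ℂ, 2 ≤ w.re → ‖riemannZeta w‖ ≤ C := by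
  have hsum : Summable (fun n : ℕ => 1 / ((n : ℝ) + 1) ^ (2 : ℝ)) := by
    have := (summable_nat_add_iff 1).2 (Real.summable_one_div_nat_rpow.2 (one_lt_two))
    simpa using this
  refine ⟨∑' n : ℕ, 1 / ((n : ℝ) + 1) ^ (2 : ℝ), tsum_nonneg fun n => by positivity,
    fun w hw => ?_⟩
  rw [zeta_eq_tsum_one_div_nat_add_one_cpow (by linarith)]
  refine tsum_of_norm_bounded hsum.hasSum fun n => ?_
  have e : (n : ℂ) + 1 = ((n + 1 : ℝ) : ℂ) := by push_cast; rfl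
  rw [norm_div, norm_one, e, Complex.norm_cpow_eq_rpow_re_of_pos (by positivity)]
  gcongr
  linarith [(Nat.cast_nonneg n : (0 : ℝ) ≤ n)]

/-- The functions `η_k` decay geometrically, locally uniformly, with any ratio above `1 / 2`. -/
lemma exists_eta_bound {R ρ : ℝ} (hR : 0 ≤ R) (hρ : 1 / 2 < ρ) :
    ∃ C : ℝ, 0 ≤ C ∧ ∀ k : ℕ, ∀ s : ℂ, k ≠ 0 → ‖s‖ ≤ R → ‖eta k s‖ ≤ C * ρ ^ k := by
  have hρ0 : 0 < ρ := by linarith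
  obtain ⟨Z, hZ0, hZ⟩ := exists_riemannZeta_bound
  -- Splitting 2^(-k) as (2ρ)^(-k) ρ^k, the first factor has ratio below 1 and absorbs the growth of
  -- the binomial products.
  have hsum := summable_prod_one_add_div (x := (2 * ρ)⁻¹) hR (by positivity)
    (inv_lt_one_of_one_lt₀ (by linarith))
  have hpos : ∀ k : ℕ, 0 ≤ (∏ i ∈ Finset.range k, (1 + R / ((i : ℝ) + 1))) * (2 * ρ)⁻¹ ^ k :=
    fun k => mul_nonneg (Finset.prod_nonneg fun i _ => by positivity) (by positivity)
  -- Beyond `K` the zeta argument k + 1 - s has real part above 2, where zeta is bounded; the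
  -- finitely many smaller indices are handled by compactness.
  obtain ⟨K, hK⟩ := exists_nat_gt (R + 1)
  have hfin : ∀ k : ℕ, ∃ C : ℝ, 0 ≤ C ∧ ∀ s : ℂ, k ≠ 0 → ‖s‖ ≤ R → ‖eta k s‖ ≤ C := by
    intro k
    cases k with
    | zero => exact ⟨0, le_rfl, fun s h => absurd rfl h⟩
    | succ k =>
      obtain ⟨C, hC⟩ := (isCompact_closedBall (0 : ℂ) R).exists_bound_of_continuousOn
        (differentiable_eta_succ k).continuous.continuousOn
      exact ⟨C, (norm_nonneg _).trans (hC 0 (mem_closedBall_self hR)), fun s _ hs =>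
        hC s (by simpa using hs)⟩
  choose c hc0 hc using hfin
  set B := ∑' k : ℕ, (∏ i ∈ Finset.range k, (1 + R / ((i : ℝ) + 1))) * (2 * ρ)⁻¹ ^ k with hB
  have hB0 : 0 ≤ B := tsum_nonneg hpos
  have hterm : ∀ k, 0 ≤ c k / ρ ^ k := fun k => div_nonneg (hc0 k) (by positivity)
  have hsumc : 0 ≤ ∑ k ∈ Finset.range K, c k / ρ ^ k := Finset.sum_nonneg fun k _ => hterm k
  refine ⟨B * Z + ∑ k ∈ Finset.range K, c k / ρ ^ k, by positivity, fun k s hk hs => ?_⟩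
  by_cases hkK : k < K
  · have h1 : c k / ρ ^ k ≤ ∑ k ∈ Finset.range K, c k / ρ ^ k :=
      Finset.single_le_sum (f := fun k => c k / ρ ^ k) (fun k _ => hterm k)
        (Finset.mem_range.2 hkK)
    refine (hc k s hk hs).trans ?_
    rw [← div_le_iff₀ (by positivity)]
    have : 0 ≤ B * Z := by positivity
    linarith
  · have hkR : R + 1 < k := hK.trans_le (by exact_mod_cast not_lt.1 hkK)
    have hre : s.re ≤ R := (Complex.re_le_norm s).trans hs
    have hne : s ≠ k := fun h => by
      rw [h, Complex.natCast_re] at hre; linarith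
    have h1 := norm_binomProd_le hs k
    have h2 : ‖riemannZeta (k + 1 - s)‖ ≤ Z := hZ _ (by simp; linarith)
    have h3 : (∏ i ∈ Finset.range k, (1 + R / ((i : ℝ) + 1))) * (2 * ρ)⁻¹ ^ k ≤ B :=
      hsum.le_tsum k fun j _ => hpos j
    have h4 : 0 ≤ ∏ i ∈ Finset.range k, (1 + R / ((i : ℝ) + 1)) :=
      Finset.prod_nonneg fun i _ => by positivity
    rw [eta_of_ne hne, norm_mul, norm_mul, norm_inv, norm_pow, Complex.norm_ofNat]
    have e : ((2 : ℝ) ^ k)⁻¹ = (2 * ρ)⁻¹ ^ k * ρ ^ k := by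
      rw [← mul_pow, ← inv_pow]; congr 1; field_simp
    calc ((2 : ℝ) ^ k)⁻¹ * ‖binomProd k s‖ * ‖riemannZeta (k + 1 - s)‖
        ≤ ((2 : ℝ) ^ k)⁻¹ * (∏ i ∈ Finset.range k, (1 + R / ((i : ℝ) + 1))) * Z := by gcongr
      _ = ((∏ i ∈ Finset.range k, (1 + R / ((i : ℝ) + 1))) * (2 * ρ)⁻¹ ^ k) * Z * ρ ^ k := by
        rw [e]; ring
      _ ≤ B * Z * ρ ^ k := by gcongr
      _ ≤ _ := by gcongr; linarith

/-- `(-1) ^ a ψ(s + a) η_{2l + a}(s)`, extended to an entire function. -/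
def kappa (a l : ℕ) (s : ℂ) : ℂ :=
  -- Only η_0 has a pole, at 0, and the zero of ψ(s) there cancels it: ψ(s) ζ(1 - s) is ψ(s)/s times
  -- s ζ(1 - s), and the latter is `-zetaReg (1 - s)`.
  if 2 * l + a = 0 then -psiQuot 0 s * zetaReg (1 - s)
  else (-1) ^ a * psi (s + a) * eta (2 * l + a) s

lemma kappa_eq {a l : ℕ} {s : ℂ} (h : a ≠ 0 ∨ s ≠ 0) :
    kappa a l s = (-1) ^ a * psi (s + a) * eta (2 * l + a) s := by
  unfold kappa
  split_ifs with h0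
  · obtain ⟨rfl, rfl⟩ : l = 0 ∧ a = 0 := by omega
    have hs : s ≠ 0 := h.resolve_left (by simp)
    rw [psiQuot_eq_div (by simpa using hs), zetaReg_of_ne (fun h => hs (by linear_combination -h)),
      eta_of_ne (by simpa using hs)]
    simp [binomProd]
    field_simp
  · rfl

lemma differentiable_kappa (a l : ℕ) : Differentiable ℂ (kappa a l) := by
  unfold kappa
  split_ifs with h0
  · exact (differentiable_psiQuot 0).neg.mul (differentiable_zetaReg.comp (by fun_prop))
  · obtain ⟨k, hk⟩ := Nat.exists_eq_succ_of_ne_zero h0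
    rw [hk]
    exact ((differentiable_psi.comp (differentiable_id.add_const (a : ℂ))).const_mul _).mul
      (differentiable_eta_succ k)

/-- The ratio 3/4, any number between 1/2 and 1, is used for η; as the index advances in steps of
two, its square 9/16 appears. -/
lemma exists_kappa_bound (a : ℕ) (s₀ : ℂ) :
    ∃ C : ℝ, 0 ≤ C ∧ ∀ᶠ s in 𝓝 s₀, ∀ l, ‖kappa a l s‖ ≤ C * (9 / 16) ^ l := by
  obtain ⟨A, hA0, hA⟩ := exists_eta_bound (R := ‖s₀‖ + 1) (ρ := 3 / 4) (by positivity)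
    (by norm_num)
  have hloc : ∀ f : ℂ → ℂ, Differentiable ℂ f → ∀ᶠ s in 𝓝 s₀, ‖f s‖ < ‖f s₀‖ + 1 := fun f hf =>
    (hf.continuous.norm.tendsto s₀).eventually (gt_mem_nhds (by linarith))
  have hpsi : Differentiable ℂ (fun s => psi (s + a)) :=
    differentiable_psi.comp (differentiable_id.add_const (a : ℂ))
  refine ⟨(‖psi (s₀ + a)‖ + 1) * A + (‖kappa a 0 s₀‖ + 1), by positivity, ?_⟩
  filter_upwards [hloc _ hpsi, hloc _ (differentiable_kappa a 0),
    Metric.ball_mem_nhds s₀ one_pos] with s h1 h2 h3 l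
  by_cases h0 : 2 * l + a = 0
  · obtain ⟨rfl, rfl⟩ : l = 0 ∧ a = 0 := by omega
    rw [pow_zero, mul_one]
    have : 0 ≤ (‖psi (s₀ + (0 : ℕ))‖ + 1) * A := by positivity
    linarith
  · have hs : ‖s‖ ≤ ‖s₀‖ + 1 := by
      rw [mem_ball_iff_norm] at h3
      have : s = s₀ + (s - s₀) := by ring
      rw [this]; exact (norm_add_le _ _).trans (by linarith)
    have h4 := hA (2 * l + a) s h0 hs
    have h5 : ((3 : ℝ) / 4) ^ (2 * l + a) ≤ (9 / 16) ^ l := by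
      rw [pow_add, pow_mul]
      have : ((3 : ℝ) / 4) ^ a ≤ 1 := pow_le_one₀ (by norm_num) (by norm_num)
      calc (((3 : ℝ) / 4) ^ 2) ^ l * (3 / 4) ^ a ≤ (((3 : ℝ) / 4) ^ 2) ^ l * 1 := by gcongr
        _ = _ := by rw [mul_one]; norm_num
    rw [kappa, if_neg h0, norm_mul, norm_mul, norm_pow, norm_neg, norm_one, one_pow, one_mul]
    calc ‖psi (s + a)‖ * ‖eta (2 * l + a) s‖
        ≤ (‖psi (s₀ + a)‖ + 1) * (A * (9 / 16) ^ l) := by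
          gcongr
          exact h4.trans (by gcongr)
      _ = (‖psi (s₀ + a)‖ + 1) * A * (9 / 16) ^ l := by ring
      _ ≤ _ := by
        gcongr
        have : 0 ≤ ‖kappa a 0 s₀‖ := norm_nonneg _
        linarith

lemma binomProd_ne_zero_of_re_neg {s : ℂ} (hs : s.re < 0) (k : ℕ) : binomProd k s ≠ 0 := by
  rw [binomProd, Finset.prod_ne_zero_iff]
  intro i _ h
  have hi : (i : ℂ) + 1 ≠ 0 := Nat.cast_add_one_ne_zero i
  have h1 : s = i + 1 := by field_simp at h; linear_combination -h
  have h2 : s.re = i + 1 := by rw [h1]; simp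
  have : (0 : ℝ) ≤ i := Nat.cast_nonneg i
  linarith

/-- One nonzero value suffices to know that the function is not identically zero. At -1/2 the
binomial has no zero, the zeta argument lies to the right of 1, and -1/2 + a is not an integer, so ψ
does not vanish. -/
lemma kappa_ne_zero (a l : ℕ) : kappa a l (-1 / 2) ≠ 0 := by
  have hre : ((-1 / 2 : ℂ)).re < 0 := by norm_num
  have hne : (-1 / 2 : ℂ) ≠ ((2 * l + a : ℕ) : ℂ) := fun h => by
    have := congrArg Complex.re h
    rw [Complex.natCast_re] at this
    have h2 : (0 : ℝ) ≤ ((2 * l + a : ℕ) : ℝ) := Nat.cast_nonneg _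
    linarith
  rw [kappa_eq (Or.inr (by norm_num)), eta_of_ne hne]
  have h1 : psi (-1 / 2 + a) ≠ 0 := by
    intro h
    obtain ⟨n, hn⟩ := psi_eq_zero_iff.1 h
    have h2 := congrArg Complex.re hn
    have : (2 * a : ℤ) + 4 * n = 1 := by
      have h3 : (2 * a : ℝ) + 4 * n = 1 := by
        simp at h2; norm_num at h2; linarith
      exact_mod_cast h3
    omega
  have h2 : riemannZeta (((2 * l + a : ℕ) : ℂ) + 1 - -1 / 2) ≠ 0 :=
    riemannZeta_ne_zero_of_one_lt_re (by
      rw [Complex.sub_re, Complex.add_re, Complex.natCast_re, Complex.one_re]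
      have h2 : (0 : ℝ) ≤ ((2 * l + a : ℕ) : ℝ) := Nat.cast_nonneg _
      linarith)
  have h3 := binomProd_ne_zero_of_re_neg hre (2 * l + a)
  simp only [ne_eq, mul_eq_zero, not_or]
  exact ⟨⟨by simp, h1⟩, ⟨by simp, h3⟩, h2⟩

end Eta

/-! ### Rapidly convergent series -/

section Rapid

lemma summable_geometric_two {r : ℝ} (h0 : 0 ≤ r) (h1 : r < 1) :
    Summable (fun k : ℕ × ℕ => r ^ (k.1 + k.2)) := by
  have h := summable_geometric_of_lt_one h0 h1
  have := h.mul_of_nonneg h (fun n => by positivity) (fun n => by positivity)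
  simpa only [pow_add] using this

lemma summable_geometric_three {r : ℝ} (h0 : 0 ≤ r) (h1 : r < 1) :
    Summable (fun k : ℕ × ℕ × ℕ => r ^ (k.1 + k.2.1 + k.2.2)) := by
  have h := summable_geometric_of_lt_one h0 h1
  have := h.mul_of_nonneg (summable_geometric_two h0 h1) (fun n => by positivity)
    (fun n => by positivity)
  simpa only [pow_add, mul_assoc] using this

/-- `k ↦ (-1) ^ a η_{2k + a} (s)`. -/
def etaSigned (a : ℕ) (s : ℂ) (k : ℕ) : ℂ := (-1) ^ a * eta (2 * k + a) s

lemma etaSigned_zero (s : ℂ) : etaSigned 0 s = etaEven s := by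
  ext k; simp [etaSigned, etaEven]

lemma etaSigned_one (s : ℂ) : etaSigned 1 s = fun k => -etaOdd s k := by
  ext k; simp [etaSigned, etaOdd]

lemma kappa_eq_psi_mul {a : ℕ} {s : ℂ} (h : psi (s + a) ≠ 0) (l : ℕ) :
    kappa a l s = psi (s + a) * etaSigned a s l := by
  rw [kappa_eq, etaSigned]
  · ring
  · by_contra! h0
    obtain ⟨rfl, rfl⟩ := h0
    exact h (psi_eq_zero_iff.2 ⟨0, by simp⟩)

lemma exists_etaSigned_bound (a : ℕ) (s : ℂ) {r : ℝ} (hr : 1 / 4 < r) :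
    ∃ C : ℝ, 0 ≤ C ∧ ∀ l, ‖etaSigned a s l‖ ≤ C * r ^ l := by
  have hr0 : 0 ≤ r := by linarith
  -- Each step in `l` raises the index of η by two, so decay of η with ratio √r gives ratio `r`, and
  -- the threshold 1/2 becomes 1/4.
  have hρ : 1 / 2 < √r := by
    rw [Real.lt_sqrt (by norm_num)]; linarith
  obtain ⟨C, hC0, hC⟩ := exists_eta_bound (norm_nonneg s) hρ
  refine ⟨C * √r ^ a + ‖eta 0 s‖, by positivity, fun l => ?_⟩
  rw [etaSigned, norm_mul, norm_pow, norm_neg, norm_one, one_pow, one_mul]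
  by_cases h0 : 2 * l + a = 0
  · obtain ⟨rfl, rfl⟩ : l = 0 ∧ a = 0 := by omega
    simp [hC0]
  · refine (hC _ s h0 le_rfl).trans ?_
    rw [pow_add, pow_mul, Real.sq_sqrt hr0]
    have : 0 ≤ ‖eta 0 s‖ * r ^ l := by positivity
    linarith

lemma summable_etaSigned (a : ℕ) (s : ℂ) : Summable (fun l => ‖etaSigned a s l‖) := by
  obtain ⟨C, _, hC⟩ := exists_etaSigned_bound a s (r := 1 / 2) (by norm_num)
  exact .of_nonneg_of_le (fun _ => norm_nonneg _) hC
    ((summable_geometric_of_lt_one (by norm_num) (by norm_num)).mul_left C)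

/-- The inverses tend to 0. A vanishing denominator has inverse 0 by convention, so rapid
convergence needs no condition on `d`. -/
lemma exists_inv_add_two_mul_bound (d : ℂ) : ∃ C : ℝ, 0 ≤ C ∧ ∀ n : ℕ, ‖(d + 2 * n)⁻¹‖ ≤ C := by
  have h1 : Tendsto (fun n : ℕ => ‖d + 2 * n‖) atTop atTop := by
    have h2 : Tendsto (fun n : ℕ => -‖d‖ + 2 * (n : ℝ)) atTop atTop :=
      tendsto_atTop_add_const_left _ _
        (tendsto_natCast_atTop_atTop.const_mul_atTop two_pos)
    refine tendsto_atTop_mono (fun n => ?_) h2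
    have h3 := norm_sub_le (d + 2 * n) d
    rw [add_sub_cancel_left, norm_mul, Complex.norm_ofNat, Complex.norm_natCast] at h3
    linarith
  have h4 : Tendsto (fun n : ℕ => ‖(d + 2 * n)⁻¹‖) atTop (𝓝 0) := by
    simp_rw [norm_inv]
    exact tendsto_inv_atTop_zero.comp h1
  obtain ⟨C, hC⟩ := h4.bddAbove_range
  exact ⟨C, (norm_nonneg _).trans (hC ⟨0, rfl⟩), fun n => hC ⟨n, rfl⟩⟩

lemma rapid_of_bound {ι : Type} {wt : ι → ℕ} {f : ι → ℂ}
    (hs : Summable (fun i => (1 / 2 : ℝ) ^ wt i))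
    (hf : ∀ r : ℝ, 1 / 4 < r → ∃ C : ℝ, ∀ i, ‖f i‖ ≤ C * r ^ wt i) : ConvergesRapidly wt f := by
  refine ⟨?_, hf⟩
  obtain ⟨C, hC⟩ := hf (1 / 2) (by norm_num)
  exact .of_norm_bounded (hs.mul_left C) hC

/-- Geometric decay with every ratio above `1 / 4`. -/
def RapidSeq (a : ℕ → ℂ) : Prop :=
  ∀ r : ℝ, 1 / 4 < r → ∃ C : ℝ, 0 ≤ C ∧ ∀ l, ‖a l‖ ≤ C * r ^ l

lemma rapidSeq_etaEven (s : ℂ) : RapidSeq (etaEven s) := fun r hr => by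
  rw [← etaSigned_zero]; exact exists_etaSigned_bound 0 s hr

lemma rapidSeq_etaOdd (s : ℂ) : RapidSeq (etaOdd s) := fun r hr => by
  simpa [etaSigned_one] using exists_etaSigned_bound 1 s hr

lemma rapid_single {a : ℕ → ℂ} (ha : RapidSeq a) (w d : ℂ) :
    ConvergesRapidly id (singleTerm a w d) := by
  refine rapid_of_bound (summable_geometric_of_lt_one (by norm_num) (by norm_num)) fun r hr => ?_
  have hr0 : 0 ≤ r := by linarith
  obtain ⟨A, hA0, hA⟩ := ha r hr
  obtain ⟨D, hD0, hD⟩ := exists_inv_add_two_mul_bound d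
  refine ⟨‖(2 : ℂ) ^ (-w)‖ * A * D, fun k => ?_⟩
  rw [singleTerm, div_eq_mul_inv, norm_mul, norm_mul]
  calc ‖(2 : ℂ) ^ (-w)‖ * ‖a k‖ * ‖(d + 2 * k)⁻¹‖ ≤ ‖(2 : ℂ) ^ (-w)‖ * (A * r ^ k) * D := by
        gcongr
        · exact hA k
        · exact hD k
    _ = _ := by simp only [id]; ring

lemma rapid_double {a b : ℕ → ℂ} (ha : RapidSeq a) (hb : RapidSeq b) (w d : ℂ) :
    ConvergesRapidly weight2 (doubleTerm a b w d) := by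
  refine rapid_of_bound (summable_geometric_two (by norm_num) (by norm_num)) fun r hr => ?_
  have hr0 : 0 ≤ r := by linarith
  obtain ⟨A, hA0, hA⟩ := ha r hr
  obtain ⟨B, hB0, hB⟩ := hb r hr
  obtain ⟨D, hD0, hD⟩ := exists_inv_add_two_mul_bound d
  refine ⟨‖(2 : ℂ) ^ (-w)‖ * A * B * D, fun k => ?_⟩
  have hDk := hD (k.1 + k.2)
  have e : d + 2 * ((k.1 + k.2 : ℕ) : ℂ) = d + 2 * k.1 + 2 * k.2 := by push_cast; ring
  rw [e] at hDk
  rw [doubleTerm, div_eq_mul_inv, norm_mul, norm_mul, norm_mul, weight2, pow_add]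
  calc ‖(2 : ℂ) ^ (-w)‖ * ‖a k.1‖ * ‖b k.2‖ * ‖(d + 2 * k.1 + 2 * k.2)⁻¹‖
      ≤ ‖(2 : ℂ) ^ (-w)‖ * (A * r ^ k.1) * (B * r ^ k.2) * D := by
        gcongr
        · exact hA _
        · exact hB _
    _ = _ := by ring

lemma rapid_triple {a b c : ℕ → ℂ} (ha : RapidSeq a) (hb : RapidSeq b) (hc : RapidSeq c) (d : ℂ) :
    ConvergesRapidly weight3 (tripleTerm a b c d) := by
  refine rapid_of_bound (summable_geometric_three (by norm_num) (by norm_num)) fun r hr => ?_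
  have hr0 : 0 ≤ r := by linarith
  obtain ⟨A, hA0, hA⟩ := ha r hr
  obtain ⟨B, hB0, hB⟩ := hb r hr
  obtain ⟨C, hC0, hC⟩ := hc r hr
  obtain ⟨D, hD0, hD⟩ := exists_inv_add_two_mul_bound d
  refine ⟨A * B * C * D, fun k => ?_⟩
  have hDk := hD (k.1 + k.2.1 + k.2.2)
  have e : d + 2 * ((k.1 + k.2.1 + k.2.2 : ℕ) : ℂ) = 2 * k.1 + 2 * k.2.1 + 2 * k.2.2 + d := by
    push_cast; ring
  rw [e] at hDk
  rw [tripleTerm, div_eq_mul_inv, norm_mul, norm_mul, norm_mul, weight3, pow_add, pow_add]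
  calc ‖a k.1‖ * ‖b k.2.1‖ * ‖c k.2.2‖ * ‖(2 * (k.1 : ℂ) + 2 * k.2.1 + 2 * k.2.2 + d)⁻¹‖
      ≤ (A * r ^ k.1) * (B * r ^ k.2.1) * (C * r ^ k.2.2) * D := by
        gcongr
        · exact hA _
        · exact hB _
        · exact hC _
    _ = _ := by ring

lemma rapidExpansion3 (s t u : ℂ) : RapidExpansion3 s t u :=
  ⟨rapid_triple (rapidSeq_etaEven s) (rapidSeq_etaEven t) (rapidSeq_etaEven u) _,
    rapid_double (rapidSeq_etaEven s) (rapidSeq_etaEven t) _ _,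
    rapid_double (rapidSeq_etaEven t) (rapidSeq_etaEven u) _ _,
    rapid_double (rapidSeq_etaEven u) (rapidSeq_etaEven s) _ _,
    rapid_single (rapidSeq_etaEven s) _ _, rapid_single (rapidSeq_etaEven t) _ _,
    rapid_single (rapidSeq_etaEven u) _ _⟩

lemma rapidExpansion4 (s t u : ℂ) : RapidExpansion4 s t u :=
  ⟨rapid_triple (rapidSeq_etaOdd s) (rapidSeq_etaOdd t) (rapidSeq_etaEven u) _,
    rapid_double (rapidSeq_etaOdd s) (rapidSeq_etaOdd t) _ _,
    rapid_double (rapidSeq_etaOdd t) (rapidSeq_etaEven u) _ _,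
    rapid_double (rapidSeq_etaEven u) (rapidSeq_etaOdd s) _ _,
    rapid_single (rapidSeq_etaOdd s) _ _, rapid_single (rapidSeq_etaOdd t) _ _,
    rapid_single (rapidSeq_etaEven u) _ _⟩

end Rapid

/-! ### The bracket of the expansion and its entire numerator -/

section Numerator

/-- The bracket of the two expansions, for the signed coefficients `etaSigned a`. -/
def bracket (a : ℕ) (s t u : ℂ) : ℂ :=
  (2 : ℂ) ^ (-s - t - u) / (s + t + u - 2)
    + ∑' k, tripleTerm (etaSigned a s) (etaSigned a t) (etaSigned 0 u) (2 * a + 1) k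
    + ∑' k, doubleTerm (etaSigned a s) (etaSigned a t) u (u + 2 * a) k
    + ∑' k, doubleTerm (etaSigned a t) (etaSigned 0 u) s (s + a) k
    + ∑' k, doubleTerm (etaSigned 0 u) (etaSigned a s) t (t + a) k
    + ∑' k, singleTerm (etaSigned a s) (t + u) (t + u - 1 + a) k
    + ∑' k, singleTerm (etaSigned a t) (u + s) (u + s - 1 + a) k
    + ∑' k, singleTerm (etaSigned 0 u) (s + t) (s + t - 1) k

lemma expansion3_eq (s t u : ℂ) : expansion3 s t u = Gccc s t u * bracket 0 s t u := by
  simp [expansion3, bracket, etaSigned_zero]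

/-- The sign in `etaSigned 1` accounts for the minus signs of the second expansion: they stand at
the series containing exactly one odd-indexed η, and cancel where two occur. -/
lemma expansion4_eq (s t u : ℂ) : expansion4 s t u = Gssc s t u * bracket 1 s t u := by
  have h1 : ∀ (a b c : ℕ → ℂ) d, tripleTerm (fun k => -a k) (fun k => -b k) c d =
      tripleTerm a b c d := fun a b c d => by ext k; simp [tripleTerm]
  have h2 : ∀ (a b : ℕ → ℂ) w d, doubleTerm (fun k => -a k) (fun k => -b k) w d =
      doubleTerm a b w d := fun a b w d => by ext k; simp [doubleTerm]
  have h3 : ∀ (a b : ℕ → ℂ) w d, doubleTerm (fun k => -a k) b w d =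
      fun k => -doubleTerm a b w d k := fun a b w d => by ext k; simp [doubleTerm, neg_div]
  have h4 : ∀ (a b : ℕ → ℂ) w d, doubleTerm a (fun k => -b k) w d =
      fun k => -doubleTerm a b w d k := fun a b w d => by ext k; simp [doubleTerm, neg_div]
  have h5 : ∀ (a : ℕ → ℂ) w d, singleTerm (fun k => -a k) w d =
      fun k => -singleTerm a w d k := fun a w d => by ext k; simp [singleTerm, neg_div]
  rw [expansion4, bracket]
  simp only [etaSigned_zero, etaSigned_one, h1, h2, h3, h4, h5, tsum_neg]
  norm_num
  left
  ring

/-- `∑ κ_l(x) κ_m(y) ψ(z) / (z + 2 (l + m + j))`. -/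
def doubleSum (a b j : ℕ) (p : ℂ × ℂ × ℂ) : ℂ :=
  ∑' k : ℕ × ℕ, kappa a k.1 p.1 * kappa b k.2 p.2.1 * psiQuot (k.1 + k.2 + j) p.2.2

/-- `∑ κ_l(x) ψ(z) / (z + 2 l)`. -/
def singleSum (a : ℕ) (p : ℂ × ℂ) : ℂ := ∑' k : ℕ, kappa a k p.1 * psiQuot k p.2

/-- `∑ κ_l(s) κ_m(t) κ_n(u) / (2 l + 2 m + 2 n + 2 a + 1)`. -/
def tripleSum (a : ℕ) (p : ℂ × ℂ × ℂ) : ℂ :=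
  ∑' k : ℕ × ℕ × ℕ, tripleTerm (fun l => kappa a l p.1) (fun l => kappa a l p.2.1)
    (fun l => kappa 0 l p.2.2) (2 * a + 1) k

lemma differentiable_singleSum (a : ℕ) : Differentiable ℂ (singleSum a) := by
  refine differentiableOn_univ.1 (differentiableOn_tsum_of_locally_summable isOpen_univ
    (fun k => ?_) fun p _ => ?_)
  · exact (((differentiable_kappa a k).comp differentiable_fst).mul
      ((differentiable_psiQuot k).comp differentiable_snd)).differentiableOn
  · obtain ⟨A, hA0, hA⟩ := exists_kappa_bound a p.1
    obtain ⟨D, hD0, hD⟩ := exists_psiQuot_bound p.2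
    refine ⟨fun l => A * (9 / 16) ^ l * D, ((summable_geometric_of_lt_one (by norm_num)
      (by norm_num)).mul_left A).mul_right D, ?_⟩
    filter_upwards [continuousAt_fst.eventually hA, continuousAt_snd.eventually hD]
      with q h1 h2 l
    rw [norm_mul]
    gcongr
    · exact h1 l
    · exact h2 l

lemma differentiable_doubleSum (a b j : ℕ) : Differentiable ℂ (doubleSum a b j) := by
  refine differentiableOn_univ.1 (differentiableOn_tsum_of_locally_summable isOpen_univ
    (fun k => ?_) fun p _ => ?_)
  · exact ((((differentiable_kappa a k.1).comp differentiable_fst).mul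
      ((differentiable_kappa b k.2).comp (differentiable_fst.comp differentiable_snd))).mul
      ((differentiable_psiQuot (k.1 + k.2 + j)).comp
        (differentiable_snd.comp differentiable_snd))).differentiableOn
  · obtain ⟨A, hA0, hA⟩ := exists_kappa_bound a p.1
    obtain ⟨B, hB0, hB⟩ := exists_kappa_bound b p.2.1
    obtain ⟨D, hD0, hD⟩ := exists_psiQuot_bound p.2.2
    refine ⟨fun k => A * B * D * (9 / 16) ^ (k.1 + k.2),
      (summable_geometric_two (by norm_num) (by norm_num)).mul_left _, ?_⟩
    have c1 : ContinuousAt (fun q : ℂ × ℂ × ℂ => q.1) p := continuousAt_fst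
    have c2 : ContinuousAt (fun q : ℂ × ℂ × ℂ => q.2.1) p := by fun_prop
    have c3 : ContinuousAt (fun q : ℂ × ℂ × ℂ => q.2.2) p := by fun_prop
    filter_upwards [c1.eventually hA, c2.eventually hB, c3.eventually hD] with q h1 h2 h3 k
    rw [norm_mul, norm_mul, pow_add]
    calc _ ≤ (A * (9 / 16) ^ k.1) * (B * (9 / 16) ^ k.2) * D := by
          gcongr
          · exact h1 _
          · exact h2 _
          · exact h3 _
      _ = _ := by ring

lemma differentiable_tripleSum (a : ℕ) : Differentiable ℂ (tripleSum a) := by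
  refine differentiableOn_univ.1 (differentiableOn_tsum_of_locally_summable isOpen_univ
    (fun k => ?_) fun p _ => ?_)
  · simp only [tripleTerm, div_eq_mul_inv]
    exact (((((differentiable_kappa a k.1).comp differentiable_fst).mul
      ((differentiable_kappa a k.2.1).comp (differentiable_fst.comp differentiable_snd))).mul
      ((differentiable_kappa 0 k.2.2).comp
        (differentiable_snd.comp differentiable_snd))).mul_const _).differentiableOn
  · obtain ⟨A, hA0, hA⟩ := exists_kappa_bound a p.1
    obtain ⟨B, hB0, hB⟩ := exists_kappa_bound a p.2.1
    obtain ⟨C, hC0, hC⟩ := exists_kappa_bound 0 p.2.2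
    obtain ⟨D, hD0, hD⟩ := exists_inv_add_two_mul_bound (2 * a + 1)
    refine ⟨fun k => A * B * C * D * (9 / 16) ^ (k.1 + k.2.1 + k.2.2),
      (summable_geometric_three (by norm_num) (by norm_num)).mul_left _, ?_⟩
    have c1 : ContinuousAt (fun q : ℂ × ℂ × ℂ => q.1) p := continuousAt_fst
    have c2 : ContinuousAt (fun q : ℂ × ℂ × ℂ => q.2.1) p := by fun_prop
    have c3 : ContinuousAt (fun q : ℂ × ℂ × ℂ => q.2.2) p := by fun_prop
    filter_upwards [c1.eventually hA, c2.eventually hB, c3.eventually hC] with q h1 h2 h3 k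
    have hDk := hD (k.1 + k.2.1 + k.2.2)
    have e : (2 * a + 1 : ℂ) + 2 * ((k.1 + k.2.1 + k.2.2 : ℕ) : ℂ) =
        2 * k.1 + 2 * k.2.1 + 2 * k.2.2 + (2 * a + 1) := by
      push_cast; ring
    rw [e] at hDk
    rw [tripleTerm, div_eq_mul_inv, norm_mul, norm_mul, norm_mul, pow_add, pow_add]
    calc _ ≤ (A * (9 / 16) ^ k.1) * (B * (9 / 16) ^ k.2.1) * (C * (9 / 16) ^ k.2.2) * D := by
          gcongr
          · exact h1 _
          · exact h2 _
          · exact h3 _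
      _ = _ := by ring

/-- The product of the factors which vanish on the singular hyperplanes. -/
def polar (a : ℕ) (p : ℂ × ℂ × ℂ) : ℂ :=
  psi (p.1 + p.2.1 - 1) * psi (p.2.1 + p.2.2 - 1 + a) * psi (p.2.2 + p.1 - 1 + a) *
    (p.1 + p.2.1 + p.2.2 - 2)

/-- The bracket multiplied by `polar` and by the factors which vanish at the poles of
`Γ_cos` and `Γ_sin`, as an entire function. -/
def numer (a : ℕ) (p : ℂ × ℂ × ℂ) : ℂ :=
  (2 : ℂ) ^ (-p.1 - p.2.1 - p.2.2) * (psi (p.1 + a) * psi (p.2.1 + a) * psi p.2.2) *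
      (psi (p.1 + p.2.1 - 1) * psi (p.2.1 + p.2.2 - 1 + a) * psi (p.2.2 + p.1 - 1 + a))
    + polar a p * (tripleSum a p
      -- Here two odd exponents shift the denominator by 2a, which is absorbed in the index of
      -- `psiQuot`. In the other two double sums the single shift a goes into the argument, because
      -- the zeros are supplied by ψ(s + a) and ψ(t + a).
      + (2 : ℂ) ^ (-p.2.2) * doubleSum a a a (p.1, p.2.1, p.2.2)
      + (2 : ℂ) ^ (-p.1) * doubleSum a 0 0 (p.2.1, p.2.2, p.1 + a)
      + (2 : ℂ) ^ (-p.2.1) * doubleSum 0 a 0 (p.2.2, p.1, p.2.1 + a))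
    + (p.1 + p.2.1 + p.2.2 - 2) *
      ((2 : ℂ) ^ (-(p.2.1 + p.2.2)) * (psi (p.2.1 + a) * psi p.2.2) *
          (psi (p.1 + p.2.1 - 1) * psi (p.2.2 + p.1 - 1 + a)) *
          singleSum a (p.1, p.2.1 + p.2.2 - 1 + a)
        + (2 : ℂ) ^ (-(p.2.2 + p.1)) * (psi p.2.2 * psi (p.1 + a)) *
          (psi (p.1 + p.2.1 - 1) * psi (p.2.1 + p.2.2 - 1 + a)) *
          singleSum a (p.2.1, p.2.2 + p.1 - 1 + a)
        + (2 : ℂ) ^ (-(p.1 + p.2.1)) * (psi (p.1 + a) * psi (p.2.1 + a)) *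
          (psi (p.2.1 + p.2.2 - 1 + a) * psi (p.2.2 + p.1 - 1 + a)) *
          singleSum 0 (p.2.2, p.1 + p.2.1 - 1))

lemma differentiable_two_cpow {E : Type*} [NormedAddCommGroup E] [NormedSpace ℂ E] {f : E → ℂ}
    (hf : Differentiable ℂ f) : Differentiable ℂ (fun x => (2 : ℂ) ^ f x) := fun x =>
  (hf x).const_cpow (Or.inl two_ne_zero)

lemma differentiable_psi_comp {E : Type*} [NormedAddCommGroup E] [NormedSpace ℂ E] {f : E → ℂ}
    (hf : Differentiable ℂ f) : Differentiable ℂ (fun x => psi (f x)) :=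
  differentiable_psi.comp hf

lemma differentiable_polar (a : ℕ) : Differentiable ℂ (polar a) := by
  unfold polar
  refine ((Differentiable.mul (Differentiable.mul ?_ ?_) ?_)).mul (by fun_prop) <;>
  exact differentiable_psi_comp (by fun_prop)

lemma differentiable_numer (a : ℕ) : Differentiable ℂ (numer a) := by
  have d2 : ∀ (a b j : ℕ) {f : ℂ × ℂ × ℂ → ℂ × ℂ × ℂ}, Differentiable ℂ f →
      Differentiable ℂ (fun p => doubleSum a b j (f p)) := fun a b j f hf =>
    (differentiable_doubleSum a b j).comp hf
  have d1 : ∀ (a : ℕ) {f : ℂ × ℂ × ℂ → ℂ × ℂ}, Differentiable ℂ f →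
      Differentiable ℂ (fun p => singleSum a (f p)) := fun a f hf =>
    (differentiable_singleSum a).comp hf
  have t := differentiable_tripleSum a
  have po := differentiable_polar a
  have x1 : Differentiable ℂ (fun p : ℂ × ℂ × ℂ => psi (p.1 + a)) :=
    differentiable_psi_comp (by fun_prop)
  have x2 : Differentiable ℂ (fun p : ℂ × ℂ × ℂ => psi (p.2.1 + a)) :=
    differentiable_psi_comp (by fun_prop)
  have x3 : Differentiable ℂ (fun p : ℂ × ℂ × ℂ => psi p.2.2) :=
    differentiable_psi_comp (by fun_prop)
  have y1 : Differentiable ℂ (fun p : ℂ × ℂ × ℂ => psi (p.1 + p.2.1 - 1)) :=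
    differentiable_psi_comp (by fun_prop)
  have y2 : Differentiable ℂ (fun p : ℂ × ℂ × ℂ => psi (p.2.1 + p.2.2 - 1 + a)) :=
    differentiable_psi_comp (by fun_prop)
  have y3 : Differentiable ℂ (fun p : ℂ × ℂ × ℂ => psi (p.2.2 + p.1 - 1 + a)) :=
    differentiable_psi_comp (by fun_prop)
  have tw : ∀ {f : ℂ × ℂ × ℂ → ℂ}, Differentiable ℂ f →
      Differentiable ℂ (fun p => (2 : ℂ) ^ f p) := differentiable_two_cpow
  have z0 : Differentiable ℂ (fun p : ℂ × ℂ × ℂ => p.1 + p.2.1 + p.2.2 - 2) := by fun_prop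
  unfold numer
  exact ((((tw (by fun_prop)).mul ((x1.mul x2).mul x3)).mul ((y1.mul y2).mul y3)).add
    (po.mul (((t.add ((tw (by fun_prop)).mul (d2 _ _ _ (by fun_prop)))).add
      ((tw (by fun_prop)).mul (d2 _ _ _ (by fun_prop)))).add
      ((tw (by fun_prop)).mul (d2 _ _ _ (by fun_prop)))))).add
    (z0.mul ((((((tw (by fun_prop)).mul (x2.mul x3)).mul (y1.mul y3)).mul
      (d1 _ (by fun_prop))).add
      ((((tw (by fun_prop)).mul (x3.mul x1)).mul (y1.mul y2)).mul (d1 _ (by fun_prop)))).add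
      ((((tw (by fun_prop)).mul (x1.mul x2)).mul (y2.mul y3)).mul (d1 _ (by fun_prop)))))

lemma singleSum_eq {a : ℕ} {x z : ℂ} (hx : psi (x + a) ≠ 0) (hz : psi z ≠ 0) (w : ℂ) :
    (2 : ℂ) ^ (-w) * singleSum a (x, z) =
      psi (x + a) * psi z * ∑' k, singleTerm (etaSigned a x) w z k := by
  rw [singleSum, ← tsum_mul_left, ← tsum_mul_left]
  refine tsum_congr fun k => ?_
  rw [kappa_eq_psi_mul hx, psiQuot_eq_div (add_two_mul_ne_zero_of_psi_ne_zero hz k), singleTerm]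
  ring

lemma doubleSum_eq {a b j : ℕ} {x y z : ℂ} (hx : psi (x + a) ≠ 0) (hy : psi (y + b) ≠ 0)
    (hz : psi z ≠ 0) (w : ℂ) :
    (2 : ℂ) ^ (-w) * doubleSum a b j (x, y, z) = psi (x + a) * psi (y + b) * psi z *
      ∑' k, doubleTerm (etaSigned a x) (etaSigned b y) w (z + 2 * j) k := by
  rw [doubleSum, ← tsum_mul_left, ← tsum_mul_left]
  refine tsum_congr fun k => ?_
  rw [kappa_eq_psi_mul hx, kappa_eq_psi_mul hy,
    psiQuot_eq_div (add_two_mul_ne_zero_of_psi_ne_zero hz _), doubleTerm]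
  have e : z + 2 * ((k.1 + k.2 + j : ℕ) : ℂ) = z + 2 * j + 2 * k.1 + 2 * k.2 := by
    push_cast; ring
  rw [e]
  ring

lemma tripleSum_eq {a : ℕ} {s t u : ℂ} (hs : psi (s + a) ≠ 0) (ht : psi (t + a) ≠ 0)
    (hu : psi u ≠ 0) : tripleSum a (s, t, u) = psi (s + a) * psi (t + a) * psi u *
      ∑' k, tripleTerm (etaSigned a s) (etaSigned a t) (etaSigned 0 u) (2 * a + 1) k := by
  have hu' : psi (u + (0 : ℕ)) ≠ 0 := by simpa using hu
  rw [tripleSum, ← tsum_mul_left]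
  refine tsum_congr fun k => ?_
  simp only [tripleTerm]
  rw [kappa_eq_psi_mul hs, kappa_eq_psi_mul ht, kappa_eq_psi_mul hu', Nat.cast_zero, add_zero]
  ring

/-- `numer` is a multiple of the bracket. -/
lemma numer_eq_mul_bracket {a : ℕ} {s t u : ℂ} (hs : psi (s + a) ≠ 0) (ht : psi (t + a) ≠ 0)
    (hu : psi u ≠ 0) (hp : polar a (s, t, u) ≠ 0) :
    numer a (s, t, u) =
      polar a (s, t, u) * (psi (s + a) * psi (t + a) * psi u) * bracket a s t u := by
  have hu' : psi (u + (0 : ℕ)) ≠ 0 := by simpa using hu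
  have hp' := hp
  simp only [polar, mul_ne_zero_iff] at hp'
  obtain ⟨⟨⟨h1, h2⟩, h3⟩, h4⟩ := hp'
  have e1 := singleSum_eq hs h2 (t + u)
  have e2 := singleSum_eq ht h3 (u + s)
  have e3 := singleSum_eq hu' h1 (s + t)
  have e4 := doubleSum_eq (j := a) hs ht hu u
  have e5 := doubleSum_eq (j := 0) ht hu' hs s
  have e6 := doubleSum_eq (j := 0) hu' hs ht t
  have e7 := tripleSum_eq hs ht hu
  simp only [Nat.cast_zero, add_zero, mul_zero] at e3 e5 e6
  have eq : ∀ A : ℂ, A = (s + t + u - 2) * (A / (s + t + u - 2)) := fun A => by field_simp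
  rw [numer, bracket]
  simp only
  rw [e4, e5, e6, e7, polar]
  simp only
  linear_combination (s + t + u - 2) * (psi (t + a) * psi u * (psi (s + t - 1) *
      psi (u + s - 1 + a))) * e1 + (s + t + u - 2) * (psi u * psi (s + a) * (psi (s + t - 1) *
      psi (t + u - 1 + a))) * e2 + (s + t + u - 2) * (psi (s + a) * psi (t + a) *
      (psi (t + u - 1 + a) * psi (u + s - 1 + a))) * e3 +
      (psi (s + a) * psi (t + a) * psi u) * (psi (s + t - 1) * psi (t + u - 1 + a) *
      psi (u + s - 1 + a)) * eq ((2 : ℂ) ^ (-s - t - u))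

end Numerator

/-! ### The expansion of the even and odd Hurwitz zeta functions -/

section Hurwitz

open Complex HurwitzZeta

lemma hasSum_one_div_one_sub_cpow (s : ℂ) {z : ℂ} (hz : ‖z‖ < 1) :
    HasSum (fun k : ℕ => binomProd k s * z ^ k) (1 / (1 - z) ^ (1 - s)) := by
  have h := (one_div_one_sub_cpow_hasFPowerSeriesOnBall_zero (1 - s)).hasSum (y := z)
    (by simpa [← ofReal_norm, enorm_eq_nnnorm, ← NNReal.coe_lt_coe] using hz)
  rw [zero_add] at h
  refine h.congr_fun fun k => ?_
  rw [FormalMultilinearSeries.ofScalars_apply_eq, smul_eq_mul, ← ringChoose_eq_binomProd]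
  congr 2
  ring

lemma hasSum_one_div_sub_cpow (s : ℂ) {x : ℝ} (hx : |x| < 1) (n : ℕ) :
    HasSum (fun k : ℕ => binomProd k s * (x : ℂ) ^ k / ((n : ℂ) + 1) ^ ((k : ℂ) + 1 - s))
      (1 / ((n : ℂ) + 1 - x) ^ (1 - s)) := by
  have hn : (0 : ℝ) < n + 1 := by positivity
  have hnc : ((n : ℂ) + 1) ≠ 0 := Nat.cast_add_one_ne_zero n
  have hz : |x / (n + 1)| < 1 := by
    rw [abs_div, abs_of_pos hn, div_lt_one hn]
    linarith [(Nat.cast_nonneg n : (0 : ℝ) ≤ n)]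
  have h := (hasSum_one_div_one_sub_cpow s (z := ((x / (n + 1) : ℝ) : ℂ))
    (by rw [Complex.norm_real]; exact hz)).div_const (((n : ℂ) + 1) ^ (1 - s))
  have e1 : (n : ℂ) + 1 - x = ((n + 1 : ℝ) : ℂ) * ((1 - x / (n + 1) : ℝ) : ℂ) := by
    push_cast; field_simp
  have e2 : ((n : ℂ) + 1) = ((n + 1 : ℝ) : ℂ) := by push_cast; rfl
  have hpos : (0 : ℝ) ≤ 1 - x / (n + 1) := by linarith [le_abs_self (x / (n + 1))]
  have e4 : 1 / ((n : ℂ) + 1 - x) ^ (1 - s) =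
      1 / (1 - ((x / (n + 1) : ℝ) : ℂ)) ^ (1 - s) / ((n : ℂ) + 1) ^ (1 - s) := by
    rw [e1, mul_cpow_ofReal_nonneg hn.le hpos, ← e2]
    push_cast
    ring
  rw [e4]
  refine h.congr_fun fun k => ?_
  have e3 : (k : ℂ) + 1 - s = k + (1 - s) := by ring
  rw [e3, cpow_add _ _ hnc, cpow_natCast]
  push_cast
  rw [div_pow]
  field_simp

lemma hasSum_zeta {w : ℂ} (hw : 1 < w.re) :
    HasSum (fun n : ℕ => 1 / ((n : ℂ) + 1) ^ w) (riemannZeta w) := by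
  rw [zeta_eq_tsum_one_div_nat_add_one_cpow hw]
  refine Summable.hasSum ?_
  have := (summable_nat_add_iff 1).2 (Complex.summable_one_div_nat_cpow.2 hw)
  simpa using this

/-- Each summand is expanded in powers of `x` by the binomial series, and the order of summation is
exchanged: the sum over `n` of the k-th coefficients is ζ(k + 1 - s). Negative real part of `s`
makes the double family absolutely summable even for k = 0. -/
lemma hasSum_shifted {a : ℕ} (ha : a ≤ 1) {s : ℂ} (hs : s.re < 0) {x : ℝ}
    (hx0 : 0 < x) (hx : x < 1) :
    HasSum (fun n : ℕ => (1 / ((n : ℂ) + 1 + x) ^ (1 - s) +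
        (-1) ^ a * (1 / ((n : ℂ) + 1 - x) ^ (1 - s))) / 2)
      (∑' l : ℕ, etaSigned a s l * (2 * (x : ℂ)) ^ (2 * l + a)) := by
  -- The sign average comes from adding the expansions at `-x` and `x`; it vanishes unless the
  -- exponent has the parity of `a`.
  set F : ℕ × ℕ → ℂ := fun p => ((-1) ^ p.2 + (-1) ^ a) / 2 *
    (binomProd p.2 s * (x : ℂ) ^ p.2 / ((p.1 : ℂ) + 1) ^ ((p.2 : ℂ) + 1 - s)) with hF
  have hsign : ∀ k : ℕ, ‖(((-1) ^ k + (-1) ^ a) / 2 : ℂ)‖ ≤ 1 := fun k => by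
    rw [norm_div, Complex.norm_ofNat, div_le_one two_pos]
    refine (norm_add_le _ _).trans ?_
    simp; norm_num
  have hsum : Summable F := by
    have h1 : Summable (fun n : ℕ => 1 / ((n : ℝ) + 1) ^ (1 - s.re)) := by
      have := (summable_nat_add_iff 1).2 (Real.summable_one_div_nat_rpow.2
        (show 1 < 1 - s.re by linarith))
      simpa using this
    have h2 := summable_prod_one_add_div (norm_nonneg s) hx0 hx
    refine .of_norm_bounded (h1.mul_of_nonneg h2 (fun n => by positivity)
      (fun k => mul_nonneg (Finset.prod_nonneg fun i _ => by positivity) (by positivity)))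
      fun p => ?_
    have e : ((p.1 : ℂ) + 1) = ((p.1 + 1 : ℝ) : ℂ) := by push_cast; rfl
    have h3 := norm_binomProd_le (le_refl ‖s‖) p.2
    have h4 : (0 : ℝ) < p.1 + 1 := by positivity
    rw [hF]
    simp only
    rw [norm_mul, norm_div (binomProd p.2 s * (x : ℂ) ^ p.2), norm_mul, norm_pow,
      Complex.norm_real, Real.norm_of_nonneg hx0.le, e,
      Complex.norm_cpow_eq_rpow_re_of_pos h4]
    have h5 : ((p.1 : ℝ) + 1) ^ (1 - s.re) ≤ ((p.1 : ℝ) + 1) ^ (((p.2 : ℂ) + 1 - s).re) := by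
      refine Real.rpow_le_rpow_of_exponent_le (by
        linarith [(Nat.cast_nonneg p.1 : (0 : ℝ) ≤ p.1)]) ?_
      simp
    have h6 : (0 : ℝ) < ((p.1 : ℝ) + 1) ^ (1 - s.re) := by positivity
    calc ‖(((-1) ^ p.2 + (-1) ^ a) / 2 : ℂ)‖ * (‖binomProd p.2 s‖ * x ^ p.2 /
          ((p.1 : ℝ) + 1) ^ (((p.2 : ℂ) + 1 - s).re))
        ≤ 1 * ((∏ i ∈ Finset.range p.2, (1 + ‖s‖ / ((i : ℝ) + 1))) * x ^ p.2 /
          ((p.1 : ℝ) + 1) ^ (1 - s.re)) := by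
          gcongr
          exact hsign _
      _ = _ := by ring
  have hrow : ∀ n : ℕ, HasSum (fun k => F (n, k)) ((1 / ((n : ℂ) + 1 + x) ^ (1 - s) +
        (-1) ^ a * (1 / ((n : ℂ) + 1 - x) ^ (1 - s))) / 2) := by
    intro n
    have h1 := hasSum_one_div_sub_cpow s (x := x) (by rw [abs_of_pos hx0]; exact hx) n
    have h2 := hasSum_one_div_sub_cpow s (x := -x) (by rw [abs_neg, abs_of_pos hx0]; exact hx) n
    have h3 := (h2.add (h1.mul_left ((-1) ^ a))).div_const 2
    have e : (n : ℂ) + 1 - ((-x : ℝ) : ℂ) = n + 1 + x := by push_cast; ring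
    rw [e] at h3
    refine h3.congr_fun fun k => ?_
    rw [hF]
    simp only
    push_cast
    rw [neg_pow]
    ring
  have hcol : ∀ k : ℕ, HasSum (fun n => F (n, k))
      (((-1) ^ k + (-1) ^ a) / 2 * (binomProd k s * (x : ℂ) ^ k * riemannZeta (k + 1 - s))) := by
    intro k
    have h1 := ((hasSum_zeta (w := k + 1 - s) (by
      simp; linarith [(Nat.cast_nonneg k : (0 : ℝ) ≤ k)])).mul_left
      (binomProd k s * (x : ℂ) ^ k)).mul_left (((-1) ^ k + (-1) ^ a) / 2 : ℂ)
    refine h1.congr_fun fun n => ?_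
    rw [hF]
    simp only
    ring
  have htot := hsum.hasSum.prod_fiberwise hrow
  have hswap : HasSum (F ∘ Prod.swap) (∑' p, F p) := (Equiv.prodComm ℕ ℕ).hasSum_iff.2 hsum.hasSum
  have hcols := hswap.prod_fiberwise hcol
  -- Only the exponents 2l + a survive. The factor 2^(-k) inside η_k is why the resulting series is
  -- in powers of 2x.
  have hinj : Function.Injective (fun l : ℕ => 2 * l + a) := fun l m h => by
    simpa using h
  have hcols2 := (hinj.hasSum_iff (fun k hk => by
    have hodd : (k + a) % 2 = 1 := by
      by_contra h
      exact hk ⟨(k - a) / 2, by simp only; omega⟩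
    have h0 : ((-1) ^ k + (-1) ^ a : ℂ) = 0 := by
      have : ((-1 : ℂ)) ^ k * (-1) ^ a = -1 := by
        rw [← pow_add]; exact (Nat.odd_iff.2 hodd).neg_one_pow
      have h2 : ((-1 : ℂ)) ^ a * (-1) ^ a = 1 := by
        rw [← pow_add]; exact (Even.add_self a).neg_one_pow
      linear_combination (-1) ^ a * this - (-1) ^ k * h2
    rw [h0, zero_div, zero_mul])).2 hcols
  rw [← hcols2.tsum_eq] at htot
  convert htot using 1
  refine tsum_congr fun l => ?_
  have hne : s ≠ ((2 * l + a : ℕ) : ℂ) := fun h => by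
    rw [h, Complex.natCast_re] at hs
    exact absurd hs (not_lt.2 (Nat.cast_nonneg _))
  have hsg : ((-1 : ℂ)) ^ (2 * l + a) = (-1) ^ a := by
    rw [pow_add, pow_mul]; simp
  simp only [Function.comp_apply]
  rw [etaSigned, eta_of_ne hne, hsg, mul_pow]
  field_simp
  ring

/-- The even (`a = 0`) and odd (`a = 1`) Hurwitz zeta functions. -/
def hurwitzTrig (a : ℕ) (x : UnitAddCircle) (w : ℂ) : ℂ :=
  if a = 0 then hurwitzZetaEven x w else hurwitzZetaOdd x w

/-- The cosine (`a = 0`) and sine (`a = 1`) zeta functions. -/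
def trigZeta (a : ℕ) (x : UnitAddCircle) (w : ℂ) : ℂ :=
  if a = 0 then cosZeta x w else sinZeta x w

lemma hasSum_hurwitzTrig {a : ℕ} (ha : a ≤ 1) {x : ℝ} (hx : x ∈ Set.Icc 0 1) {w : ℂ}
    (hw : 1 < w.re) : HasSum (fun n : ℕ => (1 / ((n : ℂ) + x) ^ w +
      (-1) ^ a * (1 / ((n : ℂ) + 1 - x) ^ w)) / 2) (hurwitzTrig a x w) := by
  unfold hurwitzTrig
  split_ifs with h
  · subst h
    simpa using hasSum_nat_hurwitzZetaEven_of_mem_Icc hx hw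
  · obtain rfl : a = 1 := by omega
    simpa [sub_eq_add_neg] using hasSum_nat_hurwitzZetaOdd_of_mem_Icc hx hw

/-- The two halves of the Hurwitz series start at x and at 1 - x. Removing the initial term of the
first half alone aligns them as n + 1 ± x, and this term is the power x^(s-1) / 2. -/
lemma hurwitzTrig_one_sub_of_re_neg {a : ℕ} (ha : a ≤ 1) {s : ℂ} (hs : s.re < 0) {x : ℝ}
    (hx0 : 0 < x) (hx : x < 1) : hurwitzTrig a x (1 - s) =
      (x : ℂ) ^ (s - 1) / 2 + ∑' l : ℕ, etaSigned a s l * (2 * (x : ℂ)) ^ (2 * l + a) := by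
  have hw : 1 < (1 - s).re := by simp; linarith
  have h1 := hasSum_hurwitzTrig ha ⟨hx0.le, hx.le⟩ hw
  have h2 := hasSum_shifted ha hs hx0 hx
  set f : ℕ → ℂ := fun n => 1 / ((n : ℂ) + x) ^ (1 - s) / 2 with hf
  have hfs : Summable f := by
    refine Summable.div_const ?_ 2
    refine .of_norm ?_
    have h3 := (Real.summable_one_div_nat_add_rpow x (1 - s).re).2 hw
    refine h3.congr fun n => ?_
    have hpos : (0 : ℝ) < n + x := by positivity
    have e : ((n : ℂ) + x) = ((n + x : ℝ) : ℂ) := by push_cast; rfl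
    rw [abs_of_pos hpos, norm_div, norm_one, e, Complex.norm_cpow_eq_rpow_re_of_pos hpos]
  have h4 := (hasSum_nat_add_iff' 1).2 hfs.hasSum
  have h5 := (h1.sub hfs.hasSum).add h4
  have h6 : HasSum (fun n : ℕ => (1 / ((n : ℂ) + 1 + x) ^ (1 - s) +
        (-1) ^ a * (1 / ((n : ℂ) + 1 - x) ^ (1 - s))) / 2)
      (hurwitzTrig a x (1 - s) - (x : ℂ) ^ (s - 1) / 2) := by
    have e : (x : ℂ) ^ (s - 1) = 1 / (x : ℂ) ^ (1 - s) := by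
      rw [one_div, ← cpow_neg, neg_sub]
    have e2 : hurwitzTrig a x (1 - s) - (x : ℂ) ^ (s - 1) / 2 =
        hurwitzTrig a x (1 - s) - ∑' b, f b + (∑' b, f b - ∑ i ∈ Finset.range 1, f i) := by
      rw [Finset.sum_range_one, hf, e]
      simp
    rw [e2]
    refine h5.congr_fun fun n => ?_
    rw [hf]
    push_cast
    ring
  have := h6.unique h2
  linear_combination this

lemma differentiableOn_hurwitzTrig_one_sub (a : ℕ) (x : UnitAddCircle) :
    DifferentiableOn ℂ (fun s => hurwitzTrig a x (1 - s)) {0}ᶜ := by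
  intro s hs
  have hd : DifferentiableAt ℂ (fun s : ℂ => 1 - s) s := by fun_prop
  have hs1 : 1 - s ≠ 1 := fun h => hs (by simpa using h)
  unfold hurwitzTrig
  split_ifs
  · exact (DifferentiableAt.comp s (differentiableAt_hurwitzZetaEven x hs1)
      hd).differentiableWithinAt
  · exact (DifferentiableAt.comp s (differentiable_hurwitzZetaOdd x _) hd).differentiableWithinAt

lemma differentiableOn_tsum_etaSigned (a : ℕ) {y : ℂ} (hy : ‖y‖ ≤ 1) :
    DifferentiableOn ℂ (fun s => ∑' l : ℕ, etaSigned a s l * y ^ (2 * l + a)) {0}ᶜ := by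
  refine differentiableOn_tsum_of_locally_summable isOpen_compl_singleton (fun l s hs => ?_)
    fun s hs => ?_
  · exact (((differentiableAt_eta (Or.inr hs)).const_mul _).mul_const _).differentiableWithinAt
  · obtain ⟨C, hC0, hC⟩ := exists_eta_bound (R := ‖s‖ + 1) (ρ := 3 / 4) (by positivity)
      (by norm_num)
    have hcont : ∀ᶠ z in 𝓝 s, ‖eta 0 z‖ < ‖eta 0 s‖ + 1 :=
      ((differentiableAt_eta (k := 0) (Or.inr hs)).continuousAt.norm.tendsto).eventually
        (gt_mem_nhds (by linarith))
    refine ⟨fun l => (C + (‖eta 0 s‖ + 1)) * (9 / 16) ^ l,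
      (summable_geometric_of_lt_one (by norm_num) (by norm_num)).mul_left _, ?_⟩
    filter_upwards [hcont, Metric.ball_mem_nhds s one_pos] with z h1 h2 l
    have hy' : ‖y ^ (2 * l + a)‖ ≤ 1 := by rw [norm_pow]; exact pow_le_one₀ (norm_nonneg _) hy
    have h3 : ‖etaSigned a z l * y ^ (2 * l + a)‖ ≤ ‖eta (2 * l + a) z‖ := by
      rw [etaSigned, norm_mul, norm_mul, norm_pow, norm_neg, norm_one, one_pow, one_mul]
      exact mul_le_of_le_one_right (norm_nonneg _) hy'
    refine h3.trans ?_
    by_cases h0 : 2 * l + a = 0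
    · obtain ⟨rfl, rfl⟩ : l = 0 ∧ a = 0 := by omega
      simp only [mul_zero, add_zero, pow_zero, mul_one]
      linarith
    · have hz : ‖z‖ ≤ ‖s‖ + 1 := by
        rw [mem_ball_iff_norm] at h2
        have : z = s + (z - s) := by ring
        rw [this]; exact (norm_add_le _ _).trans (by linarith)
      refine (hC _ z h0 hz).trans ?_
      have h5 : ((3 : ℝ) / 4) ^ (2 * l + a) ≤ (9 / 16) ^ l := by
        rw [pow_add, pow_mul]
        have : ((3 : ℝ) / 4) ^ a ≤ 1 := pow_le_one₀ (by norm_num) (by norm_num)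
        calc (((3 : ℝ) / 4) ^ 2) ^ l * (3 / 4) ^ a ≤ (((3 : ℝ) / 4) ^ 2) ^ l * 1 := by gcongr
          _ = _ := by rw [mul_one]; norm_num
      calc C * (3 / 4) ^ (2 * l + a) ≤ C * (9 / 16) ^ l := by gcongr
        _ ≤ _ := by gcongr; linarith [norm_nonneg (eta 0 s)]

/-- The expansion of `ζ(1 - s, y / 2) ± ζ(1 - s, 1 - y / 2)` in powers of `y`. -/
lemma hurwitzTrig_one_sub {a : ℕ} (ha : a ≤ 1) {s : ℂ} (hs : s ≠ 0) {y : ℝ}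
    (hy0 : 0 < y) (hy : y ≤ 1) : hurwitzTrig a ((y / 2 : ℝ) : UnitAddCircle) (1 - s) =
      (2 : ℂ) ^ (-s) * (y : ℂ) ^ (s - 1) + ∑' l : ℕ, etaSigned a s l * (y : ℂ) ^ (2 * l + a) := by
  set x : UnitAddCircle := ((y / 2 : ℝ) : UnitAddCircle)
  have hyc : (y : ℂ) ≠ 0 := ofReal_ne_zero.2 hy0.ne'
  have hd : DifferentiableOn ℂ (fun s => hurwitzTrig a x (1 - s) -
      ((2 : ℂ) ^ (-s) * (y : ℂ) ^ (s - 1) + ∑' l : ℕ, etaSigned a s l * (y : ℂ) ^ (2 * l + a)))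
      {0}ᶜ := by
    refine (differentiableOn_hurwitzTrig_one_sub a x).sub (DifferentiableOn.add ?_
      (differentiableOn_tsum_etaSigned a ?_))
    · refine Differentiable.differentiableOn (Differentiable.mul ?_ ?_)
      · exact differentiable_two_cpow (by fun_prop)
      · exact fun z => DifferentiableAt.const_cpow (by fun_prop) (Or.inl hyc)
    · rw [Complex.norm_real, Real.norm_of_nonneg hy0.le]; exact hy
  have hlt : ∀ᶠ z : ℂ in 𝓝 (-1), z.re < 0 :=
    (Complex.continuous_re.tendsto _).eventually (gt_mem_nhds (by norm_num))
  -- The identity is known for negative real part and extends in `s` to the plane without 0, where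
  -- both sides are holomorphic.
  refine sub_eq_zero.1 (eq_zero_of_eventuallyEq_zero_of_countable isOpen_compl_singleton hd
    (p := s) (q := -1) hs (by simp) ?_ ?_)
  · have := countable_line (Set.countable_singleton (0 : ℂ)) (x := s) (y := -1) hs
    simpa using this
  · filter_upwards [hlt] with z hz
    rw [hurwitzTrig_one_sub_of_re_neg ha hz (x := y / 2) (by positivity) (by linarith)]
    have e : ((y / 2 : ℝ) : ℂ) ^ (z - 1) / 2 = (2 : ℂ) ^ (-z) * (y : ℂ) ^ (z - 1) := by
      have h2 : (y : ℂ) = ((2 : ℝ) : ℂ) * ((y / 2 : ℝ) : ℂ) := by push_cast; ring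
      rw [h2, mul_cpow_ofReal_nonneg (by norm_num) (by positivity), ofReal_ofNat, ← mul_assoc,
        ← cpow_add _ _ two_ne_zero]
      have : -z + (z - 1) = -1 := by ring
      rw [this, cpow_neg_one]
      ring
    rw [e]
    have h3 : 2 * ((y / 2 : ℝ) : ℂ) = y := by push_cast; ring
    rw [h3, sub_self]

/-- Hurwitz's functional equation, with the factor Γ_cos or Γ_sin written as a quotient of values of
`psi` and cleared of its denominator. -/
lemma psi_mul_hurwitzTrig {a : ℕ} (ha : a ≤ 1) (x : UnitAddCircle) {s : ℂ} (hs : 1 < s.re) :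
    psi (s + a) * hurwitzTrig a x (1 - s) = psi (1 + a - s) * trigZeta a x s := by
  have hn : ∀ n : ℕ, s ≠ -(n : ℂ) := fun n h => by
    rw [h, neg_re, natCast_re] at hs
    linarith [(Nat.cast_nonneg n : (0 : ℝ) ≤ n)]
  have h1 : s ≠ 1 := fun h => by rw [h, one_re] at hs; exact lt_irrefl _ hs
  unfold hurwitzTrig trigZeta
  split_ifs with h
  · subst h
    rw [hurwitzZetaEven_one_sub x hn (Or.inr h1), Nat.cast_zero, add_zero, add_zero, psi, psi,
      inv_Gammaℝ_one_sub hn, Gammaℂ_def]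
    ring
  · obtain rfl : a = 1 := by omega
    have e : (1 : ℂ) + (1 : ℕ) - s = 2 - s := by push_cast; ring
    rw [hurwitzZetaOdd_one_sub x hn, e, psi, psi, inv_Gammaℝ_two_sub hn, Gammaℂ_def, Nat.cast_one]
    ring

end Hurwitz

/-! ### The bracket as an integral -/

section BracketIntegral

open Complex MeasureTheory

/-- On `(0, 1]`, `f` is the sum of the absolutely convergent series of powers `c i * y ^ e i`. -/
def IsPowerSum {ι : Type} (f : ℝ → ℂ) (c e : ι → ℂ) : Prop :=
  Summable (fun i => ‖c i‖) ∧ (∀ i, 0 ≤ (e i).re) ∧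
    ∀ y : ℝ, 0 < y → y ≤ 1 → HasSum (fun i => c i * (y : ℂ) ^ e i) (f y)

lemma norm_ofReal_cpow_le_one {y : ℝ} (h0 : 0 < y) (h1 : y ≤ 1) {e : ℂ} (he : 0 ≤ e.re) :
    ‖(y : ℂ) ^ e‖ ≤ 1 := by
  rw [norm_cpow_eq_rpow_re_of_pos h0]
  exact Real.rpow_le_one h0.le h1 he

lemma IsPowerSum.summable_norm {ι : Type} {f : ℝ → ℂ} {c e : ι → ℂ} (h : IsPowerSum f c e)
    {y : ℝ} (h0 : 0 < y) (h1 : y ≤ 1) : Summable (fun i => ‖c i * (y : ℂ) ^ e i‖) :=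
  .of_nonneg_of_le (fun _ => norm_nonneg _) (fun i => by
    rw [norm_mul]
    exact mul_le_of_le_one_right (norm_nonneg _) (norm_ofReal_cpow_le_one h0 h1 (h.2.1 i))) h.1

lemma IsPowerSum.mul {ι κ : Type} {f g : ℝ → ℂ} {c e : ι → ℂ} {c' e' : κ → ℂ}
    (hf : IsPowerSum f c e) (hg : IsPowerSum g c' e') :
    IsPowerSum (fun y => f y * g y) (fun p : ι × κ => c p.1 * c' p.2)
      (fun p => e p.1 + e' p.2) := by
  refine ⟨?_, fun p => ?_, fun y h0 h1 => ?_⟩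
  · simp_rw [norm_mul]
    exact hf.1.mul_of_nonneg hg.1 (fun _ => norm_nonneg _) (fun _ => norm_nonneg _)
  · rw [add_re]; exact add_nonneg (hf.2.1 _) (hg.2.1 _)
  · have hy : (y : ℂ) ≠ 0 := ofReal_ne_zero.2 h0.ne'
    have h1' := hf.summable_norm h0 h1
    have h2' := hg.summable_norm h0 h1
    have hs := summable_mul_of_summable_norm (f := fun i => c i * (y : ℂ) ^ e i)
      (g := fun i => c' i * (y : ℂ) ^ e' i) h1' h2'
    have := (hf.2.2 y h0 h1).mul (hg.2.2 y h0 h1) hs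
    have hc : (fun p : ι × κ => c p.1 * c' p.2 * (y : ℂ) ^ (e p.1 + e' p.2)) =
        fun p => c p.1 * (y : ℂ) ^ e p.1 * (c' p.2 * (y : ℂ) ^ e' p.2) := by
      ext p
      rw [cpow_add _ _ hy]; ring
    rw [hc]
    exact this

/-- Dominated convergence, with the summable constants `‖c i‖` as majorants since powers with
nonnegative real exponent part are at most 1 on (0, 1]. -/
lemma IsPowerSum.integral_eq {ι : Type} [Countable ι] {f : ℝ → ℂ} {c e : ι → ℂ}
    (hf : IsPowerSum f c e) : ∫ y in (0 : ℝ)..1, f y = ∑' i, c i / (e i + 1) := by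
  have h := intervalIntegral.hasSum_integral_of_dominated_convergence (μ := volume) (a := (0 : ℝ))
    (b := 1) (F := fun i (y : ℝ) => c i * (y : ℂ) ^ e i) (f := f) (fun i _ => ‖c i‖)
    (fun i => ?_) (fun i => ?_) ?_ ?_ ?_
  · rw [← h.tsum_eq]
    refine tsum_congr fun i => ?_
    have he := hf.2.1 i
    rw [intervalIntegral.integral_const_mul, integral_cpow (Or.inl (by linarith))]
    have hne : e i + 1 ≠ 0 := fun h0 => by
      have := congrArg Complex.re h0
      rw [add_re, one_re, zero_re] at this
      linarith
    rw [ofReal_one, one_cpow, ofReal_zero, zero_cpow hne, sub_zero, mul_one_div]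
  · refine (Measurable.aestronglyMeasurable ?_)
    fun_prop
  · refine Eventually.of_forall fun y hy => ?_
    rw [Set.uIoc_of_le zero_le_one] at hy
    rw [norm_mul]
    exact mul_le_of_le_one_right (norm_nonneg _)
      (norm_ofReal_cpow_le_one hy.1 hy.2 (hf.2.1 i))
  · exact Eventually.of_forall fun _ _ => hf.1
  · exact intervalIntegrable_const
  · refine Eventually.of_forall fun y hy => ?_
    rw [Set.uIoc_of_le zero_le_one] at hy
    exact hf.2.2 y hy.1 hy.2

/-- The leading term of the expansion of `hurwitzTrig`. -/
def powTerm (s : ℂ) (y : ℝ) : ℂ := (2 : ℂ) ^ (-s) * (y : ℂ) ^ (s - 1)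

/-- The regular part of the expansion of `hurwitzTrig`. -/
def etaSeries (a : ℕ) (s : ℂ) (y : ℝ) : ℂ := ∑' l : ℕ, etaSigned a s l * (y : ℂ) ^ (2 * l + a)

lemma isPowerSum_powTerm {s : ℂ} (hs : 1 < s.re) :
    IsPowerSum (powTerm s) (fun _ : Unit => (2 : ℂ) ^ (-s)) (fun _ => s - 1) := by
  refine ⟨(hasSum_fintype _).summable, fun _ => by simp; linarith, fun y _ _ => ?_⟩
  have := hasSum_fintype (fun _ : Unit => (2 : ℂ) ^ (-s) * (y : ℂ) ^ (s - 1))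
  simpa only [Finset.univ_unique, Finset.sum_singleton, powTerm] using this

lemma isPowerSum_etaSeries (a : ℕ) (s : ℂ) :
    IsPowerSum (etaSeries a s) (etaSigned a s) (fun l => 2 * l + a) := by
  refine ⟨summable_etaSigned a s, fun l => ?_, fun y h0 h1 => ?_⟩
  · have : (2 * (l : ℂ) + a) = ((2 * l + a : ℕ) : ℂ) := by push_cast; rfl
    change 0 ≤ (2 * (l : ℂ) + a).re
    rw [this, natCast_re]; positivity
  · have e : ∀ l : ℕ, (y : ℂ) ^ (2 * (l : ℂ) + a) = (y : ℂ) ^ (2 * l + a) := fun l => by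
      have : (2 * (l : ℂ) + a) = ((2 * l + a : ℕ) : ℂ) := by push_cast; rfl
      rw [this, cpow_natCast]
    simp_rw [e]
    refine Summable.hasSum (.of_norm_bounded (summable_etaSigned a s) fun l => ?_)
    rw [norm_mul, norm_pow, norm_real, Real.norm_of_nonneg h0.le]
    exact mul_le_of_le_one_right (norm_nonneg _) (pow_le_one₀ h0.le h1)

lemma continuousOn_powTerm {s : ℂ} (hs : 1 < s.re) : ContinuousOn (powTerm s) (Set.uIcc 0 1) := by
  intro y _
  exact (continuousAt_const.mul (continuousAt_ofReal_cpow_const y (s - 1)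
    (Or.inl (by simp; linarith)))).continuousWithinAt

lemma continuousOn_etaSeries (a : ℕ) (s : ℂ) : ContinuousOn (etaSeries a s) (Set.uIcc 0 1) := by
  refine continuousOn_tsum (u := fun l => ‖etaSigned a s l‖) (fun l => by fun_prop)
    (summable_etaSigned a s) fun l y hy => ?_
  rw [Set.uIcc_of_le zero_le_one] at hy
  rw [norm_mul, norm_pow, norm_real, Real.norm_of_nonneg hy.1]
  exact mul_le_of_le_one_right (norm_nonneg _) (pow_le_one₀ hy.1 hy.2)

/-- The product of three binomials has eight terms, each again an absolutely convergent sum of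
powers. The hypotheses keep the exponents s - 1, t - 1, u - 1 in the right half plane. -/
lemma integral_eq_bracket (a : ℕ) {s t u : ℂ} (hs : 1 < s.re) (ht : 1 < t.re) (hu : 1 < u.re) :
    ∫ y in (0 : ℝ)..1, (powTerm s y + etaSeries a s y) * ((powTerm t y + etaSeries a t y) *
      (powTerm u y + etaSeries 0 u y)) = bracket a s t u := by
  have cs := continuousOn_powTerm hs
  have ct := continuousOn_powTerm ht
  have cu := continuousOn_powTerm hu
  have ds := continuousOn_etaSeries a s
  have dt := continuousOn_etaSeries a t
  have du := continuousOn_etaSeries 0 u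
  have ps := isPowerSum_powTerm hs
  have pt := isPowerSum_powTerm ht
  have pu := isPowerSum_powTerm hu
  have es := isPowerSum_etaSeries a s
  have et := isPowerSum_etaSeries a t
  have eu := isPowerSum_etaSeries 0 u
  have hsplit : ∀ y : ℝ, (powTerm s y + etaSeries a s y) * ((powTerm t y + etaSeries a t y) *
      (powTerm u y + etaSeries 0 u y)) =
      powTerm s y * (powTerm t y * powTerm u y)
      + etaSeries a s y * (etaSeries a t y * etaSeries 0 u y)
      + powTerm u y * (etaSeries a s y * etaSeries a t y)
      + powTerm s y * (etaSeries a t y * etaSeries 0 u y)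
      + powTerm t y * (etaSeries 0 u y * etaSeries a s y)
      + powTerm t y * (powTerm u y * etaSeries a s y)
      + powTerm u y * (powTerm s y * etaSeries a t y)
      + powTerm s y * (powTerm t y * etaSeries 0 u y) := fun y => by ring
  simp_rw [hsplit]
  have mk : ∀ {f g h : ℝ → ℂ}, ContinuousOn f (Set.uIcc 0 1) → ContinuousOn g (Set.uIcc 0 1) →
      ContinuousOn h (Set.uIcc 0 1) →
      IntervalIntegrable (fun y => f y * (g y * h y)) volume 0 1 := fun hf hg hh =>
    (hf.mul (hg.mul hh)).intervalIntegrable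
  have plus : ∀ {f g : ℝ → ℂ}, IntervalIntegrable f volume 0 1 → IntervalIntegrable g volume 0 1 →
      IntervalIntegrable (fun y => f y + g y) volume 0 1 := fun hf hg => hf.add hg
  have i1 := mk cs ct cu
  have i2 := mk ds dt du
  have i3 := mk cu ds dt
  have i4 := mk cs dt du
  have i5 := mk ct du ds
  have i6 := mk ct cu ds
  have i7 := mk cu cs dt
  have i8 := mk cs ct du
  have j2 := plus i1 i2
  have j3 := plus j2 i3
  have j4 := plus j3 i4
  have j5 := plus j4 i5
  have j6 := plus j5 i6
  have j7 := plus j6 i7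
  have iadd := fun {f g : ℝ → ℂ} => intervalIntegral.integral_add (μ := volume) (a := (0 : ℝ))
    (b := 1) (f := f) (g := g)
  rw [iadd j7 i8, iadd j6 i7, iadd j5 i6, iadd j4 i5, iadd j3 i4, iadd j2 i3, iadd i1 i2,
    (ps.mul (pt.mul pu)).integral_eq, (es.mul (et.mul eu)).integral_eq,
    (pu.mul (es.mul et)).integral_eq, (ps.mul (et.mul eu)).integral_eq,
    (pt.mul (eu.mul es)).integral_eq, (pt.mul (pu.mul es)).integral_eq,
    (pu.mul (ps.mul et)).integral_eq, (ps.mul (pt.mul eu)).integral_eq]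
  have two : ∀ z w : ℂ, (2 : ℂ) ^ (-z) * (2 : ℂ) ^ (-w) = (2 : ℂ) ^ (-(z + w)) := fun z w => by
    rw [← cpow_add _ _ two_ne_zero]; congr 1; ring
  -- A single power is a power sum indexed by `Unit`; these trivial factors of the index type are
  -- removed here.
  have unit1 : ∀ {β : Type} (f : Unit × β → ℂ), ∑' k, f k = ∑' b, f ((), b) := fun f =>
    ((Equiv.punitProd _).symm.tsum_eq f).symm
  rw [bracket]
  congr 1
  congr 1
  congr 1
  congr 1
  congr 1
  congr 1
  congr 1
  · rw [unit1, unit1, tsum_fintype]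
    simp only [Finset.univ_unique, Finset.sum_singleton, two]
    ring_nf
  · refine tsum_congr fun k => ?_
    rw [tripleTerm]
    congr 1 <;> (push_cast; ring)
  · rw [unit1]
    refine tsum_congr fun k => ?_
    rw [doubleTerm]
    congr 1 <;> ring
  · rw [unit1]
    refine tsum_congr fun k => ?_
    rw [doubleTerm]
    congr 1 <;> (push_cast; ring)
  · rw [unit1]
    refine tsum_congr fun k => ?_
    rw [doubleTerm]
    congr 1 <;> (push_cast; ring)
  · rw [unit1, unit1]
    refine tsum_congr fun k => ?_
    rw [singleTerm, ← two]
    congr 1 <;> ring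
  · rw [unit1, unit1]
    refine tsum_congr fun k => ?_
    rw [singleTerm, ← two]
    congr 1 <;> ring
  · rw [unit1, unit1]
    refine tsum_congr fun k => ?_
    rw [singleTerm, ← two]
    congr 1 <;> (push_cast; ring)

lemma psi_mul_expansion {a : ℕ} (ha : a ≤ 1) {s : ℂ} (hs : 1 < s.re) {y : ℝ} (hy0 : 0 < y)
    (hy : y ≤ 1) : psi (s + a) * (powTerm s y + etaSeries a s y) =
      psi (1 + a - s) * trigZeta a ((y / 2 : ℝ) : UnitAddCircle) s := by
  rw [← psi_mul_hurwitzTrig ha _ hs, hurwitzTrig_one_sub ha _ hy0 hy, powTerm, etaSeries]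
  rintro rfl
  rw [zero_re] at hs
  linarith

lemma psi_mul_integral_trigZeta {a : ℕ} (ha : a ≤ 1) {s t u : ℂ} (hs : 1 < s.re)
    (ht : 1 < t.re) (hu : 1 < u.re) :
    psi (1 + a - s) * psi (1 + a - t) * psi (1 - u) *
      ∫ y in (0 : ℝ)..1, trigZeta a ((y / 2 : ℝ) : UnitAddCircle) s *
        (trigZeta a ((y / 2 : ℝ) : UnitAddCircle) t *
          trigZeta 0 ((y / 2 : ℝ) : UnitAddCircle) u) =
    psi (s + a) * psi (t + a) * psi u * bracket a s t u := by
  rw [← integral_eq_bracket a hs ht hu, ← intervalIntegral.integral_const_mul,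
    ← intervalIntegral.integral_const_mul]
  refine intervalIntegral.integral_congr_ae (Eventually.of_forall fun y hy => ?_)
  rw [Set.uIoc_of_le zero_le_one] at hy
  have h1 := psi_mul_expansion ha hs hy.1 hy.2
  have h2 := psi_mul_expansion ha ht hy.1 hy.2
  have h3 := psi_mul_expansion zero_le_one hu hy.1 hy.2
  rw [Nat.cast_zero, add_zero, add_zero] at h3
  calc _ = (psi (1 + a - s) * trigZeta a ((y / 2 : ℝ) : UnitAddCircle) s) *
        ((psi (1 + a - t) * trigZeta a ((y / 2 : ℝ) : UnitAddCircle) t) *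
          (psi (1 - u) * trigZeta 0 ((y / 2 : ℝ) : UnitAddCircle) u)) := by ring
    _ = _ := by rw [← h1, ← h2, ← h3]; ring

end BracketIntegral

/-! ### The Tornheim sums as an integral -/

section Fourier

open Complex MeasureTheory HurwitzZeta

/-- Cosine (`a = 0`) or sine (`a = 1`). -/
def trigFun (a : ℕ) (x : ℝ) : ℝ := if a = 0 then Real.cos x else Real.sin x

lemma abs_trigFun_le_one (a : ℕ) (x : ℝ) : |trigFun a x| ≤ 1 := by
  unfold trigFun
  split_ifs
  exacts [Real.abs_cos_le_one x, Real.abs_sin_le_one x]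

lemma continuous_trigFun (a : ℕ) : Continuous (trigFun a) := by
  unfold trigFun
  split_ifs
  exacts [Real.continuous_cos, Real.continuous_sin]

lemma trigFun_mul_mul {a : ℕ} (ha : a ≤ 1) (A B C : ℝ) :
    trigFun a A * (trigFun a B * trigFun 0 C) =
      ((-1) ^ a * Real.cos (A + B + C) + (-1) ^ a * Real.cos (A + B - C) +
        Real.cos (A - B + C) + Real.cos (-A + B + C)) / 4 := by
  have e1 : A - B + C = A + C - B := by ring
  have e2 : -A + B + C = B + C - A := by ring
  rw [e1, e2]
  interval_cases a <;>
  · simp only [trigFun, if_true, one_ne_zero, if_false, Real.cos_add, Real.sin_add, Real.cos_sub]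
    ring

lemma integral_cos_pi_mul (k : ℤ) :
    ∫ y in (0 : ℝ)..1, Real.cos (Real.pi * k * y) = if k = 0 then 1 else 0 := by
  split_ifs with h
  · simp [h]
  · have hk : Real.pi * (k : ℝ) ≠ 0 := mul_ne_zero Real.pi_ne_zero (Int.cast_ne_zero.2 h)
    rw [intervalIntegral.integral_comp_mul_left (fun x => Real.cos x) hk, integral_cos]
    simp [mul_comm Real.pi, Real.sin_int_mul_pi]

/-- The indicator of `k + 1 = (i + 1) + (j + 1)`. -/
def resonance (i j k : ℕ) : ℂ := if k = i + j + 1 then 1 else 0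

/-- After the product-to-sum formula only cosines of frequency zero contribute. The sum of all three
frequencies is at least 3, so resonance occurs only when one frequency is the sum of the other two.
-/
lemma integral_trigFun_mul {a : ℕ} (ha : a ≤ 1) (i j k : ℕ) :
    ∫ y in (0 : ℝ)..1, ((trigFun a (Real.pi * (i + 1) * y) * (trigFun a (Real.pi * (j + 1) * y) *
      trigFun 0 (Real.pi * (k + 1) * y)) : ℝ) : ℂ) =
      ((-1) ^ a * resonance i j k + resonance k i j + resonance j k i) / 4 := by
  have e : ∀ y : ℝ, trigFun a (Real.pi * (i + 1) * y) * (trigFun a (Real.pi * (j + 1) * y) *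
      trigFun 0 (Real.pi * (k + 1) * y)) =
      ((-1) ^ a * Real.cos (Real.pi * ((i + j + k + 3 : ℤ) : ℝ) * y) +
        (-1) ^ a * Real.cos (Real.pi * ((i + j - k + 1 : ℤ) : ℝ) * y) +
        Real.cos (Real.pi * ((i - j + k + 1 : ℤ) : ℝ) * y) +
        Real.cos (Real.pi * ((-i + j + k + 1 : ℤ) : ℝ) * y)) / 4 := fun y => by
    rw [trigFun_mul_mul ha]
    push_cast
    congr 5 <;> (congr 2; ring)
  have hi : ∀ (c : ℝ) (m : ℤ),
      IntervalIntegrable (fun y : ℝ => c * Real.cos (Real.pi * m * y)) volume 0 1 := fun c m =>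
    Continuous.intervalIntegrable (by fun_prop) _ _
  have hi' : ∀ m : ℤ,
      IntervalIntegrable (fun y : ℝ => Real.cos (Real.pi * m * y)) volume 0 1 := fun m =>
    Continuous.intervalIntegrable (by fun_prop) _ _
  have h2 : ∀ c m c' m', IntervalIntegrable (fun y : ℝ => c * Real.cos (Real.pi * (m : ℤ) * y) +
      c' * Real.cos (Real.pi * (m' : ℤ) * y)) volume 0 1 := fun c m c' m' =>
    (hi c m).add (hi c' m')
  have h3 : ∀ c m c' m' m'', IntervalIntegrable (fun y : ℝ =>
      c * Real.cos (Real.pi * (m : ℤ) * y) + c' * Real.cos (Real.pi * (m' : ℤ) * y) +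
      Real.cos (Real.pi * (m'' : ℤ) * y)) volume 0 1 := fun c m c' m' m'' =>
    (h2 c m c' m').add (hi' m'')
  rw [intervalIntegral.integral_ofReal]
  simp_rw [e]
  rw [intervalIntegral.integral_div, intervalIntegral.integral_add (h3 _ _ _ _ _) (hi' _),
    intervalIntegral.integral_add (h2 _ _ _ _) (hi' _),
    intervalIntegral.integral_add (hi _ _) (hi _ _), intervalIntegral.integral_const_mul,
    intervalIntegral.integral_const_mul]
  simp only [integral_cos_pi_mul, resonance]
  rw [if_neg (by omega : ¬ ((i : ℤ) + j + k + 3 = 0))]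
  have c1 : ((i : ℤ) + j - k + 1 = 0) ↔ k = i + j + 1 := by omega
  have c2 : ((i : ℤ) - j + k + 1 = 0) ↔ j = k + i + 1 := by omega
  have c3 : (-(i : ℤ) + j + k + 1 = 0) ↔ i = j + k + 1 := by omega
  simp only [c1, c2, c3]
  push_cast
  split_ifs <;> simp

/-- `n ↦ (n + 1) ^ (-s)`. -/
def dirichletTerm (s : ℂ) (n : ℕ) : ℂ := 1 / ((n : ℂ) + 1) ^ s

lemma summable_norm_dirichletTerm {s : ℂ} (hs : 1 < s.re) :
    Summable (fun n => ‖dirichletTerm s n‖) := by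
  have h := (Complex.summable_one_div_nat_cpow.2 hs).norm
  have := (summable_nat_add_iff 1).2 h
  simpa [dirichletTerm] using this

lemma hasSum_trigZeta (a : ℕ) (y : ℝ) {s : ℂ} (hs : 1 < s.re) :
    HasSum (fun n : ℕ => dirichletTerm s n * (trigFun a (Real.pi * (n + 1) * y) : ℂ))
      (trigZeta a ((y / 2 : ℝ) : UnitAddCircle) s) := by
  have key : HasSum (fun n : ℕ => (trigFun a (2 * Real.pi * (y / 2) * n) : ℂ) / (n : ℂ) ^ s)
      (trigZeta a ((y / 2 : ℝ) : UnitAddCircle) s) := by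
    unfold trigFun trigZeta
    split_ifs
    · exact hasSum_nat_cosZeta _ hs
    · exact hasSum_nat_sinZeta _ hs
  have hs0 : s ≠ 0 := by
    rintro rfl
    rw [zero_re] at hs
    linarith
  -- The term of index 0 is 0, because 0^s = 0 and division by 0 gives 0, so the sum can be
  -- restarted at 1.
  rw [← hasSum_nat_add_iff' 1] at key
  simp only [Finset.range_one, Finset.sum_singleton, Nat.cast_zero, zero_cpow hs0, div_zero,
    sub_zero] at key
  refine key.congr_fun fun n => ?_
  rw [dirichletTerm]
  push_cast
  rw [show Real.pi * ((n : ℝ) + 1) * y = 2 * Real.pi * (y / 2) * (n + 1) by ring]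
  ring

/-- A Tornheim series is a triple Dirichlet series supported on the graph of addition; off that
graph the indicator kills the term. -/
lemma hasSum_resonance {s t u v : ℂ} (h : HasSum (tornheimTerm s t u) v) :
    HasSum (fun k : ℕ × ℕ × ℕ => dirichletTerm s k.1 * (dirichletTerm t k.2.1 *
      dirichletTerm u k.2.2) * resonance k.1 k.2.1 k.2.2) v := by
  have inj : Function.Injective (fun k : ℕ × ℕ => (k.1, k.2, k.1 + k.2 + 1)) := by
    rintro ⟨i, j⟩ ⟨i', j'⟩ h
    simp only [Prod.mk.injEq] at h
    exact Prod.ext h.1 h.2.1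
  refine (inj.hasSum_iff fun k hk => ?_).1 ?_
  · rw [resonance, if_neg, mul_zero]
    intro h
    exact hk ⟨(k.1, k.2.1), by simp [← h]⟩
  · refine h.congr_fun fun k => ?_
    simp only [Function.comp, resonance, if_true, dirichletTerm, tornheimTerm]
    push_cast
    rw [show (k.1 : ℂ) + k.2 + 1 + 1 = k.1 + 1 + (k.2 + 1) by ring]
    simp only [one_div, mul_inv, mul_one]
    ring

lemma integral_trigZeta {a : ℕ} (ha : a ≤ 1) {s t u v₁ v₂ v₃ : ℂ} (hs : 1 < s.re)
    (ht : 1 < t.re) (hu : 1 < u.re) (h₁ : HasSum (tornheimTerm s t u) v₁)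
    (h₂ : HasSum (tornheimTerm u s t) v₂) (h₃ : HasSum (tornheimTerm t u s) v₃) :
    ∫ y in (0 : ℝ)..1, trigZeta a ((y / 2 : ℝ) : UnitAddCircle) s *
        (trigZeta a ((y / 2 : ℝ) : UnitAddCircle) t *
          trigZeta 0 ((y / 2 : ℝ) : UnitAddCircle) u) = ((-1) ^ a * v₁ + v₂ + v₃) / 4 := by
  have ns := summable_norm_dirichletTerm hs
  have nt := summable_norm_dirichletTerm ht
  have nu := summable_norm_dirichletTerm hu
  have ntu : Summable (fun k : ℕ × ℕ => ‖dirichletTerm t k.1 * dirichletTerm u k.2‖) := by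
    simp_rw [norm_mul]
    exact nt.mul_of_nonneg nu (fun _ => norm_nonneg _) (fun _ => norm_nonneg _)
  have nstu : Summable (fun k : ℕ × ℕ × ℕ =>
      ‖dirichletTerm s k.1 * (dirichletTerm t k.2.1 * dirichletTerm u k.2.2)‖) := by
    simp_rw [norm_mul] at ntu ⊢
    exact ns.mul_of_nonneg ntu (fun _ => norm_nonneg _) (fun _ => by positivity)
  have bound : ∀ (b : ℕ) (w : ℂ) (y : ℝ), Summable (fun n => ‖dirichletTerm w n‖) →
      Summable (fun n : ℕ => ‖dirichletTerm w n * (trigFun b (Real.pi * (n + 1) * y) : ℂ)‖) :=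
    fun b w y h => .of_nonneg_of_le (fun _ => norm_nonneg _) (fun n => by
      rw [norm_mul, norm_real]
      exact mul_le_of_le_one_right (norm_nonneg _) (abs_trigFun_le_one _ _)) h
  have prod : ∀ y : ℝ, HasSum (fun k : ℕ × ℕ × ℕ =>
      dirichletTerm s k.1 * (dirichletTerm t k.2.1 * dirichletTerm u k.2.2) *
      ((trigFun a (Real.pi * (k.1 + 1) * y) * (trigFun a (Real.pi * (k.2.1 + 1) * y) *
        trigFun 0 (Real.pi * (k.2.2 + 1) * y)) : ℝ) : ℂ))
      (trigZeta a ((y / 2 : ℝ) : UnitAddCircle) s * (trigZeta a ((y / 2 : ℝ) : UnitAddCircle) t *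
          trigZeta 0 ((y / 2 : ℝ) : UnitAddCircle) u)) := fun y => by
    have b1 := bound a s y ns
    have b2 := bound a t y nt
    have b3 := bound 0 u y nu
    have b23 := b2.mul_of_nonneg b3 (fun _ => norm_nonneg _) (fun _ => norm_nonneg _)
    simp_rw [← norm_mul] at b23
    have h23 := (hasSum_trigZeta a y ht).mul (hasSum_trigZeta 0 y hu) b23.of_norm
    have b123 := b1.mul_of_nonneg b23 (fun _ => norm_nonneg _) (fun _ => norm_nonneg _)
    simp_rw [← norm_mul] at b123
    have h123 := (hasSum_trigZeta a y hs).mul h23 b123.of_norm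
    refine h123.congr_fun fun k => ?_
    push_cast
    ring
  have h := intervalIntegral.hasSum_integral_of_dominated_convergence (μ := volume) (a := (0 : ℝ))
    (b := 1) (fun (k : ℕ × ℕ × ℕ) _ =>
      ‖dirichletTerm s k.1 * (dirichletTerm t k.2.1 * dirichletTerm u k.2.2)‖)
    (fun k => ?_) (fun k => ?_) (Eventually.of_forall fun _ _ => nstu) intervalIntegrable_const
    (Eventually.of_forall fun y _ => prod y)
  · simp_rw [intervalIntegral.integral_const_mul, integral_trigFun_mul ha] at h
    have r₂ : HasSum (fun k : ℕ × ℕ × ℕ => dirichletTerm s k.1 * (dirichletTerm t k.2.1 *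
        dirichletTerm u k.2.2) * resonance k.2.2 k.1 k.2.1) v₂ := by
      -- A cyclic relabelling of the indices brings the second resonance into the shape of the first
      -- for the rotated exponents.
      let e : ℕ × ℕ × ℕ ≃ ℕ × ℕ × ℕ :=
        ⟨fun k => (k.2.2, k.1, k.2.1), fun k => (k.2.1, k.2.2, k.1), fun _ => rfl, fun _ => rfl⟩
      refine (e.hasSum_iff.2 (hasSum_resonance h₂)).congr_fun fun k => ?_
      simp only [e, Function.comp, Equiv.coe_fn_mk]
      ring
    have r₃ : HasSum (fun k : ℕ × ℕ × ℕ => dirichletTerm s k.1 * (dirichletTerm t k.2.1 *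
        dirichletTerm u k.2.2) * resonance k.2.1 k.2.2 k.1) v₃ := by
      let e : ℕ × ℕ × ℕ ≃ ℕ × ℕ × ℕ :=
        ⟨fun k => (k.2.1, k.2.2, k.1), fun k => (k.2.2, k.1, k.2.1), fun _ => rfl, fun _ => rfl⟩
      refine (e.hasSum_iff.2 (hasSum_resonance h₃)).congr_fun fun k => ?_
      simp only [e, Function.comp, Equiv.coe_fn_mk]
      ring
    have r := ((((hasSum_resonance h₁).mul_left ((-1) ^ a)).add r₂).add r₃).div_const 4
    refine h.unique (r.congr_fun fun k => ?_)
    ring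
  · refine (Continuous.aestronglyMeasurable ?_)
    have := continuous_trigFun a
    have := continuous_trigFun 0
    fun_prop
  · refine Eventually.of_forall fun y _ => ?_
    rw [norm_mul _ (ofReal _), norm_real, norm_mul (trigFun _ _), norm_mul (trigFun _ _)]
    refine mul_le_of_le_one_right (norm_nonneg _) ?_
    exact mul_le_one₀ (abs_trigFun_le_one _ _) (by positivity)
      (mul_le_one₀ (abs_trigFun_le_one _ _) (by positivity) (abs_trigFun_le_one _ _))

/-- The fundamental identity, in a region where the three exponents are large. -/
lemma polar_mul_eq_four_mul_numer {a : ℕ} (ha : a ≤ 1) {s t u v₁ v₂ v₃ : ℂ} (hs : 1 < s.re)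
    (ht : 1 < t.re) (hu : 1 < u.re) (h₁ : HasSum (tornheimTerm s t u) v₁)
    (h₂ : HasSum (tornheimTerm u s t) v₂) (h₃ : HasSum (tornheimTerm t u s) v₃) :
    polar a (s, t, u) * (psi (1 + a - s) * psi (1 + a - t) * psi (1 - u)) *
      ((-1) ^ a * v₁ + v₂ + v₃) = 4 * numer a (s, t, u) := by
  have key := psi_mul_integral_trigZeta ha hs ht hu
  rw [integral_trigZeta ha hs ht hu h₁ h₂ h₃] at key
  have n : ∀ z : ℂ, 0 < z.re → psi z ≠ 0 := fun z hz => psi_ne_zero_of_re_pos hz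
  have ha0 : (0 : ℝ) ≤ a := Nat.cast_nonneg a
  rw [numer_eq_mul_bracket (n _ ?_) (n _ ?_) (n _ ?_) ?_]
  · linear_combination 4 * polar a (s, t, u) * key
  · simp; linarith
  · simp; linarith
  · linarith
  · simp only [polar]
    refine mul_ne_zero (mul_ne_zero (mul_ne_zero (n _ ?_) (n _ ?_)) (n _ ?_)) fun h => ?_
    · simp; linarith
    · simp; linarith
    · simp; linarith
    · have := congrArg re h
      simp at this
      linarith

end Fourier

/-! ### The double series in its region of convergence -/

section Convergence

/-- For x ≤ y the sum x + y is comparable with y. By `h₂` the part of the power of y beyond 1 + δ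
has a nonpositive exponent and can be moved to x; `h₃` leaves enough decay in x for a product of two
convergent series. -/
lemma rpow_mul_le_of_le {x y σ τ υ δ : ℝ} (hx : 1 ≤ x) (hxy : x ≤ y)
    (h₂ : 1 + δ ≤ τ + υ) (h₃ : 2 + 2 * δ ≤ σ + τ + υ) :
    x ^ (-σ) * y ^ (-τ) * (x + y) ^ (-υ) ≤ 2 ^ |υ| * (x ^ (-(1 + δ)) * y ^ (-(1 + δ))) := by
  have hx0 : 0 < x := by linarith
  have hy0 : 0 < y := by linarith
  have e : (x + y) ^ (-υ) ≤ 2 ^ |υ| * y ^ (-υ) := by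
    have : x + y = (x + y) / y * y := by field_simp
    rw [this, Real.mul_rpow (by positivity) hy0.le]
    gcongr
    have q1 : 1 ≤ (x + y) / y := by rw [le_div_iff₀ hy0]; linarith
    have q2 : (x + y) / y ≤ 2 := by rw [div_le_iff₀ hy0]; linarith
    calc ((x + y) / y) ^ (-υ) ≤ ((x + y) / y) ^ |υ| :=
          Real.rpow_le_rpow_of_exponent_le q1 (neg_le_abs υ)
      _ ≤ 2 ^ |υ| := Real.rpow_le_rpow (by positivity) q2 (abs_nonneg υ)
  have f : y ^ (1 + δ - τ - υ) ≤ x ^ (1 + δ - τ - υ) :=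
    Real.rpow_le_rpow_of_nonpos hx0 hxy (by linarith)
  have g : x ^ (-σ) * x ^ (1 + δ - τ - υ) ≤ x ^ (-(1 + δ)) := by
    rw [← Real.rpow_add hx0]
    exact Real.rpow_le_rpow_of_exponent_le hx (by linarith)
  calc x ^ (-σ) * y ^ (-τ) * (x + y) ^ (-υ)
      ≤ x ^ (-σ) * y ^ (-τ) * (2 ^ |υ| * y ^ (-υ)) := by gcongr
    _ = 2 ^ |υ| * (x ^ (-σ) * y ^ (1 + δ - τ - υ) * y ^ (-(1 + δ))) := by
        have : y ^ (-τ) * y ^ (-υ) = y ^ (1 + δ - τ - υ) * y ^ (-(1 + δ)) := by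
          rw [← Real.rpow_add hy0, ← Real.rpow_add hy0]; congr 1; ring
        linear_combination 2 ^ |υ| * x ^ (-σ) * this
    _ ≤ 2 ^ |υ| * (x ^ (-σ) * x ^ (1 + δ - τ - υ) * y ^ (-(1 + δ))) := by gcongr
    _ ≤ _ := by gcongr

lemma rpow_mul_le {x y σ τ υ δ : ℝ} (hx : 1 ≤ x) (hy : 1 ≤ y) (h₁ : 1 + δ ≤ σ + υ)
    (h₂ : 1 + δ ≤ τ + υ) (h₃ : 2 + 2 * δ ≤ σ + τ + υ) :
    x ^ (-σ) * y ^ (-τ) * (x + y) ^ (-υ) ≤ 2 ^ |υ| * (x ^ (-(1 + δ)) * y ^ (-(1 + δ))) := by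
  rcases le_total x y with h | h
  · exact rpow_mul_le_of_le hx h h₂ h₃
  · have := rpow_mul_le_of_le (σ := τ) (τ := σ) hy h h₁ (by linarith)
    rw [add_comm x y, mul_comm (x ^ (-σ)), mul_comm (x ^ (-(1 + δ)))]
    exact this

lemma norm_tornheimTerm_le {s t u : ℂ} {δ : ℝ} (h₁ : 1 + δ ≤ (s + u).re)
    (h₂ : 1 + δ ≤ (t + u).re) (h₃ : 2 + 2 * δ ≤ (s + t + u).re) (k : ℕ × ℕ) :
    ‖tornheimTerm s t u k‖ ≤
      2 ^ |u.re| * (((k.1 : ℝ) + 1) ^ (-(1 + δ)) * ((k.2 : ℝ) + 1) ^ (-(1 + δ))) := by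
  have c : ∀ (x : ℝ) (z : ℂ), 0 < x → ‖(x : ℂ) ^ z‖ = x ^ z.re := fun x z hx =>
    Complex.norm_cpow_eq_rpow_re_of_pos hx z
  have e : tornheimTerm s t u k = 1 / ((((k.1 + 1 : ℝ) : ℂ)) ^ s * ((k.2 + 1 : ℝ) : ℂ) ^ t *
      ((k.1 + 1 + (k.2 + 1) : ℝ) : ℂ) ^ u) := by
    rw [tornheimTerm]; push_cast; rfl
  have p1 : (0 : ℝ) < k.1 + 1 := by positivity
  have p2 : (0 : ℝ) < k.2 + 1 := by positivity
  rw [e, norm_div, norm_one, norm_mul, norm_mul, c _ _ p1, c _ _ p2, c _ _ (by positivity),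
    one_div, mul_inv, mul_inv, ← Real.rpow_neg p1.le, ← Real.rpow_neg p2.le,
    ← Real.rpow_neg (by positivity)]
  exact rpow_mul_le (by simp) (by simp) h₁ h₂ h₃

lemma summable_rpow_mul {δ : ℝ} (hδ : 0 < δ) : Summable (fun k : ℕ × ℕ =>
    ((k.1 : ℝ) + 1) ^ (-(1 + δ)) * ((k.2 : ℝ) + 1) ^ (-(1 + δ))) := by
  have h : Summable (fun n : ℕ => ((n : ℝ) + 1) ^ (-(1 + δ))) := by
    have := (summable_nat_add_iff 1).2 (Real.summable_nat_rpow.2 (by linarith : -(1 + δ) < -1))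
    simpa using this
  exact h.mul_of_nonneg h (fun _ => by positivity) (fun _ => by positivity)

lemma isOpen_convRegion : IsOpen convRegion := by
  have c : ∀ {f : ℂ × ℂ × ℂ → ℂ} (r : ℝ), Continuous f → IsOpen {p | r < (f p).re} :=
    fun r hf => isOpen_lt continuous_const (Complex.continuous_re.comp hf)
  exact (c 1 (by fun_prop)).inter ((c 1 (by fun_prop)).inter (c 2 (by fun_prop)))

lemma eventually_norm_tornheimTerm_le {p : ℂ × ℂ × ℂ} (hp : p ∈ convRegion) :
    ∃ v : ℕ × ℕ → ℝ, Summable v ∧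
      ∀ᶠ q in 𝓝 p, ∀ k, ‖tornheimTerm q.1 q.2.1 q.2.2 k‖ ≤ v k := by
  obtain ⟨h₁, h₂, h₃⟩ := hp
  obtain ⟨δ, hδ, d₁, d₂, d₃⟩ : ∃ δ : ℝ, 0 < δ ∧ 1 + δ < (p.1 + p.2.2).re ∧
      1 + δ < (p.2.1 + p.2.2).re ∧ 2 + 2 * δ < (p.1 + p.2.1 + p.2.2).re := by
    have hm : 0 < min ((p.1 + p.2.2).re - 1) (min ((p.2.1 + p.2.2).re - 1)
        ((p.1 + p.2.1 + p.2.2).re - 2)) := by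
      simp only [lt_min_iff]
      exact ⟨by linarith, by linarith, by linarith⟩
    set m := min ((p.1 + p.2.2).re - 1) (min ((p.2.1 + p.2.2).re - 1)
        ((p.1 + p.2.1 + p.2.2).re - 2)) with hmd
    have m1 : m ≤ (p.1 + p.2.2).re - 1 := min_le_left _ _
    have m2 : m ≤ (p.2.1 + p.2.2).re - 1 := (min_le_right _ _).trans (min_le_left _ _)
    have m3 : m ≤ (p.1 + p.2.1 + p.2.2).re - 2 := (min_le_right _ _).trans (min_le_right _ _)
    -- A quarter of the smallest excess leaves strict room in all three conditions, including the
    -- total, where δ is counted twice.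
    exact ⟨m / 4, by positivity, by linarith, by linarith, by linarith⟩
  refine ⟨fun k => 2 ^ (|p.2.2.re| + 1) *
    (((k.1 : ℝ) + 1) ^ (-(1 + δ)) * ((k.2 : ℝ) + 1) ^ (-(1 + δ))),
    (summable_rpow_mul hδ).mul_left _, ?_⟩
  have c1 : Continuous (fun q : ℂ × ℂ × ℂ => (q.1 + q.2.2).re) :=
    Complex.continuous_re.comp (by fun_prop)
  have c2 : Continuous (fun q : ℂ × ℂ × ℂ => (q.2.1 + q.2.2).re) :=
    Complex.continuous_re.comp (by fun_prop)
  have c3 : Continuous (fun q : ℂ × ℂ × ℂ => (q.1 + q.2.1 + q.2.2).re) :=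
    Complex.continuous_re.comp (by fun_prop)
  have c4 : Continuous (fun q : ℂ × ℂ × ℂ => |q.2.2.re|) :=
    (Complex.continuous_re.comp (by fun_prop : Continuous fun q : ℂ × ℂ × ℂ => q.2.2)).abs
  filter_upwards [c1.continuousAt.eventually (lt_mem_nhds d₁),
    c2.continuousAt.eventually (lt_mem_nhds d₂), c3.continuousAt.eventually (lt_mem_nhds d₃),
    c4.continuousAt.eventually (gt_mem_nhds (lt_add_one |p.2.2.re|))] with q q1 q2 q3 q4 k
  refine (norm_tornheimTerm_le q1.le q2.le q3.le k).trans ?_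
  gcongr
  exact one_le_two

/-- The sum of the double series. -/
def tornheimSum (p : ℂ × ℂ × ℂ) : ℂ := ∑' k, tornheimTerm p.1 p.2.1 p.2.2 k

lemma hasSum_tornheimTerm {s t u : ℂ} (hp : (s, t, u) ∈ convRegion) :
    HasSum (tornheimTerm s t u) (tornheimSum (s, t, u)) := by
  obtain ⟨v, hv, h⟩ := eventually_norm_tornheimTerm_le hp
  exact (Summable.of_norm_bounded hv h.self_of_nhds).hasSum

lemma differentiable_tornheimTerm (k : ℕ × ℕ) :
    Differentiable ℂ (fun p : ℂ × ℂ × ℂ => tornheimTerm p.1 p.2.1 p.2.2 k) := by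
  have n1 : (k.1 : ℂ) + 1 ≠ 0 := Nat.cast_add_one_ne_zero _
  have n2 : (k.2 : ℂ) + 1 ≠ 0 := Nat.cast_add_one_ne_zero _
  have n3 : (k.1 : ℂ) + 1 + (k.2 + 1) ≠ 0 := by
    rw [show (k.1 : ℂ) + 1 + (k.2 + 1) = ((k.1 + k.2 + 1 : ℕ) : ℂ) + 1 by push_cast; ring]
    exact Nat.cast_add_one_ne_zero _
  intro p
  unfold tornheimTerm
  refine differentiableAt_div (differentiableAt_const _) ((DifferentiableAt.mul ?_ ?_).mul ?_) ?_
  · exact differentiableAt_fst.const_cpow (Or.inl n1)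
  · exact (DifferentiableAt.const_cpow (by fun_prop) (Or.inl n2))
  · exact (DifferentiableAt.const_cpow (by fun_prop) (Or.inl n3))
  · simp [Complex.cpow_eq_zero_iff, n1, n2, n3]

lemma differentiableOn_tornheimSum : DifferentiableOn ℂ tornheimSum convRegion :=
  differentiableOn_tsum_of_locally_summable isOpen_convRegion
    (fun k => (differentiable_tornheimTerm k).differentiableOn)
    fun _ hp => eventually_norm_tornheimTerm_le hp

end Convergence

/-! ### The reduced numerator -/

section ReducedNumerator

/-- The points whose three cyclic rotations are all in `convRegion`. -/
def cyclicRegion : Set (ℂ × ℂ × ℂ) :=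
  {p | (p.1, p.2.1, p.2.2) ∈ convRegion ∧ (p.2.2, p.1, p.2.1) ∈ convRegion ∧
    (p.2.1, p.2.2, p.1) ∈ convRegion}

lemma convex_convRegion : Convex ℝ convRegion := by
  rintro ⟨s, t, u⟩ ⟨h₁, h₂, h₃⟩ ⟨s', t', u'⟩ ⟨h₁', h₂', h₃'⟩ a b ha hb hab
  simp only [Complex.add_re] at h₁ h₂ h₃ h₁' h₂' h₃'
  simp only [convRegion, Set.mem_ofPred_eq, Prod.smul_mk, Prod.mk_add_mk, Complex.add_re,
    Complex.smul_re, smul_eq_mul]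
  refine ⟨?_, ?_, ?_⟩
  · rcases ha.eq_or_lt with rfl | ha
    · nlinarith
    · nlinarith
  · rcases ha.eq_or_lt with rfl | ha
    · nlinarith
    · nlinarith
  · rcases ha.eq_or_lt with rfl | ha
    · nlinarith
    · nlinarith

lemma isOpen_cyclicRegion : IsOpen cyclicRegion :=
  (isOpen_convRegion.preimage (by fun_prop)).inter
    ((isOpen_convRegion.preimage (f := fun p : ℂ × ℂ × ℂ => (p.2.2, p.1, p.2.1))
      (by fun_prop)).inter
    (isOpen_convRegion.preimage (f := fun p : ℂ × ℂ × ℂ => (p.2.1, p.2.2, p.1)) (by fun_prop)))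

lemma convex_cyclicRegion : Convex ℝ cyclicRegion := by
  rintro p ⟨h₁, h₂, h₃⟩ q ⟨k₁, k₂, k₃⟩ a b ha hb hab
  exact ⟨convex_convRegion h₁ k₁ ha hb hab, convex_convRegion h₂ k₂ ha hb hab,
    convex_convRegion h₃ k₃ ha hb hab⟩

lemma mem_cyclicRegion {s t u : ℂ} (h₁ : 1 < (s + t).re) (h₂ : 1 < (t + u).re)
    (h₃ : 1 < (u + s).re) (h₄ : 2 < (s + t + u).re) : (s, t, u) ∈ cyclicRegion := by
  simp only [Complex.add_re] at h₁ h₂ h₃ h₄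
  refine ⟨⟨?_, ?_, ?_⟩, ⟨?_, ?_, ?_⟩, ⟨?_, ?_, ?_⟩⟩ <;>
  · simp only [Complex.add_re]
    linarith

/-- The combination of Tornheim sums, with sign `(-1) ^ a` for the first one. -/
def cyclicSum (a : ℕ) (T : ℂ × ℂ × ℂ → ℂ) (p : ℂ × ℂ × ℂ) : ℂ :=
  (-1) ^ a * T (p.1, p.2.1, p.2.2) + T (p.2.2, p.1, p.2.1) + T (p.2.1, p.2.2, p.1)

lemma differentiableOn_cyclicSum (a : ℕ) {T : ℂ × ℂ × ℂ → ℂ} {U V : Set (ℂ × ℂ × ℂ)}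
    (hT : DifferentiableOn ℂ T U) (h : ∀ p ∈ V, (p.1, p.2.1, p.2.2) ∈ U ∧
      (p.2.2, p.1, p.2.1) ∈ U ∧ (p.2.1, p.2.2, p.1) ∈ U) :
    DifferentiableOn ℂ (cyclicSum a T) V := by
  have c : ∀ {f : ℂ × ℂ × ℂ → ℂ × ℂ × ℂ}, Differentiable ℂ f → (∀ p ∈ V, f p ∈ U) →
      DifferentiableOn ℂ (fun p => T (f p)) V := fun hf hm =>
    hT.comp hf.differentiableOn hm
  unfold cyclicSum
  exact (((c (by fun_prop) fun p hp => (h p hp).1).const_mul _).add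
    (c (by fun_prop) fun p hp => (h p hp).2.1)).add (c (by fun_prop) fun p hp => (h p hp).2.2)

/-- The factors which vanish at the zeros of `Γ_cos` and `Γ_sin`. -/
def zeroFactor (a : ℕ) (p : ℂ × ℂ × ℂ) : ℂ :=
  psi (1 + a - p.1) * psi (1 + a - p.2.1) * psi (1 - p.2.2)

lemma differentiable_zeroFactor (a : ℕ) : Differentiable ℂ (zeroFactor a) :=
  ((differentiable_psi_comp (by fun_prop)).mul (differentiable_psi_comp (by fun_prop))).mul
    (differentiable_psi_comp (by fun_prop))

/-- The integral argument needs every exponent to have real part above 1. Since the common region of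
convergence is convex, the identity spreads over it from a neighbourhood of (2, 2, 2). -/
lemma polar_mul_cyclicSum {a : ℕ} (ha : a ≤ 1) {p : ℂ × ℂ × ℂ} (hp : p ∈ cyclicRegion) :
    polar a p * zeroFactor a p * cyclicSum a tornheimSum p = 4 * numer a p := by
  have hd : DifferentiableOn ℂ (fun p => polar a p * zeroFactor a p *
      cyclicSum a tornheimSum p - 4 * numer a p) cyclicRegion :=
    ((((differentiable_polar a).mul (differentiable_zeroFactor a)).differentiableOn.mul
      (differentiableOn_cyclicSum a differentiableOn_tornheimSum fun p hp => hp))).sub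
      ((differentiable_numer a).const_mul 4).differentiableOn
  have hq : ((2, 2, 2) : ℂ × ℂ × ℂ) ∈ cyclicRegion := by
    apply mem_cyclicRegion <;> norm_num
  refine sub_eq_zero.1 (eq_zero_of_eventuallyEq_zero_of_convex isOpen_cyclicRegion hd
    convex_cyclicRegion hp hq ?_)
  have c : ∀ {f : ℂ × ℂ × ℂ → ℂ}, Continuous f → f (2, 2, 2) = 2 →
      ∀ᶠ x in 𝓝 ((2, 2, 2) : ℂ × ℂ × ℂ), 1 < (f x).re := fun {f} hf h2 =>
    (Complex.continuous_re.comp hf).continuousAt.eventually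
      (lt_mem_nhds (by simp [h2]))
  filter_upwards [isOpen_cyclicRegion.eventually_mem hq, c continuous_fst rfl,
    c (f := fun x => x.2.1) (by fun_prop) rfl, c (f := fun x => x.2.2) (by fun_prop) rfl]
    with x hx h1 h2 h3
  rw [sub_eq_zero]
  exact polar_mul_eq_four_mul_numer ha h1 h2 h3 (hasSum_tornheimTerm hx.1)
    (hasSum_tornheimTerm hx.2.1) (hasSum_tornheimTerm hx.2.2)

lemma one_le_re_of_psi_eq_zero {b : ℕ} {z : ℂ} (h : psi (1 + b - z) = 0) : 1 ≤ z.re := by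
  obtain ⟨n, hn⟩ := psi_eq_zero_iff.1 h
  have := congrArg Complex.re hn
  simp only [Complex.sub_re, Complex.add_re, Complex.one_re, Complex.natCast_re, Complex.neg_re,
    Complex.mul_re, Complex.re_ofNat, Complex.im_ofNat, Complex.natCast_im] at this
  have hb : (0 : ℝ) ≤ b := Nat.cast_nonneg b
  have hn : (0 : ℝ) ≤ n := Nat.cast_nonneg n
  linarith

/-- An entire function of two variables which vanishes for large real parts is zero. -/
lemma eq_zero_of_forall_one_lt_re {f : ℂ × ℂ → ℂ} (hf : Differentiable ℂ f)
    (h : ∀ x y : ℂ, 1 < x.re → 1 < y.re → f (x, y) = 0) (p : ℂ × ℂ) : f p = 0 := by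
  refine eq_zero_of_eventuallyEq_zero_of_convex isOpen_univ hf.differentiableOn convex_univ
    (Set.mem_univ p) (Set.mem_univ ((2, 2) : ℂ × ℂ)) ?_
  have h1 : ∀ᶠ x in 𝓝 ((2, 2) : ℂ × ℂ), 1 < x.1.re :=
    (Complex.continuous_re.comp continuous_fst).continuousAt.eventually (lt_mem_nhds (by simp))
  have h2 : ∀ᶠ x in 𝓝 ((2, 2) : ℂ × ℂ), 1 < x.2.re :=
    (Complex.continuous_re.comp continuous_snd).continuousAt.eventually (lt_mem_nhds (by simp))
  filter_upwards [h1, h2] with x hx hy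
  exact h x.1 x.2 hx hy

lemma numer_eq_zero_of_mem {a : ℕ} (ha : a ≤ 1) {p : ℂ × ℂ × ℂ} (hp : p ∈ cyclicRegion)
    (h : zeroFactor a p = 0) : numer a p = 0 := by
  have := polar_mul_cyclicSum ha hp
  rw [h, mul_zero, zero_mul] at this
  simpa using this.symm

/-- Such an `s` has real part at least 1, so for large `t`, `u` all three double series converge and
the fundamental identity forces the vanishing; the identity theorem in `(t, u)` does the rest. -/
lemma numer_eq_zero_left {a : ℕ} (ha : a ≤ 1) {s : ℂ} (h : psi (1 + a - s) = 0) (t u : ℂ) :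
    numer a (s, t, u) = 0 := by
  have hre := one_le_re_of_psi_eq_zero h
  refine eq_zero_of_forall_one_lt_re (f := fun q => numer a (s, q.1, q.2))
    ((differentiable_numer a).comp (by fun_prop)) (fun x y hx hy => ?_) (t, u)
  refine numer_eq_zero_of_mem ha (mem_cyclicRegion ?_ ?_ ?_ ?_) (by simp [zeroFactor, h]) <;>
  · simp only [Complex.add_re]
    linarith

lemma numer_eq_zero_middle {a : ℕ} (ha : a ≤ 1) {t : ℂ} (h : psi (1 + a - t) = 0) (s u : ℂ) :
    numer a (s, t, u) = 0 := by
  have hre := one_le_re_of_psi_eq_zero h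
  refine eq_zero_of_forall_one_lt_re (f := fun q => numer a (q.1, t, q.2))
    ((differentiable_numer a).comp (by fun_prop)) (fun x y hx hy => ?_) (s, u)
  refine numer_eq_zero_of_mem ha (mem_cyclicRegion ?_ ?_ ?_ ?_) (by simp [zeroFactor, h]) <;>
  · simp only [Complex.add_re]
    linarith

lemma numer_eq_zero_right {a : ℕ} (ha : a ≤ 1) {u : ℂ} (h : psi (1 - u) = 0) (s t : ℂ) :
    numer a (s, t, u) = 0 := by
  have hre := one_le_re_of_psi_eq_zero (b := 0) (z := u) (by simpa using h)
  refine eq_zero_of_forall_one_lt_re (f := fun q => numer a (q.1, q.2, u))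
    ((differentiable_numer a).comp (by fun_prop)) (fun x y hx hy => ?_) (s, t)
  refine numer_eq_zero_of_mem ha (mem_cyclicRegion ?_ ?_ ?_ ?_) (by simp [zeroFactor, h]) <;>
  · simp only [Complex.add_re]
    linarith

lemma eq_zero_of_mul_eq_zero {f g : ℂ → ℂ} (hf : Differentiable ℂ f) {z₁ : ℂ} (h₁ : f z₁ ≠ 0)
    (hg : Continuous g) (h : ∀ z, f z * g z = 0) (z : ℂ) : g z = 0 := by
  have h0 : Tendsto g (𝓝[≠] z) (𝓝 0) := tendsto_const_nhds.congr' <| by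
    filter_upwards [eventually_ne_zero_of_entire hf h₁ z] with w hw
    exact ((mul_eq_zero.1 (h w)).resolve_left hw).symm
  exact tendsto_nhds_unique ((hg.tendsto z).mono_left nhdsWithin_le_nhds) h0

lemma exists_psi_sub_ne_zero (c : ℂ) : ∃ z, psi (c - z) ≠ 0 :=
  ⟨c - 1, by rw [sub_sub_cancel]; exact psi_ne_zero_of_re_pos (by simp)⟩

lemma deriv_psi_sub_ne_zero {c z : ℂ} (h : psi (c - z) = 0) :
    deriv (fun z => psi (c - z)) z ≠ 0 := by
  rw [deriv_comp_const_sub]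
  exact neg_ne_zero.2 (deriv_psi_ne_zero_of_eq_zero h)

/-- `numer` is divisible by `zeroFactor`. -/
lemma exists_numer_eq_mul {a : ℕ} (ha : a ≤ 1) : ∃ N : ℂ × ℂ × ℂ → ℂ, Differentiable ℂ N ∧
    ∀ p, numer a p = zeroFactor a p * N p := by
  have hpsi : ∀ c : ℂ, Differentiable ℂ (fun z => psi (c - z)) := fun c =>
    differentiable_psi_comp (by fun_prop)
  obtain ⟨za, hza⟩ := exists_psi_sub_ne_zero (1 + a)
  obtain ⟨G₁, hG₁, e₁⟩ := exists_eq_mul_of_vanishing (differentiable_numer a) (hpsi (1 + a))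
    (fun z h => deriv_psi_sub_ne_zero h) fun z w h => numer_eq_zero_left ha h w.1 w.2
  -- The variables are swapped because division acts on the first coordinate. That the first
  -- quotient still vanishes on the next hyperplane follows by cancelling the factor already
  -- removed, whose zeros are isolated.
  obtain ⟨G₂, hG₂, e₂⟩ := exists_eq_mul_of_vanishing
    (F := fun q : ℂ × ℂ × ℂ => G₁ (q.2.1, q.1, q.2.2)) (hG₁.comp (by fun_prop)) (hpsi (1 + a))
    (fun z h => deriv_psi_sub_ne_zero h) fun z w h => by
      refine eq_zero_of_mul_eq_zero (f := fun s => psi (1 + a - s))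
        (g := fun s => G₁ (s, z, w.2)) (hpsi _) hza
        (hG₁.continuous.comp (by fun_prop)) (fun s => ?_) w.1
      rw [← e₁ (s, z, w.2), numer_eq_zero_middle ha h]
  obtain ⟨G₃, hG₃, e₃⟩ := exists_eq_mul_of_vanishing
    (F := fun q : ℂ × ℂ × ℂ => G₂ (q.2.2, q.2.1, q.1)) (hG₂.comp (by fun_prop)) (hpsi 1)
    (fun z h => deriv_psi_sub_ne_zero h) fun z w h => by
      refine eq_zero_of_mul_eq_zero (f := fun t => psi (1 + a - t))
        (g := fun t => G₂ (t, w.1, z)) (hpsi _) hza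
        (hG₂.continuous.comp (by fun_prop)) (fun t => ?_) w.2
      rw [← e₂ (t, w.1, z)]
      refine eq_zero_of_mul_eq_zero (f := fun s => psi (1 + a - s))
        (g := fun s => G₁ (s, t, z)) (hpsi _) hza
        (hG₁.continuous.comp (by fun_prop)) (fun s => ?_) w.1
      rw [← e₁ (s, t, z), numer_eq_zero_right ha h]
  refine ⟨fun p => G₃ (p.2.2, p.1, p.2.1), hG₃.comp (by fun_prop), fun p => ?_⟩
  have h2 := e₂ (p.2.1, p.1, p.2.2)
  have h3 := e₃ (p.2.2, p.1, p.2.1)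
  simp only at h2 h3
  rw [e₁, h2, h3, zeroFactor]
  ring

/-- The continuation of the combination of Tornheim sums, for `N` as in
`exists_numer_eq_mul`. -/
def continuedSum (a : ℕ) (N : ℂ × ℂ × ℂ → ℂ) (p : ℂ × ℂ × ℂ) : ℂ := 4 * N p / polar a p

lemma isOpen_polar_ne_zero (a : ℕ) : IsOpen {p | polar a p ≠ 0} :=
  isOpen_ne_fun (differentiable_polar a).continuous continuous_const

lemma differentiableOn_continuedSum (a : ℕ) {N : ℂ × ℂ × ℂ → ℂ} (hN : Differentiable ℂ N) :
    DifferentiableOn ℂ (continuedSum a N) {p | polar a p ≠ 0} := fun p hp =>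
  (differentiableAt_div ((hN p).const_mul 4) (differentiable_polar a p) hp).differentiableWithinAt

lemma polar_ne_zero_of_mem_cyclicRegion (a : ℕ) {p : ℂ × ℂ × ℂ} (hp : p ∈ cyclicRegion) :
    polar a p ≠ 0 := by
  obtain ⟨⟨h₁, h₂, h₃⟩, ⟨k₁, k₂, -⟩, -⟩ := hp
  simp only [Complex.add_re] at h₁ h₂ h₃ k₁ k₂
  have ha : (0 : ℝ) ≤ a := Nat.cast_nonneg a
  refine mul_ne_zero (mul_ne_zero (mul_ne_zero ?_ ?_) ?_) fun h => ?_
  · refine psi_ne_zero_of_re_pos ?_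
    simp; linarith
  · refine psi_ne_zero_of_re_pos ?_
    simp; linarith
  · refine psi_ne_zero_of_re_pos ?_
    simp; linarith
  · have := congrArg Complex.re h
    simp at this
    linarith

lemma continuedSum_eq_cyclicSum {a : ℕ} (ha : a ≤ 1) {N : ℂ × ℂ × ℂ → ℂ}
    (hN : Differentiable ℂ N) (h : ∀ p, numer a p = zeroFactor a p * N p) {p : ℂ × ℂ × ℂ}
    (hp : p ∈ cyclicRegion) : continuedSum a N p = cyclicSum a tornheimSum p := by
  have hd : DifferentiableOn ℂ (fun p => polar a p * cyclicSum a tornheimSum p - 4 * N p)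
      cyclicRegion :=
    ((differentiable_polar a).differentiableOn.mul
      (differentiableOn_cyclicSum a differentiableOn_tornheimSum fun p hp => hp)).sub
      (hN.const_mul 4).differentiableOn
  -- To cancel `zeroFactor` a base point where it is nonzero is needed; (2, 2, 2) would fail for a =
  -- 1, since ψ(0) = 0.
  have hq : ((3 / 2, 3 / 2, 3 / 2) : ℂ × ℂ × ℂ) ∈ cyclicRegion := by
    apply mem_cyclicRegion <;> norm_num
  have hz : zeroFactor a (3 / 2, 3 / 2, 3 / 2) ≠ 0 := by
    have h1 : psi (1 - 3 / 2) ≠ 0 := fun h0 => by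
      obtain ⟨n, hn⟩ := psi_eq_zero_iff.1 h0
      have h4 : ((4 * n : ℕ) : ℂ) = (1 : ℕ) := by push_cast; linear_combination 2 * hn
      have := Nat.cast_injective h4
      omega
    have h2 : psi (1 + a - 3 / 2) ≠ 0 := by
      interval_cases a
      · simpa using h1
      · refine psi_ne_zero_of_re_pos ?_
        norm_num
    exact mul_ne_zero (mul_ne_zero h2 h2) h1
  have key := eq_zero_of_eventuallyEq_zero_of_convex isOpen_cyclicRegion hd
    convex_cyclicRegion hp hq (by
      filter_upwards [isOpen_cyclicRegion.eventually_mem hq,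
        (differentiable_zeroFactor a).continuous.continuousAt.eventually_ne hz] with x hx hxz
      have := polar_mul_cyclicSum ha hx
      rw [h x] at this
      refine (mul_eq_zero.1 ?_).resolve_left hxz
      linear_combination this)
  rw [continuedSum, div_eq_iff (polar_ne_zero_of_mem_cyclicRegion a hp)]
  linear_combination -key

end ReducedNumerator

/-! ### The singular and the exceptional sets -/

section Sets

lemma mem_oddLEOne_iff {z : ℂ} : z ∈ oddLEOne ↔ psi (z - 1) = 0 := by
  rw [psi_eq_zero_iff]
  constructor
  · rintro ⟨n, hn, ⟨k, rfl⟩, rfl⟩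
    refine ⟨(-k).toNat, ?_⟩
    have : (((-k).toNat : ℤ) : ℂ) = ((-k : ℤ) : ℂ) := by rw [Int.toNat_of_nonneg (by omega)]
    rw [Int.cast_natCast] at this
    rw [this]
    push_cast
    ring
  · rintro ⟨n, hn⟩
    refine ⟨-2 * n + 1, by omega, ⟨-n, by ring⟩, ?_⟩
    push_cast
    linear_combination hn

lemma mem_evenLEZero_iff {z : ℂ} : z ∈ evenLEZero ↔ psi z = 0 := by
  rw [psi_eq_zero_iff]
  constructor
  · rintro ⟨n, hn, ⟨k, rfl⟩, rfl⟩
    refine ⟨(-k).toNat, ?_⟩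
    have : (((-k).toNat : ℤ) : ℂ) = ((-k : ℤ) : ℂ) := by rw [Int.toNat_of_nonneg (by omega)]
    rw [Int.cast_natCast] at this
    rw [this]
    push_cast
    ring
  · rintro ⟨n, hn⟩
    refine ⟨-2 * n, by omega, ⟨-n, by ring⟩, ?_⟩
    push_cast
    linear_combination hn

lemma notMem_intLEOne_iff {z : ℂ} : z ∉ intLEOne ↔ psi (z - 1) ≠ 0 ∧ psi z ≠ 0 := by
  rw [← not_or, not_iff_not, ← mem_oddLEOne_iff, ← mem_evenLEZero_iff]
  constructor
  · rintro ⟨n, hn, rfl⟩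
    rcases Int.even_or_odd n with h | h
    · exact Or.inr ⟨n, by obtain ⟨k, rfl⟩ := h; omega, h, rfl⟩
    · exact Or.inl ⟨n, hn, h, rfl⟩
  · rintro (⟨n, hn, -, rfl⟩ | ⟨n, hn, -, rfl⟩)
    · exact ⟨n, hn, rfl⟩
    · exact ⟨n, by omega, rfl⟩

lemma regularSet3_eq : regularSet3 = {p | polar 0 p ≠ 0} := by
  ext p
  simp only [regularSet3, polar, Set.mem_ofPred_eq, mem_oddLEOne_iff, mul_ne_zero_iff, sub_ne_zero,
    Nat.cast_zero, add_zero, and_assoc, ne_eq]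

lemma regularSet4_eq : regularSet4 = {p | polar 1 p ≠ 0} := by
  ext p
  simp only [regularSet4, polar, Set.mem_ofPred_eq, mem_oddLEOne_iff, mem_evenLEZero_iff,
    mul_ne_zero_iff, sub_ne_zero, Nat.cast_one, sub_add_cancel, and_assoc, ne_eq]

lemma psi_ne_zero_of_notMem_cosExceptional {s : ℂ} (h : s ∉ cosExceptional) :
    psi s ≠ 0 ∧ psi (1 - s) ≠ 0 := by
  refine ⟨fun h0 => h ?_, fun h0 => h ?_⟩ <;> obtain ⟨n, hn⟩ := psi_eq_zero_iff.1 h0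
  · refine ⟨-2 * n, Or.inl ⟨by omega, ⟨-n, by ring⟩⟩, ?_⟩
    push_cast
    linear_combination hn
  · refine ⟨2 * n + 1, Or.inr ⟨by omega, ⟨n, by ring⟩⟩, ?_⟩
    push_cast
    linear_combination -hn

lemma psi_ne_zero_of_notMem_sinExceptional {s : ℂ} (h : s ∉ sinExceptional) :
    psi (s + 1) ≠ 0 ∧ psi (2 - s) ≠ 0 := by
  refine ⟨fun h0 => h ?_, fun h0 => h ?_⟩ <;> obtain ⟨n, hn⟩ := psi_eq_zero_iff.1 h0
  · refine ⟨-2 * n - 1, Or.inl ⟨by omega, ⟨-n - 1, by ring⟩⟩, ?_⟩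
    push_cast
    linear_combination hn
  · refine ⟨2 * n + 2, Or.inr ⟨by omega, ⟨n + 1, by ring⟩⟩, ?_⟩
    push_cast
    linear_combination -hn

end Sets

/-! ### The expansions -/

section Expansions

variable {N : ℂ × ℂ × ℂ → ℂ}

lemma continuedSum_eq_mul_bracket {a : ℕ} (h : ∀ p, numer a p = zeroFactor a p * N p)
    {s t u : ℂ} (hs : psi (s + a) ≠ 0) (ht : psi (t + a) ≠ 0) (hu : psi u ≠ 0)
    (hz : zeroFactor a (s, t, u) ≠ 0) (hp : polar a (s, t, u) ≠ 0) :
    continuedSum a N (s, t, u) =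
      4 * (psi (s + a) * psi (t + a) * psi u) / zeroFactor a (s, t, u) * bracket a s t u := by
  have e := h (s, t, u)
  rw [numer_eq_mul_bracket hs ht hu hp] at e
  rw [continuedSum, div_eq_iff hp]
  field_simp
  linear_combination -e

lemma continuedSum_eq_expansion3 (h : ∀ p, numer 0 p = zeroFactor 0 p * N p) {s t u : ℂ}
    (hp : (s, t, u) ∈ regularSet3) (hg : (s, t, u) ∈ genericSet3) :
    continuedSum 0 N (s, t, u) = expansion3 s t u := by
  obtain ⟨h1, h2, h3⟩ := hg
  obtain ⟨s1, s2⟩ := psi_ne_zero_of_notMem_cosExceptional h1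
  obtain ⟨t1, t2⟩ := psi_ne_zero_of_notMem_cosExceptional h2
  obtain ⟨u1, u2⟩ := psi_ne_zero_of_notMem_cosExceptional h3
  simp only at s1 s2 t1 t2 u1 u2
  rw [regularSet3_eq] at hp
  rw [continuedSum_eq_mul_bracket h (by simpa using s1) (by simpa using t1) u1
    (by simp [zeroFactor, *]) hp, expansion3_eq, Gccc, gammaCos_eq s1, gammaCos_eq t1,
    gammaCos_eq u1]
  simp only [zeroFactor, Nat.cast_zero, add_zero]
  field_simp

lemma continuedSum_eq_expansion4 (h : ∀ p, numer 1 p = zeroFactor 1 p * N p) {s t u : ℂ}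
    (hp : (s, t, u) ∈ regularSet4) (hg : (s, t, u) ∈ genericSet4) :
    continuedSum 1 N (s, t, u) = expansion4 s t u := by
  obtain ⟨h1, h2, h3⟩ := hg
  obtain ⟨s1, s2⟩ := psi_ne_zero_of_notMem_sinExceptional h1
  obtain ⟨t1, t2⟩ := psi_ne_zero_of_notMem_sinExceptional h2
  obtain ⟨u1, u2⟩ := psi_ne_zero_of_notMem_cosExceptional h3
  simp only at s1 s2 t1 t2 u1 u2
  have e : (1 : ℂ) + 1 = 2 := by norm_num
  rw [regularSet4_eq] at hp
  rw [continuedSum_eq_mul_bracket h (by simpa using s1) (by simpa using t1) u1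
    (by simp [zeroFactor, *]) hp, expansion4_eq, Gssc, gammaSin_eq s1, gammaSin_eq t1,
    gammaCos_eq u1]
  simp only [zeroFactor, Nat.cast_one, e]
  field_simp

end Expansions

/-! ### True singularities -/

section Singularities

lemma eventually_comp_affine_ne_zero {f : ℂ → ℂ} (hf : Differentiable ℂ f) {w : ℂ} (hw : f w ≠ 0)
    (c : ℂ) {k : ℂ} (hk : k ≠ 0) : ∀ᶠ z in 𝓝[≠] (0 : ℂ), f (c + z * k) ≠ 0 := by
  refine eventually_ne_zero_of_entire (f := fun z => f (c + z * k)) (hf.comp (by fun_prop))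
    (z₁ := (w - c) / k) ?_ 0
  rwa [div_mul_cancel₀ _ hk, add_sub_cancel]

lemma eventually_psi_affine_ne_zero (c : ℂ) {k : ℂ} (hk : k ≠ 0) :
    ∀ᶠ z in 𝓝[≠] (0 : ℂ), psi (c + z * k) ≠ 0 :=
  eventually_comp_affine_ne_zero differentiable_psi (w := 1)
    (psi_ne_zero_of_re_pos (by simp)) c hk

lemma eventually_affine_ne_zero (c : ℂ) {k : ℂ} (hk : k ≠ 0) :
    ∀ᶠ z in 𝓝[≠] (0 : ℂ), c + z * k ≠ 0 :=
  eventually_comp_affine_ne_zero differentiable_id (w := 1) one_ne_zero c hk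

lemma singleSum_neg_two_mul (a n : ℕ) (x : ℂ) :
    singleSum a (x, -(2 * n)) = kappa a n x * psiQuot n (-(2 * n)) :=
  tsum_eq_single n fun m hm => by
    simp only
    rw [psiQuot_eq_zero hm, mul_zero]

/-- Every other part of `numer` contains the factor ψ(s + t - 1), which vanishes here, and the
remaining single series collapses to its n-th term. Up to factors from clearing denominators this is
the residue along the hyperplane. -/
lemma numer_eq_of_first {a n : ℕ} {s t u : ℂ} (h : s + t - 1 = -(2 * n)) :
    numer a (s, t, u) = (s + t + u - 2) * ((2 : ℂ) ^ (-(s + t)) * (psi (s + a) * psi (t + a)) *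
      (psi (t + u - 1 + a) * psi (u + s - 1 + a)) * (kappa 0 n u * psiQuot n (-(2 * n)))) := by
  rw [numer, polar]
  simp only
  rw [h, psi_neg_two_mul, singleSum_neg_two_mul]
  ring

lemma numer_eq_of_second {a n : ℕ} {s t u : ℂ} (h : t + u - 1 + a = -(2 * n)) :
    numer a (s, t, u) = (s + t + u - 2) * ((2 : ℂ) ^ (-(t + u)) * (psi (t + a) * psi u) *
      (psi (s + t - 1) * psi (u + s - 1 + a)) * (kappa a n s * psiQuot n (-(2 * n)))) := by
  rw [numer, polar]
  simp only
  rw [h, psi_neg_two_mul, singleSum_neg_two_mul]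
  ring

lemma numer_eq_of_third {a n : ℕ} {s t u : ℂ} (h : u + s - 1 + a = -(2 * n)) :
    numer a (s, t, u) = (s + t + u - 2) * ((2 : ℂ) ^ (-(u + s)) * (psi u * psi (s + a)) *
      (psi (s + t - 1) * psi (t + u - 1 + a)) * (kappa a n t * psiQuot n (-(2 * n)))) := by
  rw [numer, polar]
  simp only
  rw [h, psi_neg_two_mul, singleSum_neg_two_mul]
  ring

lemma numer_eq_of_total {a : ℕ} {s t u : ℂ} (h : s + t + u - 2 = 0) :
    numer a (s, t, u) = (2 : ℂ) ^ (-s - t - u) * (psi (s + a) * psi (t + a) * psi u) *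
      (psi (s + t - 1) * psi (t + u - 1 + a) * psi (u + s - 1 + a)) := by
  rw [numer, polar]
  simp only
  rw [h]
  ring

/-- At a zero of `polar` there is a direction along which `polar` vanishes but `numer` does not. -/
lemma exists_direction {a : ℕ} {p : ℂ × ℂ × ℂ} (hp : polar a p = 0) :
    ∃ v : ℂ × ℂ × ℂ, (∀ z : ℂ, polar a (p + z • v) = 0) ∧
      ∀ᶠ z in 𝓝[≠] (0 : ℂ), numer a (p + z • v) ≠ 0 := by
  obtain ⟨s, t, u⟩ := p
  have tw : ∀ z : ℂ, (2 : ℂ) ^ z ≠ 0 := fun z => by simp [Complex.cpow_eq_zero_iff]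
  have kp : ∀ (b n : ℕ) (c k : ℂ), k ≠ 0 →
      ∀ᶠ z in 𝓝[≠] (0 : ℂ), kappa b n (c + z * k) ≠ 0 := fun b n c k hk =>
    eventually_comp_affine_ne_zero (differentiable_kappa b n) (kappa_ne_zero b n) c hk
  have pk : ∀ (c k : ℂ) {f : ℂ → ℂ}, k ≠ 0 → (∀ z, c + z * k = f z) →
      ∀ᶠ z in 𝓝[≠] (0 : ℂ), psi (f z) ≠ 0 := fun c k f hk hf => by
    simp only [← hf]
    exact eventually_psi_affine_ne_zero c hk
  simp only [polar, mul_eq_zero] at hp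
  rcases hp with ((h | h) | h) | h
  · obtain ⟨n, hn⟩ := psi_eq_zero_iff.1 h
    have e : ∀ z : ℂ, s + z * 1 + (t + z * -1) - 1 = -(2 * n) := fun z => by
      linear_combination hn
    -- This direction keeps s + t fixed but moves s, t, u, t + u, u + s and s + t + u, so no
    -- remaining factor is identically zero on the line. The other three directions are chosen by
    -- the same rule.
    refine ⟨(1, -1, 2), fun z => ?_, ?_⟩
    · change polar a (s + z * 1, t + z * -1, u + z * 2) = 0
      simp only [polar, e, psi_neg_two_mul, zero_mul]
    · filter_upwards [eventually_affine_ne_zero (s + t + u - 2) two_ne_zero,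
        pk (s + a) 1 (f := fun z => s + z * 1 + a) one_ne_zero fun z => by ring,
        pk (t + a) (-1) (f := fun z => t + z * -1 + a) (by norm_num) fun z => by ring,
        pk (t + u - 1 + a) 1 (f := fun z => t + z * -1 + (u + z * 2) - 1 + a) one_ne_zero
          fun z => by ring,
        pk (u + s - 1 + a) 3 (f := fun z => u + z * 2 + (s + z * 1) - 1 + a) three_ne_zero
          fun z => by ring, kp 0 n u 2 two_ne_zero] with z h1 h2 h3 h4 h5 h6
      change numer a (s + z * 1, t + z * -1, u + z * 2) ≠ 0
      rw [numer_eq_of_first (e z)]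
      exact mul_ne_zero (by convert h1 using 1; ring) (mul_ne_zero (mul_ne_zero (mul_ne_zero (tw _)
        (mul_ne_zero h2 h3)) (mul_ne_zero h4 h5)) (mul_ne_zero h6 (psiQuot_self_ne_zero n)))
  · obtain ⟨n, hn⟩ := psi_eq_zero_iff.1 h
    have e : ∀ z : ℂ, t + z * 1 + (u + z * -1) - 1 + a = -(2 * n) := fun z => by
      linear_combination hn
    refine ⟨(2, 1, -1), fun z => ?_, ?_⟩
    · change polar a (s + z * 2, t + z * 1, u + z * -1) = 0
      simp only [polar, e, psi_neg_two_mul, zero_mul, mul_zero]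
    · filter_upwards [eventually_affine_ne_zero (s + t + u - 2) two_ne_zero,
        pk (t + a) 1 (f := fun z => t + z * 1 + a) one_ne_zero fun z => by ring,
        pk u (-1) (f := fun z => u + z * -1) (by norm_num) fun z => by ring,
        pk (s + t - 1) 3 (f := fun z => s + z * 2 + (t + z * 1) - 1) three_ne_zero
          fun z => by ring,
        pk (u + s - 1 + a) 1 (f := fun z => u + z * -1 + (s + z * 2) - 1 + a) one_ne_zero
          fun z => by ring, kp a n s 2 two_ne_zero] with z h1 h2 h3 h4 h5 h6
      change numer a (s + z * 2, t + z * 1, u + z * -1) ≠ 0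
      rw [numer_eq_of_second (e z)]
      exact mul_ne_zero (by convert h1 using 1; ring) (mul_ne_zero (mul_ne_zero (mul_ne_zero (tw _)
        (mul_ne_zero h2 h3)) (mul_ne_zero h4 h5)) (mul_ne_zero h6 (psiQuot_self_ne_zero n)))
  · obtain ⟨n, hn⟩ := psi_eq_zero_iff.1 h
    have e : ∀ z : ℂ, u + z * -1 + (s + z * 1) - 1 + a = -(2 * n) := fun z => by
      linear_combination hn
    refine ⟨(1, 2, -1), fun z => ?_, ?_⟩
    · change polar a (s + z * 1, t + z * 2, u + z * -1) = 0
      simp only [polar, e, psi_neg_two_mul, zero_mul, mul_zero]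
    · filter_upwards [eventually_affine_ne_zero (s + t + u - 2) two_ne_zero,
        pk u (-1) (f := fun z => u + z * -1) (by norm_num) fun z => by ring,
        pk (s + a) 1 (f := fun z => s + z * 1 + a) one_ne_zero fun z => by ring,
        pk (s + t - 1) 3 (f := fun z => s + z * 1 + (t + z * 2) - 1) three_ne_zero
          fun z => by ring,
        pk (t + u - 1 + a) 1 (f := fun z => t + z * 2 + (u + z * -1) - 1 + a) one_ne_zero
          fun z => by ring, kp a n t 2 two_ne_zero] with z h1 h2 h3 h4 h5 h6
      change numer a (s + z * 1, t + z * 2, u + z * -1) ≠ 0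
      rw [numer_eq_of_third (e z)]
      exact mul_ne_zero (by convert h1 using 1; ring) (mul_ne_zero (mul_ne_zero (mul_ne_zero (tw _)
        (mul_ne_zero h2 h3)) (mul_ne_zero h4 h5)) (mul_ne_zero h6 (psiQuot_self_ne_zero n)))
  · have e : ∀ z : ℂ, s + z * 1 + (t + z * 1) + (u + z * -2) - 2 = 0 := fun z => by
      linear_combination h
    refine ⟨(1, 1, -2), fun z => ?_, ?_⟩
    · change polar a (s + z * 1, t + z * 1, u + z * -2) = 0
      simp only [polar, e, mul_zero]
    · filter_upwards [pk (s + a) 1 (f := fun z => s + z * 1 + a) one_ne_zero fun z => by ring,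
        pk (t + a) 1 (f := fun z => t + z * 1 + a) one_ne_zero fun z => by ring,
        pk u (-2) (f := fun z => u + z * -2) (by norm_num) fun z => by ring,
        pk (s + t - 1) 2 (f := fun z => s + z * 1 + (t + z * 1) - 1) two_ne_zero
          fun z => by ring,
        pk (t + u - 1 + a) (-1) (f := fun z => t + z * 1 + (u + z * -2) - 1 + a) (by norm_num)
          fun z => by ring,
        pk (u + s - 1 + a) (-1) (f := fun z => u + z * -2 + (s + z * 1) - 1 + a) (by norm_num)
          fun z => by ring] with z h1 h2 h3 h4 h5 h6
      change numer a (s + z * 1, t + z * 1, u + z * -2) ≠ 0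
      rw [numer_eq_of_total (e z)]
      exact mul_ne_zero (mul_ne_zero (tw _) (mul_ne_zero (mul_ne_zero h1 h2) h3))
        (mul_ne_zero (mul_ne_zero h4 h5) h6)

lemma eventually_polar_ne_zero (a : ℕ) (p : ℂ × ℂ × ℂ) :
    ∀ᶠ z in 𝓝[≠] (0 : ℂ), polar a (p + z • (1, 1, 1)) ≠ 0 := by
  obtain ⟨s, t, u⟩ := p
  filter_upwards [eventually_psi_affine_ne_zero (s + t - 1) two_ne_zero,
    eventually_psi_affine_ne_zero (t + u - 1 + a) two_ne_zero,
    eventually_psi_affine_ne_zero (u + s - 1 + a) two_ne_zero,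
    eventually_affine_ne_zero (s + t + u - 2) three_ne_zero] with z h1 h2 h3 h4
  change polar a (s + z * 1, t + z * 1, u + z * 1) ≠ 0
  refine mul_ne_zero (mul_ne_zero (mul_ne_zero ?_ ?_) ?_) ?_
  · convert h1 using 2; ring
  · convert h2 using 2; ring
  · convert h3 using 2; ring
  · convert h4 using 1; ring

lemma isTrueSingularity_continuedSum {a : ℕ} {N : ℂ × ℂ × ℂ → ℂ} (hN : Differentiable ℂ N)
    (h : ∀ p, numer a p = zeroFactor a p * N p) {p : ℂ × ℂ × ℂ} (hp : polar a p = 0) :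
    IsTrueSingularity (continuedSum a N) {p | polar a p ≠ 0} p := by
  rintro ⟨V, g, hV, hpV, hg, heq⟩
  have line : ∀ q v : ℂ × ℂ × ℂ, Tendsto (fun z : ℂ => q + z • v) (𝓝[≠] 0) (𝓝 q) := fun q v => by
    have hc : Continuous (fun z : ℂ => q + z • v) := by fun_prop
    have := (hc.tendsto 0).mono_left (nhdsWithin_le_nhds (s := {0}ᶜ))
    simpa using this
  -- Moving along (1, 1, 1) changes every linear form in `polar`, so each point of `V` is a limit of
  -- points where the original quotient is defined; the identity extends by continuity.
  have key : ∀ q ∈ V, g q * polar a q = 4 * N q := fun q hq => by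
    have hc : ContinuousAt (fun x => g x * polar a x - 4 * N x) q :=
      (((hg.differentiableAt (hV.mem_nhds hq)).mul (differentiable_polar a q)).sub
        ((hN q).const_mul 4)).continuousAt
    have h0 : Tendsto (fun z : ℂ => g (q + z • (1, 1, 1)) * polar a (q + z • (1, 1, 1)) -
        4 * N (q + z • (1, 1, 1))) (𝓝[≠] 0) (𝓝 0) := tendsto_const_nhds.congr' <| by
      filter_upwards [eventually_polar_ne_zero a q,
        (line q (1, 1, 1)).eventually (hV.eventually_mem hq)] with z h1 h2
      rw [heq ⟨h2, h1⟩, continuedSum, div_mul_cancel₀ _ h1, sub_self]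
    exact sub_eq_zero.1 (tendsto_nhds_unique (hc.tendsto.comp (line q (1, 1, 1))) h0)
  obtain ⟨v, hv, hne⟩ := exists_direction hp
  obtain ⟨z, hz, hzV⟩ := (hne.and ((line p v).eventually (hV.eventually_mem hpV))).exists
  have := key _ hzV
  rw [hv, mul_zero] at this
  refine hz ?_
  rw [h, (mul_eq_zero.1 this.symm).resolve_left (by norm_num), mul_zero]

end Singularities

/-! ### Uniqueness and existence of the continued double series -/

section Continuation

lemma countable_intLEOne : intLEOne.Countable :=
  (Set.countable_range (fun n : ℤ => (n : ℂ))).mono (by rintro z ⟨n, -, rfl⟩; exact ⟨n, rfl⟩)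

lemma isOpen_notMem_intLEOne {f : ℂ × ℂ × ℂ → ℂ} (hf : Continuous f) :
    IsOpen {p | f p ∉ intLEOne} := by
  simp only [notMem_intLEOne_iff]
  exact (isOpen_ne_fun (differentiable_psi.continuous.comp (hf.sub continuous_const))
    continuous_const).inter (isOpen_ne_fun (differentiable_psi.continuous.comp hf)
    continuous_const)

/-- The points whose three cyclic rotations are all in `tornheimDomain`. -/
def cyclicDomain : Set (ℂ × ℂ × ℂ) :=
  {p | p.1 + p.2.1 ∉ intLEOne ∧ p.2.1 + p.2.2 ∉ intLEOne ∧ p.2.2 + p.1 ∉ intLEOne ∧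
    p.1 + p.2.1 + p.2.2 ≠ 2}

lemma mem_cyclicDomain_iff {s t u : ℂ} : (s, t, u) ∈ cyclicDomain ↔ InCyclicDomain s t u := by
  have e1 : s + u + t = s + t + u := by ring
  have e2 : t + u + s = s + t + u := by ring
  rw [InCyclicDomain, cyclicDomain, tornheimDomain]
  simp only [Set.mem_ofPred_eq, e2, add_comm u t, add_comm t s, add_comm u s, e1]
  tauto

lemma isOpen_cyclicDomain : IsOpen cyclicDomain :=
  (isOpen_notMem_intLEOne (by fun_prop)).inter ((isOpen_notMem_intLEOne (by fun_prop)).inter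
    ((isOpen_notMem_intLEOne (by fun_prop)).inter (isOpen_ne_fun (by fun_prop) continuous_const)))

lemma isOpen_tornheimDomain : IsOpen tornheimDomain :=
  (isOpen_notMem_intLEOne (by fun_prop)).inter ((isOpen_notMem_intLEOne (by fun_prop)).inter
    (isOpen_ne_fun (by fun_prop) continuous_const))

lemma notMem_intLEOne_of_one_lt_re {z : ℂ} (h : 1 < z.re) : z ∉ intLEOne := by
  rintro ⟨n, hn, rfl⟩
  rw [Complex.intCast_re] at h
  have : (n : ℝ) ≤ 1 := by exact_mod_cast hn
  linarith

lemma convRegion_subset_tornheimDomain : convRegion ⊆ tornheimDomain := by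
  rintro p ⟨h₁, h₂, h₃⟩
  refine ⟨notMem_intLEOne_of_one_lt_re h₁, notMem_intLEOne_of_one_lt_re h₂, fun h => ?_⟩
  rw [h] at h₃
  simp at h₃

lemma cyclicRegion_subset_cyclicDomain : cyclicRegion ⊆ cyclicDomain := fun _ hp =>
  mem_cyclicDomain_iff.2 ⟨convRegion_subset_tornheimDomain hp.1,
    convRegion_subset_tornheimDomain hp.2.1, convRegion_subset_tornheimDomain hp.2.2⟩

lemma polar_zero_ne_zero_of_mem {p : ℂ × ℂ × ℂ} (hp : p ∈ cyclicDomain) : polar 0 p ≠ 0 := by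
  obtain ⟨h₁, h₂, h₃, h₄⟩ := hp
  simp only [polar, Nat.cast_zero, add_zero]
  exact mul_ne_zero (mul_ne_zero (mul_ne_zero (notMem_intLEOne_iff.1 h₁).1
    (notMem_intLEOne_iff.1 h₂).1) (notMem_intLEOne_iff.1 h₃).1) (sub_ne_zero.2 h₄)

lemma polar_one_ne_zero_of_mem {p : ℂ × ℂ × ℂ} (hp : p ∈ cyclicDomain) : polar 1 p ≠ 0 := by
  obtain ⟨h₁, h₂, h₃, h₄⟩ := hp
  simp only [polar, Nat.cast_one, sub_add_cancel]
  exact mul_ne_zero (mul_ne_zero (mul_ne_zero (notMem_intLEOne_iff.1 h₁).1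
    (notMem_intLEOne_iff.1 h₂).2) (notMem_intLEOne_iff.1 h₃).2) (sub_ne_zero.2 h₄)

lemma polar_ne_zero_of_mem {a : ℕ} (ha : a ≤ 1) {p : ℂ × ℂ × ℂ} (hp : p ∈ cyclicDomain) :
    polar a p ≠ 0 := by
  interval_cases a
  exacts [polar_zero_ne_zero_of_mem hp, polar_one_ne_zero_of_mem hp]

lemma two_mem_cyclicRegion : ((2, 2, 2) : ℂ × ℂ × ℂ) ∈ cyclicRegion := by
  apply mem_cyclicRegion <;> norm_num

/-- Holomorphic functions on `cyclicDomain` which agree on `cyclicRegion` are equal. -/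
lemma eqOn_cyclicDomain {f g : ℂ × ℂ × ℂ → ℂ} (hf : DifferentiableOn ℂ f cyclicDomain)
    (hg : DifferentiableOn ℂ g cyclicDomain) (h : ∀ p ∈ cyclicRegion, f p = g p) :
    Set.EqOn f g cyclicDomain := by
  intro p hp
  have hq := two_mem_cyclicRegion
  refine sub_eq_zero.1 (eq_zero_of_eventuallyEq_zero_of_countable (f := fun p => f p - g p)
    isOpen_cyclicDomain (hf.sub hg) hp (cyclicRegion_subset_cyclicDomain hq) ?_ ?_)
  · obtain ⟨s, t, u⟩ := p
    obtain ⟨h₁, h₂, h₃, h₄⟩ := hp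
    -- On the line to (2, 2, 2) the pair sums run to 4 and the total runs to 6, so the line leaves
    -- the domain at only countably many parameters.
    have c := fun {x : ℂ} (hx : x ∉ intLEOne) => countable_line (y := 4) countable_intLEOne hx
    have c' := countable_line (y := 6) (Set.countable_singleton (2 : ℂ)) h₄
    refine ((((c h₁).union (c h₂)).union (c h₃)).union c').mono fun z hz => ?_
    by_contra hcon
    simp only [Set.mem_union, Set.mem_ofPred_eq, not_or] at hcon
    obtain ⟨⟨⟨k₁, k₂⟩, k₃⟩, k₄⟩ := hcon
    refine hz ?_
    change (s + z * (2 - s), t + z * (2 - t), u + z * (2 - u)) ∈ cyclicDomain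
    refine ⟨?_, ?_, ?_, ?_⟩
    · convert k₁ using 2; ring
    · convert k₂ using 2; ring
    · convert k₃ using 2; ring
    · convert k₄ using 1; ring_nf; simp
  · filter_upwards [isOpen_cyclicRegion.eventually_mem hq] with x hx
    rw [h x hx, sub_self]

lemma IsTornheim.eq_tornheimSum {T : ℂ × ℂ × ℂ → ℂ} (hT : IsTornheim T) {p : ℂ × ℂ × ℂ}
    (hp : p ∈ convRegion) : T p = tornheimSum p :=
  (hT.2 p.1 p.2.1 p.2.2 hp).unique (hasSum_tornheimTerm hp)

/-- The continued sum is the combination of the values of the continued double series. -/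
lemma IsTornheim.continuedSum_eq {T : ℂ × ℂ × ℂ → ℂ} (hT : IsTornheim T) {a : ℕ} (ha : a ≤ 1)
    {N : ℂ × ℂ × ℂ → ℂ} (hN : Differentiable ℂ N) (h : ∀ p, numer a p = zeroFactor a p * N p)
    {s t u : ℂ} (hp : InCyclicDomain s t u) :
    continuedSum a N (s, t, u) = (-1) ^ a * T (s, t, u) + T (u, s, t) + T (t, u, s) := by
  refine eqOn_cyclicDomain (g := cyclicSum a T)
    ((differentiableOn_continuedSum a hN).mono fun p hp => polar_ne_zero_of_mem ha hp)
    (differentiableOn_cyclicSum a hT.1 fun p hp => mem_cyclicDomain_iff.1 hp) (fun p hp => ?_)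
    (mem_cyclicDomain_iff.2 hp)
  rw [continuedSum_eq_cyclicSum ha hN h hp, cyclicSum, cyclicSum, hT.eq_tornheimSum hp.1,
    hT.eq_tornheimSum hp.2.1, hT.eq_tornheimSum hp.2.2]

/-- The double series continues to `tornheimDomain`. -/
lemma exists_isTornheim : ∃ T, IsTornheim T := by
  classical
  obtain ⟨N₀, hN₀, h₀⟩ := exists_numer_eq_mul zero_le_one
  obtain ⟨N₁, hN₁, h₁⟩ := exists_numer_eq_mul le_rfl
  -- `A` isolates T(s,t,u) as half of S_3 - S_4. `B` adds the two other rotations of S_4, in which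
  -- the unwanted T's cancel.
  let A : ℂ × ℂ × ℂ → ℂ := fun p => 1 / 2 * (continuedSum 0 N₀ p - continuedSum 1 N₁ p)
  let B : ℂ × ℂ × ℂ → ℂ := fun p =>
    1 / 2 * (continuedSum 1 N₁ (p.2.2, p.1, p.2.1) + continuedSum 1 N₁ (p.2.1, p.2.2, p.1))
  let UA : Set (ℂ × ℂ × ℂ) := tornheimDomain ∩ {p | psi (p.1 + p.2.1 - 1) ≠ 0}
  let UB : Set (ℂ × ℂ × ℂ) := tornheimDomain ∩ {p | psi (p.1 + p.2.1) ≠ 0}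
  have oA : IsOpen UA := isOpen_tornheimDomain.inter (isOpen_ne_fun
    (differentiable_psi.continuous.comp (by fun_prop)) continuous_const)
  have oB : IsOpen UB := isOpen_tornheimDomain.inter (isOpen_ne_fun
    (differentiable_psi.continuous.comp (by fun_prop)) continuous_const)
  have hA : DifferentiableOn ℂ A UA := by
    have m₀ : UA ⊆ {p | polar 0 p ≠ 0} := by
      rintro ⟨s, t, u⟩ ⟨⟨k₁, k₂, k₃⟩, k₄⟩
      change polar 0 (s, t, u) ≠ 0
      rw [add_comm] at k₁
      simp only [polar, Nat.cast_zero, add_zero]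
      exact mul_ne_zero (mul_ne_zero (mul_ne_zero k₄ (notMem_intLEOne_iff.1 k₂).1)
        (notMem_intLEOne_iff.1 k₁).1) (sub_ne_zero.2 k₃)
    have m₁ : UA ⊆ {p | polar 1 p ≠ 0} := by
      rintro ⟨s, t, u⟩ ⟨⟨k₁, k₂, k₃⟩, k₄⟩
      change polar 1 (s, t, u) ≠ 0
      rw [add_comm] at k₁
      simp only [polar, Nat.cast_one, sub_add_cancel]
      exact mul_ne_zero (mul_ne_zero (mul_ne_zero k₄ (notMem_intLEOne_iff.1 k₂).2)
        (notMem_intLEOne_iff.1 k₁).2) (sub_ne_zero.2 k₃)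
    exact (((differentiableOn_continuedSum 0 hN₀).mono m₀).sub
      ((differentiableOn_continuedSum 1 hN₁).mono m₁)).const_mul _
  have hB : DifferentiableOn ℂ B UB := by
    have c : ∀ {f : ℂ × ℂ × ℂ → ℂ × ℂ × ℂ}, Differentiable ℂ f →
        (∀ p ∈ UB, polar 1 (f p) ≠ 0) →
        DifferentiableOn ℂ (fun p => continuedSum 1 N₁ (f p)) UB := fun hf hm =>
      (differentiableOn_continuedSum 1 hN₁).comp hf.differentiableOn hm
    have m₂ : ∀ p ∈ UB, polar 1 (p.2.2, p.1, p.2.1) ≠ 0 := by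
      rintro ⟨s, t, u⟩ ⟨⟨k₁, k₂, k₃⟩, k₄⟩
      rw [add_comm] at k₁
      simp only [polar, Nat.cast_one, sub_add_cancel]
      refine mul_ne_zero (mul_ne_zero (mul_ne_zero (notMem_intLEOne_iff.1 k₁).1 k₄)
        (notMem_intLEOne_iff.1 k₂).2) (sub_ne_zero.2 ?_)
      convert k₃ using 1
      ring
    have m₃ : ∀ p ∈ UB, polar 1 (p.2.1, p.2.2, p.1) ≠ 0 := by
      rintro ⟨s, t, u⟩ ⟨⟨k₁, k₂, k₃⟩, k₄⟩
      rw [add_comm] at k₁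
      simp only [polar, Nat.cast_one, sub_add_cancel]
      refine mul_ne_zero (mul_ne_zero (mul_ne_zero (notMem_intLEOne_iff.1 k₂).1
        (notMem_intLEOne_iff.1 k₁).2) k₄) (sub_ne_zero.2 ?_)
      convert k₃ using 1
      ring
    exact ((c (f := fun p => (p.2.2, p.1, p.2.1)) (by fun_prop) m₂).add
      (c (f := fun p => (p.2.1, p.2.2, p.1)) (by fun_prop) m₃)).const_mul _
  have rA : ∀ p ∈ cyclicRegion, A p = tornheimSum p := fun p hp => by
    simp only [A]
    rw [continuedSum_eq_cyclicSum zero_le_one hN₀ h₀ hp, continuedSum_eq_cyclicSum le_rfl hN₁ h₁ hp,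
      cyclicSum, cyclicSum]
    ring
  have rB : ∀ p ∈ cyclicRegion, B p = tornheimSum p := fun p hp => by
    have hp2 : (p.2.2, p.1, p.2.1) ∈ cyclicRegion := ⟨hp.2.1, hp.2.2, hp.1⟩
    have hp3 : (p.2.1, p.2.2, p.1) ∈ cyclicRegion := ⟨hp.2.2, hp.1, hp.2.1⟩
    simp only [B]
    rw [continuedSum_eq_cyclicSum le_rfl hN₁ h₁ hp2, continuedSum_eq_cyclicSum le_rfl hN₁ h₁ hp3,
      cyclicSum, cyclicSum]
    simp only
    ring
  have cyc : ∀ p ∈ tornheimDomain, psi (p.1 + p.2.1 - 1) ≠ 0 → psi (p.1 + p.2.1) ≠ 0 →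
      p ∈ cyclicDomain := fun p hp k₁ k₂ =>
    ⟨notMem_intLEOne_iff.2 ⟨k₁, k₂⟩, hp.2.1, by rw [add_comm]; exact hp.1, hp.2.2⟩
  have dA : cyclicDomain ⊆ UA := fun p hp =>
    ⟨(mem_cyclicDomain_iff.1 hp).1, (notMem_intLEOne_iff.1 hp.1).1⟩
  have dB : cyclicDomain ⊆ UB := fun p hp =>
    ⟨(mem_cyclicDomain_iff.1 hp).1, (notMem_intLEOne_iff.1 hp.1).2⟩
  have hAB : Set.EqOn A B cyclicDomain := eqOn_cyclicDomain (hA.mono dA) (hB.mono dB)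
    fun p hp => (rA p hp).trans (rB p hp).symm
  let T : ℂ × ℂ × ℂ → ℂ := fun p => if psi (p.1 + p.2.1 - 1) = 0 then B p else A p
  have hT : DifferentiableOn ℂ T tornheimDomain := by
    intro p hp
    refine DifferentiableAt.differentiableWithinAt ?_
    by_cases hp1 : psi (p.1 + p.2.1 - 1) = 0
    -- If ψ vanished at both s + t - 1 and s + t, this would equate an odd and an even natural
    -- number; hence the two charts cover the domain.
    · have hp2 : p ∈ UB := ⟨hp, fun hp2 => by
        obtain ⟨n, hn⟩ := psi_eq_zero_iff.1 hp1
        obtain ⟨m, hm⟩ := psi_eq_zero_iff.1 hp2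
        have : ((2 * m + 1 : ℕ) : ℂ) = ((2 * n : ℕ) : ℂ) := by
          push_cast
          linear_combination hm - hn
        have := Nat.cast_injective this
        omega⟩
      refine (hB.differentiableAt (oB.mem_nhds hp2)).congr_of_eventuallyEq ?_
      filter_upwards [oB.mem_nhds hp2] with q hq
      by_cases hq1 : psi (q.1 + q.2.1 - 1) = 0
      · simp only [T, if_pos hq1]
      · simp only [T, if_neg hq1]
        exact hAB (cyc q hq.1 hq1 hq.2)
    · have hp2 : p ∈ UA := ⟨hp, hp1⟩
      refine (hA.differentiableAt (oA.mem_nhds hp2)).congr_of_eventuallyEq ?_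
      filter_upwards [oA.mem_nhds hp2] with q hq
      simp only [T, if_neg hq.2]
  refine ⟨T, hT, fun s t u hp => ?_⟩
  -- So far agreement with the series is known only where all three rotations converge; convexity of
  -- the full region of convergence extends it.
  have key : T (s, t, u) - tornheimSum (s, t, u) = 0 :=
    eq_zero_of_eventuallyEq_zero_of_convex (f := fun p => T p - tornheimSum p) isOpen_convRegion
      ((hT.mono convRegion_subset_tornheimDomain).sub differentiableOn_tornheimSum)
      convex_convRegion hp two_mem_cyclicRegion.1 <| by
        filter_upwards [isOpen_cyclicRegion.eventually_mem two_mem_cyclicRegion] with x hx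
        have hx1 := (dA (cyclicRegion_subset_cyclicDomain hx)).2
        simp only [T, if_neg hx1]
        rw [rA x hx, sub_self]
  rw [sub_eq_zero.1 key]
  exact hasSum_tornheimTerm hp

end Continuation

end

end Tornheim

/-! ### The theorem, assembled from the two cases a = 0 and a = 1 -/

theorem theorem2 :
    (∃ T : ℂ × ℂ × ℂ → ℂ, IsTornheim T) ∧
    ∀ T : ℂ × ℂ × ℂ → ℂ, IsTornheim T →
      (∃ S₃ : ℂ × ℂ × ℂ → ℂ,
        DifferentiableOn ℂ S₃ regularSet3 ∧
        (∀ s t u : ℂ, InCyclicDomain s t u →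
          S₃ (s, t, u) = T (s, t, u) + T (u, s, t) + T (t, u, s)) ∧
        (∀ s t u : ℂ, (s, t, u) ∈ regularSet3 → (s, t, u) ∈ genericSet3 →
          RapidExpansion3 s t u ∧ S₃ (s, t, u) = expansion3 s t u) ∧
        (∀ p ∈ regularSet3, Tendsto (fun q : ℂ × ℂ × ℂ => expansion3 q.1 q.2.1 q.2.2)
          (𝓝[regularSet3 ∩ genericSet3] p) (𝓝 (S₃ p))) ∧
        (∀ p ∉ regularSet3, IsTrueSingularity S₃ regularSet3 p)) ∧
      (∃ S₄ : ℂ × ℂ × ℂ → ℂ,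
        DifferentiableOn ℂ S₄ regularSet4 ∧
        (∀ s t u : ℂ, InCyclicDomain s t u →
          S₄ (s, t, u) = -T (s, t, u) + T (u, s, t) + T (t, u, s)) ∧
        (∀ s t u : ℂ, (s, t, u) ∈ regularSet4 → (s, t, u) ∈ genericSet4 →
          RapidExpansion4 s t u ∧ S₄ (s, t, u) = expansion4 s t u) ∧
        (∀ p ∈ regularSet4, Tendsto (fun q : ℂ × ℂ × ℂ => expansion4 q.1 q.2.1 q.2.2)
          (𝓝[regularSet4 ∩ genericSet4] p) (𝓝 (S₄ p))) ∧
        (∀ p ∉ regularSet4, IsTrueSingularity S₄ regularSet4 p)) := by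
  refine ⟨exists_isTornheim, fun T hT => ⟨?_, ?_⟩⟩
  · obtain ⟨N, hN, h⟩ := exists_numer_eq_mul zero_le_one
    have hd : DifferentiableOn ℂ (continuedSum 0 N) regularSet3 := by
      rw [regularSet3_eq]
      exact differentiableOn_continuedSum 0 hN
    have ho : IsOpen regularSet3 := by
      rw [regularSet3_eq]
      exact isOpen_polar_ne_zero 0
    refine ⟨continuedSum 0 N, hd, fun s t u hp => ?_, fun s t u hp hg =>
      ⟨rapidExpansion3 s t u, continuedSum_eq_expansion3 h hp hg⟩, fun p hp => ?_, fun p hp => ?_⟩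
    · rw [hT.continuedSum_eq zero_le_one hN h hp]
      simp
    -- The removable-singularity clause is continuity of the continued sum, with which the expansion
    -- coincides at all generic points of the regular set.
    · refine ((hd.differentiableAt (ho.mem_nhds hp)).continuousAt.tendsto.mono_left
        nhdsWithin_le_nhds).congr' ?_
      filter_upwards [self_mem_nhdsWithin] with q hq
      exact continuedSum_eq_expansion3 h hq.1 hq.2
    · rw [regularSet3_eq] at hp ⊢
      exact isTrueSingularity_continuedSum hN h (not_not.1 hp)
  · obtain ⟨N, hN, h⟩ := exists_numer_eq_mul le_rfl
    have hd : DifferentiableOn ℂ (continuedSum 1 N) regularSet4 := by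
      rw [regularSet4_eq]
      exact differentiableOn_continuedSum 1 hN
    have ho : IsOpen regularSet4 := by
      rw [regularSet4_eq]
      exact isOpen_polar_ne_zero 1
    refine ⟨continuedSum 1 N, hd, fun s t u hp => ?_, fun s t u hp hg =>
      ⟨rapidExpansion4 s t u, continuedSum_eq_expansion4 h hp hg⟩, fun p hp => ?_, fun p hp => ?_⟩
    · rw [hT.continuedSum_eq le_rfl hN h hp]
      simp
    · refine ((hd.differentiableAt (ho.mem_nhds hp)).continuousAt.tendsto.mono_left
        nhdsWithin_le_nhds).congr' ?_
      filter_upwards [self_mem_nhdsWithin] with q hq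
      exact continuedSum_eq_expansion4 h hq.1 hq.2
    · rw [regularSet4_eq] at hp ⊢
      exact isTrueSingularity_continuedSum hN h (not_not.1 hp)
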